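/- Let $n>2$, let $M$ be a connected smooth (Hausdorff, second countable) $n$-manifold without boundary, and let $(\eta,\nabla)$ be an equiaffine $SL(n,\mathbb R)$-structure on $M$: $\nabla$ is a smooth torsion-free linear connection and $\eta$ is a nowhere vanishing smooth $n$-form with $\nabla\eta=0$. Assume that the structure is equiprojective, i.e. its Weyl projective curvature tensor vanishes: $$R(X,Y)Z=\frac1{n-1}\bigl(\mathrm{Ric}(Y,Z)X-\mathrm{Ric}(X,Z)Y\bigr),\qquad \mathrm{Ric}(Y,Z)=\mathrm{trace}\bigl(X\mapsto R(X,Y)Z\bigr).$$ Let $1\le p\le n-1$. For an open set $U\subseteq M$ let $\mathbf K^p(U,\mathbb R)$ be the real vector space of Killing–Yano tensors of degree $p$ on $U$, i.e. of the smooth $p$-forms $\omega$ on $U$ such that the $(p-1)$-form $i_{d\gamma/dt}\,\omega$ is parallel along every geodesic $\gamma$ in $U$. Then locally $$\dim \mathbf K^p=\frac{(n+1)!}{(p+1)!\,(n-p)!},$$ and this is the maximal number of linearly independent Killing–Yano tensors of degree $p$. Precisely: 1. every neighbourhood of every point of $M$ contains a connected open neighbourhood $U$ of that point with $\dim\mathbf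 K^p(U,\mathbb R)=\frac{(n+1)!}{(p+1)!(n-p)!}$; 2. this equality holds for every simply connected open set $U\subseteq M$, in particular for $U=M$ if $M$ is simply connected; 3. for every nonempty connected open set $U\subseteq M$, in particular for $U=M$, the space $\mathbf K^p(U,\mathbb R)$ is finite-dimensional and $\dim\mathbf K^p(U,\mathbb R)\le\frac{(n+1)!}{(p+1)!(n-p)!}$. -/

import Mathlib

open Bundle Set
open scoped Manifold ContDiff Topology Nat

noncomputable section

namespace KillingYano

section Tensors

variable {n : ℕ} {M : Type*} [TopologicalSpace M] [ChartedSpace (EuclideanSpace ℝ (Fin n)) M]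

/-- The fibre of `Λ^p(T*M)` at `x`. (The tangent spaces are finite-dimensional, so no continuity
condition is needed.) -/
abbrev FormAt (n : ℕ) {M : Type*} [TopologicalSpace M]
    [ChartedSpace (EuclideanSpace ℝ (Fin n)) M] (p : ℕ) (x : M) : Type :=
  (TangentSpace (𝓡 n) x) [⋀^Fin p]→ₗ[ℝ] ℝ

/-- A vector field on `M` is smooth, as a section of the tangent bundle. -/
def IsSmoothField [IsManifold (𝓡 n) ∞ M] (X : Π x : M, TangentSpace (𝓡 n) x) : Prop :=
  ContMDiff (𝓡 n) (𝓡 n).tangent ∞ (fun x ↦ (⟨x, X x⟩ : TangentBundle (𝓡 n) M))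

/-- A field of `p`-forms is smooth on `U`: its values on smooth vector fields are smooth
functions on `U`. -/
def IsSmoothFormOn [IsManifold (𝓡 n) ∞ M] {p : ℕ} (θ : Π x : M, FormAt n p x) (U : Set M) : Prop :=
  ∀ Y : Fin p → Π x : M, TangentSpace (𝓡 n) x, (∀ i, IsSmoothField (Y i)) →
    ContMDiffOn (𝓡 n) 𝓘(ℝ, ℝ) ∞ (fun x ↦ θ x (fun i ↦ Y i x)) U

/-- The interior product `i_v θ` of a `p`-form with a vector: `v` is inserted in the first
slot of `θ`. As usual it is zero for `p = 0`. -/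
def interior {V : Type*} [AddCommGroup V] [Module ℝ V] :
    {p : ℕ} → V [⋀^Fin p]→ₗ[ℝ] ℝ → V → V [⋀^Fin (p - 1)]→ₗ[ℝ] ℝ
  | 0, _, _ => 0
  | _ + 1, θ, v => θ.curryLeft v

theorem interior_add {V : Type*} [AddCommGroup V] [Module ℝ V] {p : ℕ}
    (θ θ' : V [⋀^Fin p]→ₗ[ℝ] ℝ) (v : V) :
    interior (θ + θ') v = interior θ v + interior θ' v := by
  cases p with
  | zero => simp [interior]
  | succ q => rfl

theorem interior_smul {V : Type*} [AddCommGroup V] [Module ℝ V] {p : ℕ}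
    (c : ℝ) (θ : V [⋀^Fin p]→ₗ[ℝ] ℝ) (v : V) :
    interior (c • θ) v = c • interior θ v := by
  cases p with
  | zero => simp [interior]
  | succ q => rfl

theorem interior_zero {V : Type*} [AddCommGroup V] [Module ℝ V] {p : ℕ} (v : V) :
    interior (0 : V [⋀^Fin p]→ₗ[ℝ] ℝ) v = 0 := by
  cases p with
  | zero => rfl
  | succ q => rfl

end Tensors

section Connections

variable {n : ℕ} {M : Type*} [TopologicalSpace M] [ChartedSpace (EuclideanSpace ℝ (Fin n)) M]
  [IsManifold (𝓡 n) ∞ M]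

/-- Linear connections on `M` (not yet assumed smooth or torsion-free).
The value `D X x v` is `∇_v X` at `x`. -/
abbrev Connection (n : ℕ) (M : Type*) [TopologicalSpace M]
    [ChartedSpace (EuclideanSpace ℝ (Fin n)) M] [IsManifold (𝓡 n) ∞ M] :=
  CovariantDerivative (𝓡 n) (EuclideanSpace ℝ (Fin n)) (TangentSpace (𝓡 n) : M → Type)

/-- `R(X, Y) Z = ∇_X ∇_Y Z - ∇_Y ∇_X Z - ∇_[X, Y] Z` for vector fields `X`, `Y`, `Z`. -/
def curvature (D : Connection n M) (X Y Z : Π x : M, TangentSpace (𝓡 n) x) (x : M) :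
    TangentSpace (𝓡 n) x :=
  D (fun y ↦ D Z y (Y y)) x (X x) - D (fun y ↦ D Z y (X y)) x (Y x)
    - D Z x (VectorField.mlieBracket (𝓡 n) X Y x)

/-- The curvature tensor `R(u, v) w` on tangent vectors at `x`: the vectors are extended to
vector fields that have constant components in the preferred chart at `x`. -/
def curvatureAt (D : Connection n M) (x : M) (u v w : TangentSpace (𝓡 n) x) :
    TangentSpace (𝓡 n) x :=
  curvature D (FiberBundle.extend (EuclideanSpace ℝ (Fin n)) u)
    (FiberBundle.extend (EuclideanSpace ℝ (Fin n)) v)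
    (FiberBundle.extend (EuclideanSpace ℝ (Fin n)) w) x

/-- The Ricci tensor `Ric(v, w) = trace (u ↦ R(u, v) w)`, the trace being computed in the standard
basis of the tangent space. -/
def ricciAt (D : Connection n M) (x : M) (v w : TangentSpace (𝓡 n) x) : ℝ :=
  ∑ i : Fin n, (show EuclideanSpace ℝ (Fin n) from
    curvatureAt D x (show TangentSpace (𝓡 n) x from EuclideanSpace.single i (1 : ℝ)) v w) i

/-- The field of `p`-forms `η` is parallel, `∇ η = 0`. -/
def IsParallelForm (D : Connection n M) {p : ℕ} (η : Π x : M, FormAt n p x) : Prop :=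
  ∀ Y : Fin p → Π x : M, TangentSpace (𝓡 n) x, (∀ i, IsSmoothField (Y i)) →
    ∀ (x : M) (v : TangentSpace (𝓡 n) x),
      mvfderiv (𝓡 n) (fun y ↦ η y (fun i ↦ Y i y)) x v
        = ∑ i, η x (Function.update (fun j ↦ Y j x) i (D (Y i) x v))

/-- The velocity vector `dγ/dt`. -/
def velocity (n : ℕ) {M : Type*} [TopologicalSpace M]
    [ChartedSpace (EuclideanSpace ℝ (Fin n)) M] (γ : ℝ → M) (t : ℝ) :
    TangentSpace (𝓡 n) (γ t) :=
  mfderiv 𝓘(ℝ, ℝ) (𝓡 n) γ t (1 : ℝ)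

/-- A vector field along the curve `γ` is smooth on `J`. -/
def IsSmoothAlong (γ : ℝ → M) (J : Set ℝ) (V : Π t : ℝ, TangentSpace (𝓡 n) (γ t)) : Prop :=
  ContMDiffOn 𝓘(ℝ, ℝ) (𝓡 n).tangent ∞ (fun t ↦ (⟨γ t, V t⟩ : TangentBundle (𝓡 n) M)) J

/-- The covariant derivative `∇_{dγ/dt} V` at time `t` of a vector field `V` along `γ`. If
`V = ∑ f_i E_i` for the coordinate frame `E_i` of the preferred chart at `γ t`, then the first
summand is `∑ f_i'(t) E_i` and the second one is `∑ f_i(t) ∇_{dγ/dt} E_i`. -/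
def covDerivAlong (D : Connection n M) (γ : ℝ → M) (V : Π t : ℝ, TangentSpace (𝓡 n) (γ t))
    (t : ℝ) : TangentSpace (𝓡 n) (γ t) :=
  (trivializationAt (EuclideanSpace ℝ (Fin n)) (TangentSpace (𝓡 n) : M → Type) (γ t)).symm (γ t)
      (deriv (fun s ↦ (trivializationAt (EuclideanSpace ℝ (Fin n))
        (TangentSpace (𝓡 n) : M → Type) (γ t) ⟨γ s, V s⟩).2) t)
    + D (FiberBundle.extend (EuclideanSpace ℝ (Fin n)) (V t)) (γ t) (velocity n γ t)

/-- `γ` is a geodesic on `J`, with affine parameter: `∇_{dγ/dt} dγ/dt = 0`. -/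
structure IsGeodesicOn (D : Connection n M) (γ : ℝ → M) (J : Set ℝ) : Prop where
  smooth : ContMDiffOn 𝓘(ℝ, ℝ) (𝓡 n) ∞ γ J
  eq_zero : ∀ t ∈ J, covDerivAlong D γ (velocity n γ) t = 0

/-- A field `α` of `q`-forms along `γ` is parallel along `γ` on `J`: for all smooth vector fields
`V_1, …, V_q` along `γ`, the derivative of `α(V_1, …, V_q)` is
`∑ α(V_1, …, ∇_{dγ/dt} V_i, …, V_q)`. -/
def IsParallelAlong (D : Connection n M) (γ : ℝ → M) (J : Set ℝ) {q : ℕ}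
    (α : Π t : ℝ, FormAt n q (γ t)) : Prop :=
  ∀ V : Fin q → Π t : ℝ, TangentSpace (𝓡 n) (γ t), (∀ i, IsSmoothAlong γ J (V i)) →
    ∀ t ∈ J, HasDerivAt (fun s ↦ α s (fun i ↦ V i s))
      (∑ i, α t (Function.update (fun j ↦ V j t) i (covDerivAlong D γ (V i) t))) t

end Connections

section Structures

/-- An equiaffine `SL(n, ℝ)`-structure `(η, ∇)` on `M`: a smooth torsion-free linear connection
`∇` and a smooth nowhere vanishing `n`-form `η` with `∇ η = 0`. -/
structure EquiaffineStructure (n : ℕ) (M : Type*) [TopologicalSpace M]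
    [ChartedSpace (EuclideanSpace ℝ (Fin n)) M] [IsManifold (𝓡 n) ∞ M] where
  conn : Connection n M
  smooth_conn : CovariantDerivative.ContMDiffCovariantDerivative conn ∞
  torsion_eq_zero : conn.torsion = 0
  vol : Π x : M, FormAt n n x
  smooth_vol : IsSmoothFormOn vol univ
  vol_ne_zero : ∀ x, vol x ≠ 0
  parallel_vol : IsParallelForm conn vol

variable {n : ℕ} {M : Type*} [TopologicalSpace M] [ChartedSpace (EuclideanSpace ℝ (Fin n)) M]
  [IsManifold (𝓡 n) ∞ M]

/-- The structure is equiprojective: the Weyl projective curvature tensor vanishes, that is,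
`R(u, v) w = (n - 1)⁻¹ (Ric(v, w) u - Ric(u, w) v)`. -/
def EquiaffineStructure.IsEquiprojective (S : EquiaffineStructure n M) : Prop :=
  ∀ (x : M) (u v w : TangentSpace (𝓡 n) x),
    curvatureAt S.conn x u v w
      = ((n : ℝ) - 1)⁻¹ • (ricciAt S.conn x v w • u - ricciAt S.conn x u w • v)

/-- `θ` is a Killing–Yano tensor of degree `p` on the open set `U`: it is smooth on `U`, and
`i_{dγ/dt} θ` is parallel along every geodesic `γ : J → U`, `J` an open interval. -/
structure IsKillingYanoOn (S : EquiaffineStructure n M) {p : ℕ} (U : Set M)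
    (θ : Π x : M, FormAt n p x) : Prop where
  smooth : IsSmoothFormOn θ U
  parallel : ∀ (γ : ℝ → M) (J : Set ℝ), IsOpen J → J.OrdConnected → MapsTo γ J U →
    IsGeodesicOn S.conn γ J →
      IsParallelAlong S.conn γ J (fun t ↦ interior (θ (γ t)) (velocity n γ t))

/-- The real vector space `K^p(U, ℝ)` of Killing–Yano tensors of degree `p` on the open set `U`,
a tensor field on `U` being represented by its extension by zero to `M`.
For `U = univ` this is `K^p(M, ℝ)`. -/
def killingYanoSpace (S : EquiaffineStructure n M) (p : ℕ) (U : Set M) :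
    Submodule ℝ (Π x : M, FormAt n p x) where
  carrier := {θ | IsKillingYanoOn S U θ ∧ ∀ x ∉ U, θ x = 0}
  add_mem' := by
    rintro θ θ' ⟨h, h0⟩ ⟨h', h0'⟩
    refine ⟨⟨fun Y hY ↦ (h.smooth Y hY).add (h'.smooth Y hY), ?_⟩, fun x hx ↦ ?_⟩
    · intro γ J hJ hJ' hU hγ V hV t ht
      have := (h.parallel γ J hJ hJ' hU hγ V hV t ht).add
        (h'.parallel γ J hJ hJ' hU hγ V hV t ht)
      simp only [Pi.add_apply, interior_add, AlternatingMap.add_apply, Finset.sum_add_distrib]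
      exact this
    · simp [h0 x hx, h0' x hx]
  zero_mem' := by
    refine ⟨⟨fun Y hY ↦ ?_, ?_⟩, fun x hx ↦ rfl⟩
    · simpa using contMDiffOn_const
    · intro γ J hJ hJ' hU hγ V hV t ht
      simpa [interior_zero] using hasDerivAt_const t (0 : ℝ)
  smul_mem' := by
    rintro c θ ⟨h, h0⟩
    refine ⟨⟨fun Y hY ↦ ?_, ?_⟩, fun x hx ↦ ?_⟩
    · exact (contMDiffOn_const (I := 𝓡 n) (I' := 𝓘(ℝ, ℝ)) (c := c)).smul (h.smooth Y hY)
    · intro γ J hJ hJ' hU hγ V hV t ht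
      have := (h.parallel γ J hJ hJ' hU hγ V hV t ht).const_smul c
      simp only [Pi.smul_apply, interior_smul, AlternatingMap.smul_apply, ← Finset.smul_sum]
      exact this
    · simp [h0 x hx]

end Structures

end KillingYano

end

/-! Since a geodesic leaves every point in every direction, a `p`-form `θ` is Killing–Yano exactly
when `(∇_v θ)(v, …) = 0` for all `v`, that is, when `∇θ` is totally alternating. In the flat
projective model the solutions are the constant `(p+1)`-forms on `ℝ^(n+1)` contracted with the
position vector; there are `(n+1).choose (p+1)` independent ones, which is the asserted number. The
proof transports this model to the manifold by the projective tractor connection on `ℝ × TM`, `∇_v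
(a, X) = (da(v) - P(v, X), ∇_v X + a v)`, where `P` is the normalized Ricci tensor.

Flatness. Vanishing of the Weyl tensor kills the tangential part of the tractor curvature. The
remaining scalar part is a Cotton tensor, and the second Bianchi identity kills it because `n ≥ 3`
(`linCurv_tractorForm`). The linear Frobenius theorem (`exists_local_parallel_section`) then gives a
local frame `G` which turns the tractor connection into `d`. In particular `G(1, 0)` plays the role
of the position vector: its derivative along `v` is `G(0, v)`.

Local classification. A constant form `Ψ` induces `θ(Y) = Ψ(G(1, 0), G(0, Y_1), …)`, which is
Killing–Yano because differentiating `G(1, 0)` along `v` repeats an argument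
(`isKYCoord_modelForm`). Conversely, `θ` and `β = ∇θ` together form a tractor `(p+1)`-form `σ`. Its
derivative is annihilated by `G(1, 0)`; differentiating this relation makes the rest of `dσ`
symmetric in two arguments, while it is alternating in the others, so `dσ = 0`
(`exists_eq_modelForm`). No curvature term has to be computed for this step.

Globalization. Local parameters are unique, so a Killing–Yano tensor on a connected set is
determined by its germ at one point, and restriction to a small set gives the upper bound. Changes
of parameter form a locally constant cocycle; on a simply connected set the associated covering has
global sections, hence every local solution extends (`restrict_surjective`). -/

noncomputable section

namespace KillingYano

/-! ### Calculus of alternating maps evaluated on varying vectors -/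

section Evaluation

variable {X E : Type*} [NormedAddCommGroup X] [NormedSpace ℝ X]
  [NormedAddCommGroup E] [NormedSpace ℝ E] [FiniteDimensional ℝ E] {k : ℕ}

omit [FiniteDimensional ℝ E] in
/-- An alternating map is determined by its values on tuples of basis vectors. -/
theorem alternating_eq_sum_basis {ι : Type*} [Fintype ι] (b : Module.Basis ι ℝ E)
    (α : E [⋀^Fin k]→ₗ[ℝ] ℝ) (Y : Fin k → E) :
    α Y = ∑ f : Fin k → ι, (∏ i, b.repr (Y i) (f i)) * α (fun i ↦ b (f i)) := by
  classical
  conv_lhs => rw [show Y = fun i ↦ ∑ j, b.repr (Y i) j • b j from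
    funext fun i ↦ (b.sum_repr (Y i)).symm]
  change α.toMultilinearMap _ = _
  rw [MultilinearMap.map_sum]
  refine Finset.sum_congr rfl fun f _ ↦ ?_
  rw [MultilinearMap.map_smul_univ, smul_eq_mul]
  rfl

theorem alternating_continuous (α : E [⋀^Fin k]→ₗ[ℝ] ℝ) : Continuous α := by
  let b := Module.finBasis ℝ E
  have : (α : (Fin k → E) → ℝ) = fun Y ↦ ∑ f : Fin k → Fin (Module.finrank ℝ E),
      (∏ i, b.coord (f i) (Y i)) * α (fun i ↦ b (f i)) :=
    funext fun Y ↦ alternating_eq_sum_basis b α Y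
  rw [this]
  refine continuous_finsetSum _ fun f _ ↦ Continuous.mul ?_ continuous_const
  exact continuous_finsetProd _ fun i _ ↦
    (LinearMap.continuous_of_finiteDimensional (b.coord (f i))).comp (continuous_apply i)

theorem contDiffWithinAt_alternating_apply {m : WithTop ℕ∞} {s : Set X} {x : X}
    {α : X → E [⋀^Fin k]→ₗ[ℝ] ℝ} {Y : Fin k → X → E}
    (hα : ∀ Z, ContDiffWithinAt ℝ m (fun y ↦ α y Z) s x)
    (hY : ∀ i, ContDiffWithinAt ℝ m (Y i) s x) :
    ContDiffWithinAt ℝ m (fun y ↦ α y (fun i ↦ Y i y)) s x := by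
  let b := Module.finBasis ℝ E
  have : (fun y ↦ α y (fun i ↦ Y i y)) = fun y ↦ ∑ f : Fin k → Fin (Module.finrank ℝ E),
      (∏ i, (b.coord (f i)).toContinuousLinearMap (Y i y)) * α y (fun i ↦ b (f i)) :=
    funext fun y ↦ alternating_eq_sum_basis b (α y) _
  rw [this]
  refine ContDiffWithinAt.sum fun f _ ↦ ContDiffWithinAt.mul ?_ (hα _)
  exact contDiffWithinAt_prod fun i _ ↦
    (ContinuousLinearMap.contDiff _).contDiffAt.comp_contDiffWithinAt x (hY i)

theorem contDiffOn_alternating_apply {m : WithTop ℕ∞} {s : Set X}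
    {α : X → E [⋀^Fin k]→ₗ[ℝ] ℝ} {Y : Fin k → X → E}
    (hα : ∀ Z, ContDiffOn ℝ m (fun y ↦ α y Z) s) (hY : ∀ i, ContDiffOn ℝ m (Y i) s) :
    ContDiffOn ℝ m (fun y ↦ α y (fun i ↦ Y i y)) s :=
  fun x hx ↦ contDiffWithinAt_alternating_apply (fun Z ↦ hα Z x hx) (fun i ↦ hY i x hx)

/-- The Leibniz rule for `α(Y_1, …, Y_k)`, where `α` and all the `Y_i` vary. -/
theorem hasFDerivAt_alternating_apply {x : X} {α : X → E [⋀^Fin k]→ₗ[ℝ] ℝ} {Y : Fin k → X → E}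
    {Y' : Fin k → X →L[ℝ] E} (hα : ∀ Z, DifferentiableAt ℝ (fun y ↦ α y Z) x)
    (hY : ∀ i, HasFDerivAt (Y i) (Y' i) x) :
    DifferentiableAt ℝ (fun y ↦ α y (fun i ↦ Y i y)) x ∧
    ∀ v, fderiv ℝ (fun y ↦ α y (fun i ↦ Y i y)) x v
      = fderiv ℝ (fun y ↦ α y (fun i ↦ Y i x)) x v
        + ∑ i, α x (Function.update (fun j ↦ Y j x) i (Y' i v)) := by
  let b := Module.finBasis ℝ E
  let c : (Fin k → Fin (Module.finrank ℝ E)) → X → ℝ :=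
    fun f y ↦ ∏ i, (b.coord (f i)).toContinuousLinearMap (Y i y)
  have hc : ∀ f, DifferentiableAt ℝ (c f) x := fun f ↦
    (HasFDerivAt.finsetProd fun i _ ↦
      ((b.coord (f i)).toContinuousLinearMap.hasFDerivAt).comp x (hY i)).differentiableAt
  have key : ∀ β : X → E [⋀^Fin k]→ₗ[ℝ] ℝ, (fun y ↦ β y (fun i ↦ Y i y))
      = fun y ↦ ∑ f, c f y * β y (fun i ↦ b (f i)) := fun β ↦
    funext fun y ↦ alternating_eq_sum_basis b (β y) _
  -- In a basis, the product rule splits the derivative into a part where only `α` moves (`h2`) and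
  -- a part where only the vectors move (`h3`).
  have h1 : HasFDerivAt (fun y ↦ α y (fun i ↦ Y i y))
      (∑ f, (c f x • fderiv ℝ (fun y ↦ α y (fun i ↦ b (f i))) x
        + α x (fun i ↦ b (f i)) • fderiv ℝ (c f) x)) x := by
    rw [key]
    exact HasFDerivAt.fun_sum fun f _ ↦ (hc f).hasFDerivAt.mul (hα _).hasFDerivAt
  have h2 : HasFDerivAt (fun y ↦ α y (fun i ↦ Y i x))
      (∑ f, (c f x • fderiv ℝ (fun y ↦ α y (fun i ↦ b (f i))) x)) x := by
    have : (fun y ↦ α y (fun i ↦ Y i x)) = fun y ↦ ∑ f, c f x * α y (fun i ↦ b (f i)) :=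
      funext fun y ↦ alternating_eq_sum_basis b (α y) _
    rw [this]
    exact HasFDerivAt.fun_sum fun f _ ↦ (hα _).hasFDerivAt.const_mul _
  have h3 : HasFDerivAt (fun y ↦ α x (fun i ↦ Y i y))
      (∑ f, (α x (fun i ↦ b (f i)) • fderiv ℝ (c f) x)) x := by
    rw [key (fun _ ↦ α x)]
    exact HasFDerivAt.fun_sum fun f _ ↦ (hc f).hasFDerivAt.mul_const _
  refine ⟨h1.differentiableAt, fun v ↦ ?_⟩
  let A : ContinuousMultilinearMap ℝ (fun _ : Fin k ↦ E) ℝ :=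
    ⟨(α x).toMultilinearMap, alternating_continuous (α x)⟩
  -- For frozen `α` the multilinear product rule gives the same derivative in the desired basis-free
  -- form.
  have h4 := (HasFDerivAt.multilinear_comp (f := A) hY).unique h3
  have h5 : ∑ i, α x (Function.update (fun j ↦ Y j x) i (Y' i v))
      = (∑ i, (A.toContinuousLinearMap (fun j ↦ Y j x) i) ∘L (Y' i)) v := by
    simp only [sum_apply, ContinuousLinearMap.comp_apply]
    rfl
  rw [h5, h4, h1.fderiv, h2.fderiv]
  simp only [Finset.sum_add_distrib, add_apply]

end Evaluation

/-! ### Linear Frobenius theorem, by solving along rays -/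

section Frobenius

variable {E F : Type*} [NormedAddCommGroup E] [NormedSpace ℝ E]
  [NormedAddCommGroup F] [NormedSpace ℝ F] [CompleteSpace F]

/-- Linear differential equations with small coefficients can be solved on `[0, 1]`. -/
theorem exists_linear_ode_solution {B : ℝ → F →L[ℝ] F} (hB : ContinuousOn B (Icc 0 1))
    (hb : ∀ t ∈ Icc (0 : ℝ) 1, ‖B t‖ ≤ 1 / 2) (f₀ : F) :
    ∃ f : ℝ → F, f 0 = f₀ ∧ (∀ t ∈ Icc (0 : ℝ) 1, HasDerivWithinAt f (B t (f t)) (Icc 0 1) t) ∧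
      ∀ t ∈ Icc (0 : ℝ) 1, ‖f t‖ ≤ ‖f₀‖ * Real.exp 1 := by
  -- On the ball of radius `‖f₀‖` about `f₀` one has `‖x‖ ≤ 2‖f₀‖`, so the speed is at most `‖f₀‖`
  -- and the solution stays in the ball up to time 1.
  have h : IsPicardLindelof (fun t x ↦ B t x) (tmin := 0) (tmax := 1)
      (⟨0, by simp⟩ : Icc (0 : ℝ) 1) f₀ ‖f₀‖₊ 0 ‖f₀‖₊ 1 := by
    refine ⟨fun t ht ↦ ?_, fun x _ ↦ hB.clm_apply continuousOn_const, fun t ht x hx ↦ ?_, ?_⟩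
    · refine (((B t).lipschitz).weaken ?_).lipschitzOnWith
      exact_mod_cast (hb t ht).trans (by norm_num)
    · have h1 : ‖x‖ ≤ 2 * ‖f₀‖ := by
        have h2 : ‖x - f₀‖ ≤ ‖f₀‖ := by simpa [dist_eq_norm] using hx
        calc ‖x‖ = ‖(x - f₀) + f₀‖ := by rw [sub_add_cancel]
          _ ≤ _ := (norm_add_le _ _).trans (by linarith)
      calc ‖B t x‖ ≤ ‖B t‖ * ‖x‖ := (B t).le_opNorm x
        _ ≤ 1 / 2 * (2 * ‖f₀‖) := by gcongr; exact hb t ht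
        _ = _ := by simp
    · simp
  obtain ⟨f, hf0, hf⟩ := h.exists_eq_forall_mem_Icc_hasDerivWithinAt₀
  refine ⟨f, hf0, hf, fun t ht ↦ ?_⟩
  have hg := norm_le_gronwallBound_of_norm_deriv_right_le (f := f) (f' := fun t ↦ B t (f t))
    (δ := ‖f₀‖) (K := 1) (ε := 0) (a := 0) (b := 1)
    (fun t ht ↦ (hf t ht).continuousWithinAt)
    (fun t ht ↦ ((hf t (Ico_subset_Icc_self ht)).mono_of_mem_nhdsWithin
      (Icc_mem_nhdsGE_of_mem ht)))
    (by simpa using (congrArg norm hf0).le)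
    (fun t ht ↦ by
      have := (B t).le_opNorm (f t)
      have h2 := hb t (Ico_subset_Icc_self ht)
      nlinarith [norm_nonneg (f t)]) t ht
  refine hg.trans ?_
  rw [gronwallBound_ε0]
  gcongr
  simpa using ht.2

/-- Second order Taylor estimates near a point. -/
theorem exists_taylor_bound {G : Type*} [NormedAddCommGroup G] [NormedSpace ℝ G]
    {B : E → G} {x₀ : E} (hB : ContDiffAt ℝ 2 B x₀) :
    ∃ r > 0, ∃ C ≥ 0, (∀ x ∈ Metric.ball x₀ r, DifferentiableAt ℝ B x ∧ ‖B x‖ ≤ C ∧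
        ‖fderiv ℝ B x‖ ≤ C) ∧
      ∀ x ∈ Metric.ball x₀ r, ∀ y ∈ Metric.ball x₀ r, ‖B y - B x‖ ≤ C * ‖y - x‖ ∧
        ‖B y - B x - fderiv ℝ B x (y - x)‖ ≤ C * ‖y - x‖ ^ 2 := by
  have hD : ContDiffAt ℝ 1 (fderiv ℝ B) x₀ := hB.fderiv_right (by norm_num)
  obtain ⟨K, t, ht, hK⟩ := hD.exists_lipschitzOnWith
  have h1 : ∀ᶠ x in 𝓝 x₀, DifferentiableAt ℝ B x :=
    (hB.eventually (by simp)).mono fun x hx ↦ hx.differentiableAt (by simp)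
  have h2 : ∀ᶠ x in 𝓝 x₀, ‖B x‖ < ‖B x₀‖ + 1 :=
    hB.continuousAt.norm.eventually_lt continuousAt_const (by linarith)
  have h3 : ∀ᶠ x in 𝓝 x₀, ‖fderiv ℝ B x‖ < ‖fderiv ℝ B x₀‖ + 1 :=
    hD.continuousAt.norm.eventually_lt continuousAt_const (by linarith)
  obtain ⟨r, hr, hb⟩ := Metric.eventually_nhds_iff_ball.1
    ((h1.and (h2.and h3)).and (Filter.eventually_mem_set.2 ht))
  -- One constant dominating the bounds for `B` and its derivative and the Lipschitz constant of the
  -- derivative.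
  let C : ℝ := ‖B x₀‖ + 1 + (‖fderiv ℝ B x₀‖ + 1) + K
  have hK0 : (0 : ℝ) ≤ K := K.2
  refine ⟨r, hr, C, by positivity, fun x hx ↦ ?_, fun x hx y hy ↦ ?_⟩
  · obtain ⟨⟨h1, h2, h3⟩, -⟩ := hb x hx
    refine ⟨h1, h2.le.trans ?_, h3.le.trans ?_⟩ <;> simp only [C] <;>
      linarith [norm_nonneg (B x₀), norm_nonneg (fderiv ℝ B x₀)]
  · have hseg : segment ℝ x y ⊆ Metric.ball x₀ r := (convex_ball x₀ r).segment_subset hx hy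
    constructor
    · refine (convex_segment x y).norm_image_sub_le_of_norm_hasFDerivWithin_le
        (f' := fderiv ℝ B) (fun z hz ↦ (hb z (hseg hz)).1.1.hasFDerivAt.hasFDerivWithinAt)
        (fun z hz ↦ (hb z (hseg hz)).1.2.2.le.trans ?_) (left_mem_segment ℝ x y)
        (right_mem_segment ℝ x y)
      simp only [C]; linarith [norm_nonneg (B x₀), norm_nonneg (fderiv ℝ B x₀)]
    · have : ‖B y - B x - fderiv ℝ B x (y - x)‖ ≤ C * ‖y - x‖ * ‖y - x‖ :=
        (convex_segment x y).norm_image_sub_le_of_norm_hasFDerivWithin_le' (f' := fderiv ℝ B)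
        (fun z hz ↦ (hb z (hseg hz)).1.1.hasFDerivAt.hasFDerivWithinAt)
        (fun z hz ↦ ?_) (left_mem_segment ℝ x y) (right_mem_segment ℝ x y)
      · exact this.trans (by rw [pow_two, mul_assoc])
      · have h4 := hK.norm_sub_le (hb z (hseg hz)).2 (hb x hx).2
        refine h4.trans ?_
        have h5 : ‖z - x‖ ≤ ‖y - x‖ := by
          obtain ⟨a, ⟨ha0, ha1⟩, rfl⟩ := segment_eq_image' ℝ x y ▸ hz
          simp only [add_sub_cancel_left, norm_smul, Real.norm_eq_abs, abs_of_nonneg ha0]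
          nlinarith [norm_nonneg (y - x)]
        have h6 : (K : ℝ) ≤ C := by
          simp only [C]; linarith [norm_nonneg (B x₀), norm_nonneg (fderiv ℝ B x₀)]
        gcongr

omit [CompleteSpace F] in
theorem hasDerivAt_comp_line {B : E → F} {x₀ v : E} {t : ℝ}
    (h : DifferentiableAt ℝ B (x₀ + t • v)) :
    HasDerivAt (fun t : ℝ ↦ B (x₀ + t • v)) (fderiv ℝ B (x₀ + t • v) v) t := by
  have h1 : HasDerivAt (fun t : ℝ ↦ x₀ + t • v) v t := by
    simpa using ((hasDerivAt_id t).smul_const v).const_add x₀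
  exact h.hasFDerivAt.comp_hasDerivAt t h1

omit [CompleteSpace F] in
theorem hasDerivAt_clm_line {B : E → E →L[ℝ] F} {x₀ v : E} {t : ℝ}
    (h : DifferentiableAt ℝ B (x₀ + t • v)) (w : E) :
    HasDerivAt (fun t : ℝ ↦ B (x₀ + t • v) w) (fderiv ℝ B (x₀ + t • v) v w) t := by
  have := (hasDerivAt_comp_line h).clm_apply (hasDerivAt_const t w)
  simpa using this

-- For `f` and `g` solutions along neighbouring rays and `b` the coefficient in the direction of
-- their difference, this differentiates the defect of the expected first order expansion.
omit [CompleteSpace F] in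
theorem hasDerivWithinAt_sub_sub_smul {f g : ℝ → F} {f' g' : F} {b : ℝ → F →L[ℝ] F}
    {b' : F →L[ℝ] F} {s : Set ℝ} {t : ℝ} (hf : HasDerivWithinAt f f' s t)
    (hg : HasDerivWithinAt g g' s t) (hb : HasDerivWithinAt b b' s t) :
    HasDerivWithinAt (fun t ↦ f t - g t - t • b t (g t))
      (f' - g' - (t • (b t g' + b' (g t)) + b t (g t))) s t := by
  have e3 := (hasDerivWithinAt_id t s).smul (hb.clm_apply hg)
  refine ((hf.sub hg).sub e3).congr_deriv ?_
  simp only [id, one_smul]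
  congr 3
  abel

omit [CompleteSpace F] in
/-- The defect of the linearisation of a radial solution satisfies a differential inequality. -/
theorem norm_linearization_defect_le {Bx By : E →L[ℝ] F →L[ℝ] F} {D : E →L[ℝ] E →L[ℝ] F →L[ℝ] F}
    {C N t : ℝ} {v h : E} {f g : F} (hC : 0 ≤ C) (ht : t ∈ Icc (0 : ℝ) 1)
    (hflt : D v h g + Bx h (Bx v g) = D h v g + Bx v (Bx h g))
    (hxy1 : ‖By - Bx‖ ≤ C * ‖t • h‖) (hxy2 : ‖By - Bx - D (t • h)‖ ≤ C * ‖t • h‖ ^ 2)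
    (hBx : ‖Bx‖ ≤ C) (hBy : ‖By (v + h)‖ ≤ 1 / 2) (hg : ‖g‖ ≤ N) (hv1 : ‖v‖ ≤ 1)
    (hvh1 : ‖v + h‖ ≤ 1) :
    ‖By (v + h) f - Bx v g - (t • (Bx h (Bx v g) + D v h g) + Bx h g)‖
      ≤ 1 * ‖f - g - t • Bx h g‖ + (2 * C + 2 * C ^ 2) * N * ‖h‖ ^ 2 := by
  have ht0 : ‖t • h‖ ≤ ‖h‖ := by
    rw [norm_smul, Real.norm_eq_abs, abs_of_nonneg ht.1]
    nlinarith [norm_nonneg h, ht.2]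
  have ht1 : ‖t‖ ≤ 1 := by rw [Real.norm_eq_abs, abs_of_nonneg ht.1]; exact ht.2
  have hxy1' : ‖By - Bx‖ ≤ C * ‖h‖ := hxy1.trans (by gcongr)
  have hxy2' : ‖By - Bx - D (t • h)‖ ≤ C * ‖h‖ ^ 2 := hxy2.trans (by gcongr)
  have hBhg : ‖Bx h g‖ ≤ C * ‖h‖ * N := (Bx.le_opNorm₂ h g).trans (by gcongr)
  -- Integrability exchanges `v` and `h` in the second order terms. All terms linear in `h` then
  -- cancel: the first summand is governed by the defect, the others are quadratic in `h`.
  have hsplit : By (v + h) f - Bx v g - (t • (Bx h (Bx v g) + D v h g) + Bx h g)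
      = By (v + h) (f - g - t • Bx h g) + (By - Bx - D (t • h)) v g
        + (By - Bx) h g + (t • (By - Bx) (v + h) (Bx h g) + t • Bx h (Bx h g)) := by
    have : t • (Bx h (Bx v g) + D v h g) = t • (D h v g + Bx v (Bx h g)) := by
      rw [← hflt, add_comm]
    rw [this]
    have a1 : ∀ k g, (By - Bx) k g = By k g - Bx k g := fun _ _ ↦ rfl
    have a2 : (By - Bx - D (t • h)) v g = By v g - Bx v g - D (t • h) v g := rfl
    have a3 : D (t • h) v g = t • D h v g := by rw [D.map_smul]; rfl
    have a4 : ∀ f, By (v + h) f = By v f + By h f := fun f ↦ by rw [By.map_add]; rfl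
    have a5 : By (v + h) (f - g - t • Bx h g)
        = By (v + h) f - By (v + h) g - t • By (v + h) (Bx h g) := by
      rw [(By (v + h)).map_sub, (By (v + h)).map_sub, (By (v + h)).map_smul]
    have a6 : (By - Bx) (v + h) (Bx h g)
        = By (v + h) (Bx h g) - (Bx v (Bx h g) + Bx h (Bx h g)) := by
      rw [a1, Bx.map_add]; rfl
    rw [a5, a6, a2, a3, a1]
    simp only [a4, smul_add, smul_sub]
    abel
  rw [hsplit]
  have n1 : ‖By (v + h) (f - g - t • Bx h g)‖ ≤ 1 * ‖f - g - t • Bx h g‖ :=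
    ((By (v + h)).le_opNorm _).trans (by gcongr; linarith)
  have n2 : ‖(By - Bx - D (t • h)) v g‖ ≤ C * ‖h‖ ^ 2 * 1 * N :=
    (ContinuousLinearMap.le_opNorm₂ _ v g).trans (by gcongr)
  have n3 : ‖(By - Bx) h g‖ ≤ C * ‖h‖ * ‖h‖ * N :=
    (ContinuousLinearMap.le_opNorm₂ _ h g).trans (by gcongr)
  have n4 : ‖t • (By - Bx) (v + h) (Bx h g)‖ ≤ 1 * (C * ‖h‖ * 1 * (C * ‖h‖ * N)) := by
    rw [norm_smul]
    exact mul_le_mul ht1 ((ContinuousLinearMap.le_opNorm₂ _ _ _).trans (by gcongr))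
      (norm_nonneg _) zero_le_one
  have n5 : ‖t • Bx h (Bx h g)‖ ≤ 1 * (C * ‖h‖ * (C * ‖h‖ * N)) := by
    rw [norm_smul]
    exact mul_le_mul ht1 ((ContinuousLinearMap.le_opNorm₂ _ _ _).trans (by gcongr))
      (norm_nonneg _) zero_le_one
  refine (norm_add_le _ _).trans ((add_le_add (norm_add₃_le.trans
    (add_le_add (add_le_add n1 n2) n3)) ((norm_add_le _ _).trans (add_le_add n4 n5))).trans
    (le_of_eq ?_))
  ring

/-- The Frobenius theorem for linear total differential equations: if the integrability condition
holds, then `df(v) = B(v) f` has a local solution with prescribed value at a point. -/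
theorem exists_local_parallel_section {B : E → E →L[ℝ] F →L[ℝ] F} {x₀ : E}
    (hB : ContDiffAt ℝ 2 B x₀)
    (hflat : ∀ᶠ x in 𝓝 x₀, ∀ u v : E, ∀ f : F,
      fderiv ℝ B x u v f + B x v (B x u f) = fderiv ℝ B x v u f + B x u (B x v f)) (f₀ : F) :
    ∃ r > 0, ∃ f : E → F, f x₀ = f₀ ∧
      ∀ x ∈ Metric.ball x₀ r, HasFDerivAt f ((B x).flip (f x)) x := by
  obtain ⟨r₁, hr₁, C, hC, hb, htay⟩ := exists_taylor_bound hB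
  obtain ⟨r₂, hr₂, hfl⟩ := Metric.eventually_nhds_iff_ball.1 hflat
  -- `C * r ≤ 1 / 2` makes the ray equation solvable up to time 1, and `r ≤ 1` normalizes the
  -- directions in the defect estimate.
  obtain ⟨r, hr, hrr₁, hrr₂, hr1, hrC⟩ :
      ∃ r > 0, r ≤ r₁ ∧ r ≤ r₂ ∧ r ≤ 1 ∧ C * r ≤ 1 / 2 := by
    refine ⟨min (min r₁ r₂) (min 1 (1 / (2 * (C + 1)))), by positivity, ?_, ?_, ?_, ?_⟩
    · exact (min_le_left _ _).trans (min_le_left _ _)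
    · exact (min_le_left _ _).trans (min_le_right _ _)
    · exact (min_le_right _ _).trans (min_le_left _ _)
    · calc C * min (min r₁ r₂) (min 1 (1 / (2 * (C + 1)))) ≤ (C + 1) * (1 / (2 * (C + 1))) := by
            gcongr
            · linarith
            · exact (min_le_right _ _).trans (min_le_right _ _)
        _ = 1 / 2 := by field_simp
  have hmem : ∀ {v : E}, ‖v‖ < r → ∀ t ∈ Icc (0 : ℝ) 1, x₀ + t • v ∈ Metric.ball x₀ r := by
    intro v hv t ht
    rw [Metric.mem_ball, dist_eq_norm, add_sub_cancel_left, norm_smul, Real.norm_eq_abs,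
      abs_of_nonneg ht.1]
    nlinarith [norm_nonneg v, ht.2]
  have hBd : ∀ {v : E}, ‖v‖ < r → ∀ t ∈ Icc (0 : ℝ) 1, DifferentiableAt ℝ B (x₀ + t • v) :=
    fun hv t ht ↦ (hb _ (Metric.ball_subset_ball hrr₁ (hmem hv t ht))).1
  have hCn : ∀ {v : E}, ‖v‖ < r → ∀ t ∈ Icc (0 : ℝ) 1, ‖B (x₀ + t • v)‖ ≤ C := fun hv t ht ↦
    (hb _ (Metric.ball_subset_ball hrr₁ (hmem hv t ht))).2.1
  have hhalf : ∀ {v : E}, ‖v‖ < r → ∀ t ∈ Icc (0 : ℝ) 1, ‖B (x₀ + t • v) v‖ ≤ 1 / 2 :=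
    fun hv t ht ↦ ((B _).le_opNorm _).trans
      ((mul_le_mul (hCn hv t ht) hv.le (norm_nonneg _) hC).trans hrC)
  -- The equation restricted to the ray `t ↦ x₀ + t • v`. The candidate for `f (x₀ + v)` is the
  -- value of its solution at time 1.
  have hsol : ∀ v : E, ∃ sol : ℝ → F, ‖v‖ < r → sol 0 = f₀ ∧
      (∀ t ∈ Icc (0 : ℝ) 1, HasDerivWithinAt sol (B (x₀ + t • v) v (sol t)) (Icc 0 1) t) ∧
      ∀ t ∈ Icc (0 : ℝ) 1, ‖sol t‖ ≤ ‖f₀‖ * Real.exp 1 := by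
    intro v
    by_cases hv : ‖v‖ < r
    · obtain ⟨sol, h⟩ := exists_linear_ode_solution (B := fun t ↦ B (x₀ + t • v) v)
        (fun t ht ↦ (hasDerivAt_clm_line (hBd hv t ht) v).continuousAt.continuousWithinAt)
        (hhalf hv) f₀
      exact ⟨sol, fun _ ↦ h⟩
    · exact ⟨0, fun h ↦ absurd h hv⟩
  choose sol hsol using hsol
  refine ⟨r, hr, fun x ↦ sol (x - x₀) 1, ?_, fun x hx ↦ ?_⟩
  · obtain ⟨h0, h1, -⟩ := hsol 0 (by simpa using hr)
    have := norm_image_sub_le_of_norm_deriv_le_segment_01' (C := 0) h1 (fun t _ ↦ by simp)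
    change sol (x₀ - x₀) 1 = f₀
    rw [sub_self, ← h0]
    exact sub_eq_zero.1 (norm_le_zero_iff.1 this)
  obtain ⟨v, rfl⟩ : ∃ v, x = x₀ + v := ⟨x - x₀, by abel⟩
  have hv : ‖v‖ < r := by simpa [dist_eq_norm] using hx
  obtain ⟨hG0, hG, hGn⟩ := hsol v hv
  let N : ℝ := ‖f₀‖ * Real.exp 1
  have hN : 0 ≤ N := by positivity
  let C' : ℝ := (2 * C + 2 * C ^ 2) * N
  -- The defect starts at zero and satisfies a differential inequality with error `C' * ‖h‖ ^ 2`;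
  -- Grönwall's bound at time 1 is the differentiability of `f` with the prescribed derivative.
  have hmain : ∀ h : E, ‖h‖ < r - ‖v‖ →
      ‖sol (v + h) 1 - sol v 1 - B (x₀ + v) h (sol v 1)‖ ≤ C' * (Real.exp 1 - 1) * ‖h‖ ^ 2 := by
    intro h hh
    have hvh : ‖v + h‖ < r := (norm_add_le _ _).trans_lt (by linarith)
    obtain ⟨hF0, hF, -⟩ := hsol (v + h) hvh
    have hD : ∀ t ∈ Icc (0 : ℝ) 1, HasDerivWithinAt
        (fun t ↦ sol (v + h) t - sol v t - t • B (x₀ + t • v) h (sol v t))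
        (B (x₀ + t • (v + h)) (v + h) (sol (v + h) t) - B (x₀ + t • v) v (sol v t)
          - (t • (B (x₀ + t • v) h (B (x₀ + t • v) v (sol v t))
            + fderiv ℝ B (x₀ + t • v) v h (sol v t)) + B (x₀ + t • v) h (sol v t)))
        (Icc 0 1) t := by
      exact fun t ht ↦ hasDerivWithinAt_sub_sub_smul (hF t ht) (hG t ht)
        (hasDerivAt_clm_line (hBd hv t ht) h).hasDerivWithinAt
    have hbound := norm_le_gronwallBound_of_norm_deriv_right_le
      (δ := 0) (K := 1) (ε := C' * ‖h‖ ^ 2) (fun t ht ↦ (hD t ht).continuousWithinAt)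
      (fun t ht ↦ ((hD t (Ico_subset_Icc_self ht)).mono_of_mem_nhdsWithin
        (Icc_mem_nhdsGE_of_mem ht))) (by simp [hG0, hF0]) (fun t ht ↦ ?_) 1 (by simp)
    · rw [gronwallBound_of_K_ne_0 one_ne_zero] at hbound
      refine (le_of_eq ?_).trans (hbound.trans (le_of_eq ?_))
      · simp
      · simp; ring
    · replace ht := Ico_subset_Icc_self ht
      have hflt := hfl _ (Metric.ball_subset_ball hrr₂ (hmem hv t ht)) v h (sol v t)
      have hxy := htay _ (Metric.ball_subset_ball hrr₁ (hmem hv t ht)) _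
        (Metric.ball_subset_ball hrr₁ (hmem hvh t ht))
      rw [show x₀ + t • (v + h) - (x₀ + t • v) = t • h by rw [smul_add]; abel] at hxy
      exact norm_linearization_defect_le hC ht hflt hxy.1 hxy.2 (hCn hv t ht)
        (hhalf hvh t ht) (hGn t ht) (hv.le.trans hr1) (hvh.le.trans hr1)
  rw [hasFDerivAt_iff_isLittleO_nhds_zero]
  refine Asymptotics.IsBigO.trans_isLittleO (Asymptotics.IsBigO.of_bound
    (C' * (Real.exp 1 - 1)) ?_) (Asymptotics.isLittleO_norm_pow_id one_lt_two)
  filter_upwards [Metric.ball_mem_nhds (0 : E) (sub_pos.2 hv)] with h hh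
  have := hmain h (by simpa using hh)
  simpa [add_assoc] using this

/-- Solutions of a total differential equation with smooth right-hand side are smooth. -/
theorem contDiffOn_of_hasFDerivAt {E F : Type*} [NormedAddCommGroup E] [NormedSpace ℝ E]
    [NormedAddCommGroup F] [NormedSpace ℝ F] {s : Set E} (hs : IsOpen s)
    {g : E × F → E →L[ℝ] F} {t : Set (E × F)} (hg : ContDiffOn ℝ ∞ g t) {f : E → F}
    (hf : ∀ x ∈ s, HasFDerivAt f (g (x, f x)) x) (ht : ∀ x ∈ s, (x, f x) ∈ t) :
    ContDiffOn ℝ ∞ f s := by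
  rw [contDiffOn_infty]
  intro k
  induction k with
  | zero => exact contDiffOn_zero.2 fun x hx ↦ (hf x hx).continuousAt.continuousWithinAt
  -- If `f` is of class `C^k`, so is the right-hand side, which is the derivative of `f`.
  | succ k ih =>
    rw [Nat.cast_add, Nat.cast_one, contDiffOn_succ_iff_fderiv_of_isOpen hs]
    refine ⟨fun x hx ↦ (hf x hx).differentiableAt.differentiableWithinAt, by simp, ?_⟩
    refine ContDiffOn.congr ?_ fun x hx ↦ (hf x hx).fderiv
    exact (hg.of_le (by exact_mod_cast le_top)).comp (contDiffOn_id.prodMk ih) ht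

end Frobenius

/-! ### Curvature of a connection `d + A` and the Bianchi identity -/

section CLM

variable {X E F G : Type*} [NormedAddCommGroup X] [NormedSpace ℝ X]
  [NormedAddCommGroup E] [NormedSpace ℝ E]
  [NormedAddCommGroup F] [NormedSpace ℝ F] [NormedAddCommGroup G] [NormedSpace ℝ G]

theorem fderiv_clm_apply_const {B : X → F →L[ℝ] G} {x : X} (h : DifferentiableAt ℝ B x) (t : F) :
    DifferentiableAt ℝ (fun y ↦ B y t) x ∧
      ∀ w, fderiv ℝ (fun y ↦ B y t) x w = fderiv ℝ B x w t := by
  have h1 := h.hasFDerivAt.clm_apply (hasFDerivAt_const t x)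
  refine ⟨h1.differentiableAt, fun w ↦ ?_⟩
  rw [h1.fderiv]
  simp

theorem fderiv_clm_apply_apply {B : X → F →L[ℝ] G} {f : X → F} {x : X}
    (h : DifferentiableAt ℝ B x) (hf : DifferentiableAt ℝ f x) :
    DifferentiableAt ℝ (fun y ↦ B y (f y)) x ∧
      ∀ w, fderiv ℝ (fun y ↦ B y (f y)) x w = fderiv ℝ B x w (f x) + B x (fderiv ℝ f x w) := by
  have h1 := h.hasFDerivAt.clm_apply hf.hasFDerivAt
  refine ⟨h1.differentiableAt, fun w ↦ ?_⟩
  rw [h1.fderiv]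
  simp [add_comm]

/-- The curvature of the linear connection `d + A`, acting on `t`. -/
def linCurv (A : E → E →L[ℝ] F →L[ℝ] F) (x u v : E) (t : F) : F :=
  fderiv ℝ A x u v t - fderiv ℝ A x v u t + A x u (A x v t) - A x v (A x u t)

set_option synthInstance.maxHeartbeats 200000 in
theorem fderiv_linCurv {A : E → E →L[ℝ] F →L[ℝ] F} {x : E} (hA : ContDiffAt ℝ 2 A x)
    (w u v : E) (t : F) :
    DifferentiableAt ℝ (fun y ↦ linCurv A y u v t) x ∧
    fderiv ℝ (fun y ↦ linCurv A y u v t) x w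
      = fderiv ℝ (fderiv ℝ A) x w u v t - fderiv ℝ (fderiv ℝ A) x w v u t
        + (fderiv ℝ A x w u (A x v t) + A x u (fderiv ℝ A x w v t))
        - (fderiv ℝ A x w v (A x u t) + A x v (fderiv ℝ A x w u t)) := by
  have hd : DifferentiableAt ℝ A x := hA.differentiableAt (by simp)
  have hdd : DifferentiableAt ℝ (fderiv ℝ A) x :=
    (hA.fderiv_right (m := 1) (by norm_num)).differentiableAt (by simp)
  have e1 : ∀ u v : E, DifferentiableAt ℝ (fun y ↦ fderiv ℝ A y u v t) x ∧
      ∀ w, fderiv ℝ (fun y ↦ fderiv ℝ A y u v t) x w = fderiv ℝ (fderiv ℝ A) x w u v t := by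
    intro u v
    have a := fderiv_clm_apply_const (F := E) (G := E →L[ℝ] F →L[ℝ] F) hdd u
    have b := fderiv_clm_apply_const a.1 v
    have c := fderiv_clm_apply_const b.1 t
    exact ⟨c.1, fun w ↦ by rw [c.2, b.2, a.2]⟩
  have e2 : ∀ u v : E, DifferentiableAt ℝ (fun y ↦ A y u (A y v t)) x ∧
      ∀ w, fderiv ℝ (fun y ↦ A y u (A y v t)) x w
        = fderiv ℝ A x w u (A x v t) + A x u (fderiv ℝ A x w v t) := by
    intro u v
    have a := fderiv_clm_apply_const hd u
    have b := fderiv_clm_apply_const hd v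
    have b' := fderiv_clm_apply_const b.1 t
    have c := fderiv_clm_apply_apply a.1 b'.1
    exact ⟨c.1, fun w ↦ by rw [c.2, a.2, b'.2, b.2]⟩
  have h := ((((e1 u v).1.hasFDerivAt).sub (e1 v u).1.hasFDerivAt).add
    (e2 u v).1.hasFDerivAt).sub (e2 v u).1.hasFDerivAt
  refine ⟨h.differentiableAt, ?_⟩
  rw [← (e1 u v).2, ← (e1 v u).2, ← (e2 u v).2, ← (e2 v u).2]
  exact congrArg (fun L : E →L[ℝ] F ↦ L w) h.fderiv

/-- The second Bianchi identity for `d + A`. -/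
theorem linCurv_bianchi {A : E → E →L[ℝ] F →L[ℝ] F} {x : E} (hA : ContDiffAt ℝ 2 A x)
    (u v w : E) (t : F) :
    (fderiv ℝ (fun y ↦ linCurv A y u v t) x w + A x w (linCurv A x u v t)
        - linCurv A x u v (A x w t))
      + (fderiv ℝ (fun y ↦ linCurv A y v w t) x u + A x u (linCurv A x v w t)
        - linCurv A x v w (A x u t))
      + (fderiv ℝ (fun y ↦ linCurv A y w u t) x v + A x v (linCurv A x w u t)
        - linCurv A x w u (A x v t)) = 0 := by
  -- Symmetry of second derivatives removes the second order terms from the cyclic sum; the products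
  -- cancel algebraically.
  have hs : ∀ a b c, fderiv ℝ (fderiv ℝ A) x a b c t = fderiv ℝ (fderiv ℝ A) x b a c t :=
    fun a b c ↦ by rw [(hA.isSymmSndFDerivAt (by simp)).eq a b]
  rw [(fderiv_linCurv hA w u v t).2, (fderiv_linCurv hA u v w t).2, (fderiv_linCurv hA v w u t).2,
    hs w u v, hs w v u, hs u v w]
  simp only [linCurv, map_add, map_sub]
  abel

end CLM

/-! ### Flatness of the projective tractor connection -/

section Tractor

variable {E : Type*} [NormedAddCommGroup E] [NormedSpace ℝ E]

/-- The connection form of the projective tractor connection on `ℝ × E`. -/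
def tractorForm (P : E →L[ℝ] E →L[ℝ] ℝ) (Γ : E →L[ℝ] E →L[ℝ] E) :
    E →L[ℝ] (ℝ × E) →L[ℝ] (ℝ × E) :=
  (ContinuousLinearMap.smulRightL ℝ (ℝ × E) (ℝ × E) (ContinuousLinearMap.fst ℝ ℝ E)) ∘L
      (ContinuousLinearMap.inr ℝ ℝ E)
    - ((ContinuousLinearMap.compL ℝ (ℝ × E) ℝ (ℝ × E) (ContinuousLinearMap.inl ℝ ℝ E)) ∘L
        ((ContinuousLinearMap.compL ℝ (ℝ × E) E ℝ).flip (ContinuousLinearMap.snd ℝ ℝ E))) ∘L P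
    + ((ContinuousLinearMap.compL ℝ (ℝ × E) E (ℝ × E) (ContinuousLinearMap.inr ℝ ℝ E)) ∘L
        ((ContinuousLinearMap.compL ℝ (ℝ × E) E E).flip (ContinuousLinearMap.snd ℝ ℝ E))) ∘L Γ

theorem tractorForm_apply (P : E →L[ℝ] E →L[ℝ] ℝ) (Γ : E →L[ℝ] E →L[ℝ] E) (v : E) (t : ℝ × E) :
    tractorForm P Γ v t = (-(P v t.2), t.1 • v + Γ v t.2) := by
  change (t.1 • ((0 : ℝ), v) - (P v t.2, (0 : E))) + ((0 : ℝ), Γ v t.2) = _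
  ext <;> simp

theorem contDiffOn_tractorForm {P : E → E →L[ℝ] E →L[ℝ] ℝ} {Γ : E → E →L[ℝ] E →L[ℝ] E}
    {s : Set E} (hP : ContDiffOn ℝ ∞ P s) (hΓ : ContDiffOn ℝ ∞ Γ s) :
    ContDiffOn ℝ ∞ (fun x ↦ tractorForm (P x) (Γ x)) s := by
  unfold tractorForm
  exact (contDiffOn_const.sub (contDiffOn_const.clm_comp hP)).add (contDiffOn_const.clm_comp hΓ)

theorem fderiv_tractorForm {P : E → E →L[ℝ] E →L[ℝ] ℝ} {Γ : E → E →L[ℝ] E →L[ℝ] E} {x : E}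
    (hA : DifferentiableAt ℝ (fun x ↦ tractorForm (P x) (Γ x)) x)
    (hP : DifferentiableAt ℝ P x) (hΓ : DifferentiableAt ℝ Γ x) (u v : E) (t : ℝ × E) :
    fderiv ℝ (fun x ↦ tractorForm (P x) (Γ x)) x u v t
      = (-(fderiv ℝ P x u v t.2), fderiv ℝ Γ x u v t.2) := by
  have a := fderiv_clm_apply_const hA v
  have b := fderiv_clm_apply_const a.1 t
  rw [← a.2, ← b.2]
  simp only [tractorForm_apply]
  have c := fderiv_clm_apply_const hP v
  have c' := fderiv_clm_apply_const c.1 t.2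
  have d := fderiv_clm_apply_const hΓ v
  have d' := fderiv_clm_apply_const d.1 t.2
  have := (c'.1.hasFDerivAt.neg.prodMk (d'.1.hasFDerivAt.const_add (t.1 • v))).fderiv
  refine (congrArg (fun L : E →L[ℝ] ℝ × E ↦ L u) this).trans ?_
  rw [← c.2, ← c'.2, ← d.2, ← d'.2]
  rfl

/-- The `E`-component of the curvature is that of `Γ` corrected by `P`, which is zero by `hW` and
symmetry. The scalar component `κ(u, v)` enters the Bianchi identity only through `κ(u, v) • w` and
its cyclic permutations, so it vanishes as soon as three independent directions exist. -/
theorem linCurv_tractorForm {P : E → E →L[ℝ] E →L[ℝ] ℝ} {Γ : E → E →L[ℝ] E →L[ℝ] E}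
    {s : Set E} (hs : IsOpen s) (hP : ContDiffOn ℝ ∞ P s) (hΓ : ContDiffOn ℝ ∞ Γ s)
    (hsymm : ∀ x ∈ s, ∀ u v, Γ x u v = Γ x v u)
    (hW : ∀ x ∈ s, ∀ u v w, linCurv Γ x u v w = P x v w • u - P x u w • v)
    (hdim : 3 ≤ Module.finrank ℝ E) {x : E} (hx : x ∈ s) (u v : E) (t : ℝ × E) :
    linCurv (fun x ↦ tractorForm (P x) (Γ x)) x u v t = 0 := by
  set A : E → E →L[ℝ] (ℝ × E) →L[ℝ] (ℝ × E) := fun x ↦ tractorForm (P x) (Γ x) with hAdef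
  have hA : ContDiffOn ℝ ∞ A s := contDiffOn_tractorForm hP hΓ
  have hA2 : ∀ y ∈ s, ContDiffAt ℝ 2 A y := fun y hy ↦
    (hA.contDiffAt (hs.mem_nhds hy)).of_le (WithTop.coe_le_coe.2 (le_top (a := (2 : ℕ∞))))
  have hsnd : ∀ y ∈ s, ∀ u v t, (linCurv A y u v t).2 = 0 := by
    intro y hy u v t
    have e := fderiv_tractorForm (P := P) (Γ := Γ) ((hA2 y hy).differentiableAt (by simp))
      ((hP.contDiffAt (hs.mem_nhds hy)).differentiableAt (by simp))
      ((hΓ.contDiffAt (hs.mem_nhds hy)).differentiableAt (by simp))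
    have h := hW y hy u v t.2
    simp only [linCurv] at h ⊢
    rw [e, e]
    simp only [hAdef, tractorForm_apply, Prod.snd_add, Prod.snd_sub, map_add, map_smul]
    rw [hsymm y hy u v]
    have h2 : fderiv ℝ Γ y u v t.2 - fderiv ℝ Γ y v u t.2
        = P y v t.2 • u - P y u t.2 • v - (Γ y u (Γ y v t.2) - Γ y v (Γ y u t.2)) := by
      rw [← h]; abel
    rw [h2]
    simp only [neg_smul]
    abel
  -- The `E`-component of the Bianchi identity: the curvature has no `E`-component near `x`, and `A`
  -- moves its scalar component into `E` as a multiple of the direction.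
  have hcyc : ∀ u v w t, (linCurv A x u v t).1 • w + (linCurv A x v w t).1 • u
      + (linCurv A x w u t).1 • v = 0 := by
    intro u v w t
    have hb := congrArg Prod.snd (linCurv_bianchi (hA2 x hx) u v w t)
    have hd : ∀ u v w, (fderiv ℝ (fun y ↦ linCurv A y u v t) x w).2 = 0 := by
      intro u v w
      have h1 := (fderiv_linCurv (hA2 x hx) w u v t).1.hasFDerivAt.snd
      have h2 : (fun y ↦ (linCurv A y u v t).2) =ᶠ[𝓝 x] fun _ ↦ 0 :=
        Filter.eventually_of_mem (hs.mem_nhds hx) fun y hy ↦ hsnd y hy u v t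
      have h3 := h1.unique ((hasFDerivAt_const (0 : E) x).congr_of_eventuallyEq h2)
      exact congrArg (fun L : E →L[ℝ] E ↦ L w) h3
    have hA' : ∀ a u v, (A x a (linCurv A x u v t)).2 = (linCurv A x u v t).1 • a := by
      intro a u v
      simp only [hAdef, tractorForm_apply]
      rw [← hAdef, hsnd x hx, map_zero, add_zero]
    simpa only [Prod.snd_add, Prod.snd_sub, hd, hA', hsnd x hx, zero_add, sub_zero,
      Prod.snd_zero] using hb
  refine Prod.ext ?_ (hsnd x hx u v t)
  have : FiniteDimensional ℝ E := Module.finite_of_finrank_pos (by omega)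
  -- Dimension at least 3 enters here: a nonzero scalar component would put this `w` into the span
  -- of `u` and `v`.
  obtain ⟨w, hw⟩ : ∃ w, w ∉ Submodule.span ℝ ({u, v} : Set E) := by
    by_contra! h
    have h1 : Submodule.span ℝ ({u, v} : Set E) = ⊤ := by
      rw [eq_top_iff]; exact fun w _ ↦ h w
    classical
    have h2 := finrank_span_finset_le_card (R := ℝ) ({u, v} : Finset E)
    rw [Set.finrank, Finset.coe_pair, h1, finrank_top] at h2
    have h3 := Finset.card_le_two (a := u) (b := v)
    omega
  by_contra hne
  apply hw
  have h := hcyc u v w t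
  have hw' : w = (linCurv A x u v t).1⁻¹ •
      (-(linCurv A x v w t).1 • u + -(linCurv A x w u t).1 • v) := by
    rw [eq_inv_smul_iff₀ hne, neg_smul, neg_smul]
    rw [add_assoc] at h
    rw [eq_neg_of_add_eq_zero_left h]
    abel
  rw [hw', Submodule.mem_span_pair]
  refine ⟨(linCurv A x u v t).1⁻¹ * -(linCurv A x v w t).1,
    (linCurv A x u v t).1⁻¹ * -(linCurv A x w u t).1, ?_⟩
  rw [smul_add, mul_smul, mul_smul]

end Tractor

set_option synthInstance.maxHeartbeats 400000

/-! ### The projective Schouten tensor -/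

section Schouten

variable {E : Type*} [NormedAddCommGroup E] [NormedSpace ℝ E] [FiniteDimensional ℝ E]

/-- A connection in coordinates is projectively flat on `s`: its curvature is
`R(u, v) w = c(v, w) u - c(u, w) v`. -/
structure IsProjFlat (Γ : E → E →L[ℝ] E →L[ℝ] E) (s : Set E) : Prop where
  smooth : ContDiffOn ℝ ∞ Γ s
  symm : ∀ x ∈ s, ∀ u v, Γ x u v = Γ x v u
  curv : ∀ x ∈ s, ∃ c : E → E → ℝ, ∀ u v w, linCurv Γ x u v w = c v w • u - c u w • v

omit [FiniteDimensional ℝ E] in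
theorem linCurv_add_mid (Γ : E → E →L[ℝ] E →L[ℝ] E) (x u v v' w : E) :
    linCurv Γ x u (v + v') w = linCurv Γ x u v w + linCurv Γ x u v' w := by
  have a1 : fderiv ℝ Γ x u (v + v') w = fderiv ℝ Γ x u v w + fderiv ℝ Γ x u v' w := by
    rw [(fderiv ℝ Γ x u).map_add]; rfl
  have a2 : fderiv ℝ Γ x (v + v') u w = fderiv ℝ Γ x v u w + fderiv ℝ Γ x v' u w := by
    rw [(fderiv ℝ Γ x).map_add]; rfl
  have a3 : ∀ a, Γ x (v + v') a = Γ x v a + Γ x v' a := fun a ↦ by rw [(Γ x).map_add]; rfl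
  simp only [linCurv, a1, a2, a3]
  simp only [(Γ x u).map_add]
  abel

omit [FiniteDimensional ℝ E] in
theorem linCurv_smul_mid (Γ : E → E →L[ℝ] E →L[ℝ] E) (a : ℝ) (x u v w : E) :
    linCurv Γ x u (a • v) w = a • linCurv Γ x u v w := by
  have a1 : fderiv ℝ Γ x u (a • v) w = a • fderiv ℝ Γ x u v w := by
    rw [(fderiv ℝ Γ x u).map_smul]; rfl
  have a2 : fderiv ℝ Γ x (a • v) u w = a • fderiv ℝ Γ x v u w := by
    rw [(fderiv ℝ Γ x).map_smul]; rfl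
  have a3 : ∀ b, Γ x (a • v) b = a • Γ x v b := fun b ↦ by rw [(Γ x).map_smul]; rfl
  simp only [linCurv, a1, a2, a3]
  simp only [(Γ x u).map_smul, smul_sub, smul_add]

/-- The projective Schouten tensor, that is, the normalized Ricci tensor. -/
def schouten (Γ : E → E →L[ℝ] E →L[ℝ] E) (x : E) : E →L[ℝ] E →L[ℝ] ℝ :=
  LinearMap.toContinuousLinearMap ((LinearMap.toContinuousLinearMap (𝕜 := ℝ)).toLinearMap ∘ₗ
    LinearMap.mk₂ ℝ (fun v w ↦ ((Module.finrank ℝ E : ℝ) - 1)⁻¹ *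
      ∑ i, (Module.finBasis ℝ E).coord i (linCurv Γ x (Module.finBasis ℝ E i) v w))
      (fun v v' w ↦ by
        simp only [linCurv_add_mid, map_add, Finset.sum_add_distrib, mul_add])
      (fun a v w ↦ by
        simp only [linCurv_smul_mid, map_smul, smul_eq_mul, ← Finset.mul_sum]
        ring)
      (fun v w w' ↦ by
        simp only [linCurv, map_add, map_sub, Finset.sum_add_distrib, Finset.sum_sub_distrib]
        ring)
      (fun a v w ↦ by
        simp only [linCurv, map_smul, ← smul_sub, ← smul_add, smul_eq_mul, ← Finset.mul_sum]
        ring))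

theorem schouten_apply (Γ : E → E →L[ℝ] E →L[ℝ] E) (x v w : E) :
    schouten Γ x v w = ((Module.finrank ℝ E : ℝ) - 1)⁻¹ *
      ∑ i, (Module.finBasis ℝ E).coord i (linCurv Γ x (Module.finBasis ℝ E i) v w) := rfl

omit [FiniteDimensional ℝ E] in
theorem contDiffOn_of_forall_apply_apply {F F' G : Type*} [NormedAddCommGroup F] [NormedSpace ℝ F]
    [NormedAddCommGroup F'] [NormedSpace ℝ F'] [NormedAddCommGroup G] [NormedSpace ℝ G]
    [FiniteDimensional ℝ F] [FiniteDimensional ℝ F'] {m : WithTop ℕ∞}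
    {B : E → F →L[ℝ] F' →L[ℝ] G} {s : Set E}
    (h : ∀ v w, ContDiffOn ℝ m (fun x ↦ B x v w) s) : ContDiffOn ℝ m B s :=
  contDiffOn_clm_apply.2 fun v ↦ contDiffOn_clm_apply.2 fun w ↦ h v w

theorem contDiffOn_schouten {Γ : E → E →L[ℝ] E →L[ℝ] E} {s : Set E} (hs : IsOpen s)
    (hΓ : ContDiffOn ℝ ∞ Γ s) : ContDiffOn ℝ ∞ (schouten Γ) s := by
  refine contDiffOn_of_forall_apply_apply fun v w ↦ ?_
  simp only [schouten_apply]
  refine contDiffOn_const.mul (ContDiffOn.sum fun i _ ↦ ?_)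
  refine (LinearMap.toContinuousLinearMap _).contDiff.comp_contDiffOn
    (f := fun x ↦ linCurv Γ x (Module.finBasis ℝ E i) v w) ?_
  have e0 : ∀ b : E, ContDiffOn ℝ ∞ (fun x ↦ Γ x b w) s := fun b ↦
    (hΓ.clm_apply (contDiffOn_const (c := b))).clm_apply contDiffOn_const
  have e1 : ∀ a b : E, ContDiffOn ℝ ∞ (fun x ↦ fderiv ℝ Γ x a b w) s := by
    intro a b
    refine (((e0 b).fderiv_of_isOpen hs (m := ∞) (by simp)).clm_apply
      (contDiffOn_const (c := a))).congr fun x hx ↦ ?_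
    have c := fderiv_clm_apply_const ((hΓ.contDiffAt (hs.mem_nhds hx)).differentiableAt (by simp)) b
    rw [(fderiv_clm_apply_const c.1 w).2, c.2]
  have e2 : ∀ a b : E, ContDiffOn ℝ ∞ (fun x ↦ Γ x a (Γ x b w)) s := fun a b ↦
    (hΓ.clm_apply (contDiffOn_const (c := a))).clm_apply (e0 b)
  exact (((e1 _ _).sub (e1 _ _)).add (e2 _ _)).sub (e2 _ _)

/-- Taking the trace over `u` in `c v w • u - c u w • v` gives `(n - 1) c(v, w)`, so the unspecified
coefficient is the Schouten tensor, which is visibly smooth. -/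
theorem IsProjFlat.linCurv_eq {Γ : E → E →L[ℝ] E →L[ℝ] E} {s : Set E} (h : IsProjFlat Γ s)
    (hdim : 2 ≤ Module.finrank ℝ E) {x : E} (hx : x ∈ s) (u v w : E) :
    linCurv Γ x u v w = schouten Γ x v w • u - schouten Γ x u w • v := by
  obtain ⟨c, hc⟩ := h.curv x hx
  let b := Module.finBasis ℝ E
  have hnt : Nontrivial E := Module.nontrivial_of_finrank_pos (R := ℝ) (by omega)
  obtain ⟨e, he⟩ := exists_ne (0 : E)
  have hlin : ∀ w v, c v w = ∑ i, b.coord i v * c (b i) w := by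
    intro w v
    have hadd : ∀ v v', c (v + v') w = c v w + c v' w := by
      intro v v'
      have h1 := linCurv_add_mid Γ x e v v' w
      rw [hc, hc, hc] at h1
      have h2 : (c (v + v') w - c v w - c v' w) • e = 0 := by
        rw [sub_smul, sub_smul]
        rw [smul_add, sub_eq_iff_eq_add] at h1
        rw [h1]; abel
      have := (smul_eq_zero.1 h2).resolve_right he
      linarith
    have hsmul : ∀ (a : ℝ) v, c (a • v) w = a * c v w := by
      intro a v
      have h1 := linCurv_smul_mid Γ a x e v w
      rw [hc, hc, smul_sub, smul_comm a (c e w) v] at h1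
      have h2 : (c (a • v) w - a * c v w) • e = 0 := by
        rw [sub_smul, mul_smul, sub_eq_zero]
        exact sub_left_injective h1
      have := (smul_eq_zero.1 h2).resolve_right he
      linarith
    let L : E →ₗ[ℝ] ℝ := ⟨⟨fun v ↦ c v w, fun v v' ↦ hadd v v'⟩, fun a v ↦ hsmul a v⟩
    change L v = ∑ i, b.coord i v * L (b i)
    conv_lhs => rw [← b.sum_repr v, map_sum]
    exact Finset.sum_congr rfl fun i _ ↦ by rw [map_smul]; rfl
  have hP : ∀ v w, schouten Γ x v w = c v w := by
    intro v w
    rw [schouten_apply]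
    have hs : ∑ i, b.coord i (linCurv Γ x (b i) v w)
        = ((Module.finrank ℝ E : ℝ) - 1) * c v w := by
      have : ∀ i, b.coord i (linCurv Γ x (b i) v w) = c v w - b.coord i v * c (b i) w := by
        intro i
        rw [hc, map_sub, map_smul, map_smul]
        simp [mul_comm]
      simp only [this, Finset.sum_sub_distrib]
      rw [← hlin]
      simp
      ring
    rw [hs, ← mul_assoc, inv_mul_cancel₀, one_mul]
    have : (2 : ℝ) ≤ Module.finrank ℝ E := by exact_mod_cast hdim
    linarith
  rw [hP, hP, hc]

end Schouten

/-! ### Parallel frames of flat connections -/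

section Frame

variable {E : Type*} [NormedAddCommGroup E] [NormedSpace ℝ E]

/-- A flat connection on a trivial bundle has a local parallel frame. -/
theorem exists_parallel_frame {𝒜 : Type*} [NormedRing 𝒜] [NormedAlgebra ℝ 𝒜] [CompleteSpace 𝒜]
    {A : E → E →L[ℝ] 𝒜} {s : Set E} (hs : IsOpen s) (hA : ContDiffOn ℝ ∞ A s)
    (hflat : ∀ x ∈ s, ∀ u v,
      fderiv ℝ A x u v + A x u * A x v = fderiv ℝ A x v u + A x v * A x u)
    {x₀ : E} (hx₀ : x₀ ∈ s) :
    ∃ r > 0, Metric.ball x₀ r ⊆ s ∧ ∃ G H : E → 𝒜, ContDiffOn ℝ ∞ G (Metric.ball x₀ r) ∧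
      ContDiffOn ℝ ∞ H (Metric.ball x₀ r) ∧ ∀ x ∈ Metric.ball x₀ r,
        G x * H x = 1 ∧ H x * G x = 1 ∧ ∀ v, fderiv ℝ G x v = G x * A x v := by
  -- The frame equation is `dG(v) = G * A(v)`, hence the coefficient of the Frobenius problem is
  -- right multiplication by `A(v)`.
  let L : 𝒜 →L[ℝ] 𝒜 →L[ℝ] 𝒜 := (ContinuousLinearMap.mul ℝ 𝒜).flip
  let B : E → E →L[ℝ] 𝒜 →L[ℝ] 𝒜 := fun x ↦ L ∘L A x
  have hB : ContDiffOn ℝ ∞ B s := contDiffOn_const.clm_comp hA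
  have hBapp : ∀ x v g, B x v g = g * A x v := fun _ _ _ ↦ rfl
  have hBd : ∀ x ∈ s, ∀ u v g, fderiv ℝ B x u v g = g * fderiv ℝ A x u v := by
    intro x hx u v g
    have hAd := (hA.contDiffAt (hs.mem_nhds hx)).differentiableAt (by simp)
    have hBd := (hB.contDiffAt (hs.mem_nhds hx)).differentiableAt (by simp)
    have a := fderiv_clm_apply_const (F := E) (G := 𝒜 →L[ℝ] 𝒜) hBd v
    have b := fderiv_clm_apply_const a.1 g
    rw [← a.2, ← b.2]
    simp only [hBapp]
    have c := fderiv_clm_apply_const hAd v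
    rw [← c.2, (c.1.hasFDerivAt.const_mul g).fderiv]
    rfl
  obtain ⟨r, hr, G, hG0, hG⟩ := exists_local_parallel_section (x₀ := x₀) (B := B)
    ((hB.contDiffAt (hs.mem_nhds hx₀)).of_le (WithTop.coe_le_coe.2 (le_top (a := (2 : ℕ∞)))))
    (Filter.eventually_of_mem (hs.mem_nhds hx₀) fun x hx u v g ↦ by
      rw [hBd x hx, hBd x hx, hBapp, hBapp, hBapp, hBapp, mul_assoc, mul_assoc, ← mul_add,
        ← mul_add, hflat x hx]) 1
  -- `G x₀ = 1` and units form an open set, so `G` is invertible on a smaller ball.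
  have hopen : IsOpen {g : 𝒜 | IsUnit g} := Units.isOpen
  have hGc : ContinuousAt G x₀ := (hG x₀ (Metric.mem_ball_self hr)).continuousAt
  obtain ⟨r', hr', hball⟩ := Metric.mem_nhds_iff.1 (Filter.inter_mem (hs.mem_nhds hx₀)
    (hGc.preimage_mem_nhds (hopen.mem_nhds (show IsUnit (G x₀) by rw [hG0]; exact isUnit_one))))
  have hsub : Metric.ball x₀ (min r r') ⊆ Metric.ball x₀ r :=
    Metric.ball_subset_ball (min_le_left _ _)
  have hsub' : Metric.ball x₀ (min r r') ⊆ s ∩ G ⁻¹' {g | IsUnit g} :=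
    (Metric.ball_subset_ball (min_le_right _ _)).trans hball
  have hGs : ContDiffOn ℝ ∞ G (Metric.ball x₀ (min r r')) := by
    refine contDiffOn_of_hasFDerivAt (g := fun p : E × 𝒜 ↦ (L.flip p.2) ∘L (A p.1))
      (t := s ×ˢ univ) Metric.isOpen_ball ?_
      (fun x hx ↦ hG x (hsub hx)) (fun x hx ↦ ⟨(hsub' hx).1, mem_univ _⟩)
    have h1 : ContDiffOn ℝ ∞ (fun p : E × 𝒜 ↦ A p.1) (s ×ˢ univ) :=
      hA.comp contDiffOn_fst fun p hp ↦ hp.1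
    exact (L.flip.contDiff.comp_contDiffOn contDiffOn_snd).clm_comp h1
  refine ⟨min r r', lt_min hr hr', fun x hx ↦ (hsub' hx).1, G, fun x ↦ Ring.inverse (G x),
    hGs, fun x hx ↦ ?_, fun x hx ↦ ⟨?_, ?_, fun v ↦ ?_⟩⟩
  · obtain ⟨u, hu⟩ := (hsub' hx).2
    change ContDiffWithinAt ℝ ∞ (Ring.inverse ∘ G) _ _
    refine ContDiffAt.comp_contDiffWithinAt x ?_ (hGs x hx)
    rw [← hu]
    exact contDiffAt_ringInverse ℝ u
  · exact Ring.mul_inverse_cancel _ (hsub' hx).2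
  · exact Ring.inverse_mul_cancel _ (hsub' hx).2
  · rw [(hG x (hsub hx)).fderiv]
    rfl

/-- A parallel frame of the tractor bundle `ℝ × E` on `s`, with its inverse. -/
structure IsTractorFrame (Γ : E → E →L[ℝ] E →L[ℝ] E) (P : E → E →L[ℝ] E →L[ℝ] ℝ)
    (G H : E → (ℝ × E) →L[ℝ] (ℝ × E)) (s : Set E) : Prop where
  smooth : ContDiffOn ℝ ∞ G s
  smooth_inv : ContDiffOn ℝ ∞ H s
  right_inv : ∀ x ∈ s, ∀ t, G x (H x t) = t
  left_inv : ∀ x ∈ s, ∀ t, H x (G x t) = t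
  deriv : ∀ x ∈ s, ∀ v t, fderiv ℝ G x v t = G x (-(P x v t.2), t.1 • v + Γ x v t.2)

/-- `P` is the Schouten tensor, but it stays existential: what follows uses only the rule for `dG`,
where the `P`-term is a multiple of `G(1, 0)`. -/
theorem IsProjFlat.exists_tractorFrame [FiniteDimensional ℝ E]
    {Γ : E → E →L[ℝ] E →L[ℝ] E} {s : Set E} (hs : IsOpen s) (h : IsProjFlat Γ s)
    (hdim : 3 ≤ Module.finrank ℝ E) {x₀ : E} (hx₀ : x₀ ∈ s) :
    ∃ r > 0, Metric.ball x₀ r ⊆ s ∧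
      ∃ P G H, IsTractorFrame Γ P G H (Metric.ball x₀ r) := by
  set P := schouten Γ
  set A : E → E →L[ℝ] (ℝ × E) →L[ℝ] (ℝ × E) := fun x ↦ tractorForm (P x) (Γ x) with hAdef
  have hP := contDiffOn_schouten hs h.smooth
  have hA : ContDiffOn ℝ ∞ A s := contDiffOn_tractorForm hP h.smooth
  have hflat : ∀ x ∈ s, ∀ u v t, linCurv A x u v t = 0 := fun x hx u v t ↦
    linCurv_tractorForm hs hP h.smooth h.symm
      (fun x hx u v w ↦ h.linCurv_eq (by omega) hx u v w) hdim hx u v t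
  obtain ⟨r, hr, hrs, G, H, hG, hH, hGH⟩ := exists_parallel_frame hs hA (fun x hx u v ↦ by
    refine ContinuousLinearMap.ext fun t ↦ ?_
    have h1 := hflat x hx u v t
    rw [linCurv, sub_add_eq_add_sub, sub_sub, sub_eq_zero] at h1
    exact h1) hx₀
  refine ⟨r, hr, hrs, P, G, H, hG, hH, fun x hx t ↦ ?_, fun x hx t ↦ ?_, fun x hx v t ↦ ?_⟩
  · exact congrArg (fun g : (ℝ × E) →L[ℝ] (ℝ × E) ↦ g t) (hGH x hx).1
  · exact congrArg (fun g : (ℝ × E) →L[ℝ] (ℝ × E) ↦ g t) (hGH x hx).2.1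
  · rw [← tractorForm_apply, (hGH x hx).2.2]
    rfl

end Frame

/-! ### Alternating forms on `E` and on `ℝ × E` -/

section AlternatingAlgebra

variable {E : Type*} [AddCommGroup E] [Module ℝ E] {k q : ℕ}

theorem alternating_cons_cons_swap (g : E [⋀^Fin (q + 2)]→ₗ[ℝ] ℝ) (a b : E) (W : Fin q → E) :
    g (Fin.cons a (Fin.cons b W : Fin (q + 1) → E)) =
      -g (Fin.cons b (Fin.cons a W : Fin (q + 1) → E)) := by
  rw [← g.map_swap _ (show (0 : Fin (q + 2)) ≠ 1 by simp)]
  congr 1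
  funext i
  refine Fin.cases ?_ (fun i ↦ Fin.cases ?_ (fun j ↦ ?_) i) i
  · simp
  · have : (Fin.succ 0 : Fin (q + 2)) = 1 := rfl
    simp [this]
  · rw [Function.comp_apply, Equiv.swap_apply_of_ne_of_ne]
    · simp
    · exact Fin.succ_ne_zero _
    · intro h
      exact Fin.succ_ne_zero j (Fin.succ_injective _ h)

/-- An alternating map which vanishes as soon as `e` is in the first slot vanishes as soon as `e`
is in some slot. -/
theorem alternating_eq_zero_of_apply_eq {χ : E [⋀^Fin (k + 1)]→ₗ[ℝ] ℝ} {e : E}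
    (h : ∀ Z : Fin k → E, χ (Fin.cons e Z) = 0) {t : Fin (k + 1) → E} {i : Fin (k + 1)}
    (hi : t i = e) : χ t = 0 := by
  by_cases h0 : i = 0
  · subst h0
    rw [← Fin.cons_self_tail t, hi]
    exact h _
  · have h1 := χ.map_swap t (i := 0) (j := i) (Ne.symm h0)
    have h2 : (t ∘ Equiv.swap 0 i) = Fin.cons e (Fin.tail (t ∘ Equiv.swap 0 i)) := by
      rw [← hi]
      conv_lhs => rw [← Fin.cons_self_tail (t ∘ Equiv.swap 0 i)]
      simp
    rw [h2, h] at h1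
    linarith

/-- A bilinear expression that vanishes on the diagonal extends to an alternating map. -/
theorem exists_alternating_uncurry (f : E →ₗ[ℝ] E [⋀^Fin (q + 1)]→ₗ[ℝ] ℝ)
    (hf : ∀ v Z, f v (Fin.cons v Z) = 0) :
    ∃ g : E [⋀^Fin (q + 2)]→ₗ[ℝ] ℝ, ∀ W, g W = f (W 0) (Fin.tail W) := by
  let m : MultilinearMap ℝ (fun _ : Fin (q + 2) ↦ E) ℝ :=
    LinearMap.uncurryLeft (AlternatingMap.toMultilinearMapLM (R := ℝ) (S := ℝ) ∘ₗ f)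
  have hm : ∀ W, m W = f (W 0) (Fin.tail W) := fun W ↦ rfl
  -- The hypothesis only covers equality of the first two arguments; a swap inside `f v` moves any
  -- other repetition there.
  have key : ∀ (W : Fin (q + 2) → E) (j : Fin (q + 1)), W 0 = W j.succ → m W = 0 := by
    intro W j h
    rw [hm]
    exact alternating_eq_zero_of_apply_eq (hf (W 0)) (i := j) h.symm
  refine ⟨{ m with map_eq_zero_of_eq' := ?_ }, hm⟩
  intro W i j hij hne
  change m W = 0
  refine Fin.cases (fun hne hij ↦ ?_) (fun i hne hij ↦ ?_) i hne hij
  · obtain ⟨j, rfl⟩ := Fin.exists_succ_eq.2 (Ne.symm hne)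
    exact key W j hij
  · refine Fin.cases (fun hne hij ↦ ?_) (fun j hne hij ↦ ?_) j hne hij
    · exact key W i hij.symm
    · rw [hm]
      exact AlternatingMap.map_eq_zero_of_eq _ _ (i := i) (j := j) hij
        (fun h ↦ hne (by rw [h]))

/-- An alternating map on `ℝ × E` which vanishes as soon as some argument is `(1, 0)` only depends
on the second components of its arguments. -/
theorem alternating_prod_apply [FiniteDimensional ℝ E] {χ : (ℝ × E) [⋀^Fin k]→ₗ[ℝ] ℝ}
    (h : ∀ t i, t i = ((1 : ℝ), (0 : E)) → χ t = 0) (t : Fin k → ℝ × E) :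
    χ t = χ (fun i ↦ ((0 : ℝ), (t i).2)) := by
  let b := (Module.Basis.singleton Unit ℝ).prod (Module.finBasis ℝ E)
  let L : (ℝ × E) →ₗ[ℝ] (ℝ × E) := LinearMap.inr ℝ ℝ E ∘ₗ LinearMap.snd ℝ ℝ E
  suffices χ = χ.compLinearMap L from congrArg (fun g : (ℝ × E) [⋀^Fin k]→ₗ[ℝ] ℝ ↦ g t) this
  refine b.ext_alternating fun v _ ↦ ?_
  by_cases hv : ∃ i, v i = Sum.inl ()
  · obtain ⟨i, hi⟩ := hv
    have hb : b (v i) = ((1 : ℝ), (0 : E)) := by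
      rw [hi]
      simp [b]
    rw [h _ i hb]
    rw [AlternatingMap.compLinearMap_apply]
    refine (AlternatingMap.map_coord_zero χ i ?_).symm
    change L (b (v i)) = 0
    rw [hb]
    simp [L]
  · push Not at hv
    rw [AlternatingMap.compLinearMap_apply]
    congr 1
    funext i
    obtain ⟨j, hj⟩ : ∃ j, v i = Sum.inr j := by
      rcases h' : v i with a | j
      · exact absurd h' (hv i)
      · exact ⟨j, rfl⟩
    change b (v i) = L (b (v i))
    rw [hj]
    simp [b, L]

/-- The alternating form on `ℝ × E` with components `α` and `β`. -/
def formPair (α : E [⋀^Fin (q + 1)]→ₗ[ℝ] ℝ) (β : E [⋀^Fin (q + 2)]→ₗ[ℝ] ℝ) :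
    (ℝ × E) [⋀^Fin (q + 2)]→ₗ[ℝ] ℝ :=
  AlternatingMap.alternatizeUncurryFin
      ((LinearMap.fst ℝ ℝ E).smulRight (α.compLinearMap (LinearMap.snd ℝ ℝ E)))
    + β.compLinearMap (LinearMap.snd ℝ ℝ E)

theorem formPair_apply (α : E [⋀^Fin (q + 1)]→ₗ[ℝ] ℝ) (β : E [⋀^Fin (q + 2)]→ₗ[ℝ] ℝ)
    (t : Fin (q + 2) → ℝ × E) :
    formPair α β t = ∑ i : Fin (q + 2),
      (-1 : ℝ) ^ (i : ℕ) * ((t i).1 * α (fun j : Fin (q + 1) ↦ (i.removeNth t j).2))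
      + β (fun i ↦ (t i).2) := by
  simp only [formPair, AlternatingMap.add_apply, AlternatingMap.alternatizeUncurryFin_apply]
  congr 1
  refine Finset.sum_congr rfl fun i _ ↦ ?_
  rw [← Int.cast_smul_eq_zsmul ℝ]
  simp only [Int.cast_pow, Int.cast_neg, Int.cast_one, smul_eq_mul]
  rfl

/-- In the sum of `formPair_apply` only the term pairing with the inserted `(1, 0)` survives: every
other one evaluates a form on the zero `E`-part of that vector. -/
theorem formPair_cons (α : E [⋀^Fin (q + 1)]→ₗ[ℝ] ℝ) (β : E [⋀^Fin (q + 2)]→ₗ[ℝ] ℝ)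
    (t : Fin (q + 1) → ℝ × E) :
    formPair α β (Fin.cons ((1 : ℝ), (0 : E)) t) = α (fun j ↦ (t j).2) := by
  rw [formPair_apply, Fin.sum_univ_succ]
  have h1 : β (fun i ↦ ((Fin.cons ((1 : ℝ), (0 : E)) t : Fin (q + 2) → ℝ × E) i).2) = 0 :=
    AlternatingMap.map_coord_zero _ 0 (by simp)
  have h2 : ∀ j : Fin (q + 1), α (fun l ↦ ((Fin.succ j).removeNth
      (Fin.cons ((1 : ℝ), (0 : E)) t : Fin (q + 2) → ℝ × E) l).2) = 0 := fun j ↦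
    AlternatingMap.map_coord_zero _ 0 (by simp [Fin.removeNth])
  simp [h1, h2]

theorem formPair_inr (α : E [⋀^Fin (q + 1)]→ₗ[ℝ] ℝ) (β : E [⋀^Fin (q + 2)]→ₗ[ℝ] ℝ)
    (Y : Fin (q + 2) → E) :
    formPair α β (fun i ↦ ((0 : ℝ), Y i)) = β Y := by
  simp [formPair_apply]

end AlternatingAlgebra

/-! ### The Killing–Yano equation and its model solutions -/

section KillingYanoEquation

variable {X E : Type*} [NormedAddCommGroup X] [NormedSpace ℝ X]
  [NormedAddCommGroup E] [NormedSpace ℝ E] {k q : ℕ}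

/-- The derivative of a differentiable family of alternating maps. -/
theorem exists_fderiv_alternating {x : X} {α : X → E [⋀^Fin k]→ₗ[ℝ] ℝ}
    (hα : ∀ Z, DifferentiableAt ℝ (fun y ↦ α y Z) x) :
    ∃ D : X →ₗ[ℝ] E [⋀^Fin k]→ₗ[ℝ] ℝ, ∀ v Z, D v Z = fderiv ℝ (fun y ↦ α y Z) x v := by
  let D : X → E [⋀^Fin k]→ₗ[ℝ] ℝ := fun v ↦
    { toFun := fun Z ↦ fderiv ℝ (fun y ↦ α y Z) x v
      map_update_add' := fun {hd} Z i a b ↦ by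
        obtain rfl := Subsingleton.elim hd (instDecidableEqFin k)
        simp only [(α _).map_update_add]
        rw [fderiv_fun_add (hα _) (hα _)]
        rfl
      map_update_smul' := fun {hd} Z i c a ↦ by
        obtain rfl := Subsingleton.elim hd (instDecidableEqFin k)
        simp only [(α _).map_update_smul, smul_eq_mul]
        rw [fderiv_const_mul (hα _)]
        rfl
      map_eq_zero_of_eq' := fun Z i j h hij ↦ by
        simp [(α _).map_eq_zero_of_eq Z h hij] }
  exact ⟨⟨⟨D, fun v w ↦ AlternatingMap.ext fun Z ↦ (fderiv ℝ (fun y ↦ α y Z) x).map_add v w⟩,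
    fun c v ↦ AlternatingMap.ext fun Z ↦ (fderiv ℝ (fun y ↦ α y Z) x).map_smul c v⟩, fun v Z ↦ rfl⟩

/-- The covariant derivative of a field of alternating maps, for the connection `Γ`. -/
theorem exists_covDeriv_alternating [FiniteDimensional ℝ E] (Γ : E →L[ℝ] E →L[ℝ] E) {x : E}
    {θ : E → E [⋀^Fin k]→ₗ[ℝ] ℝ} (hθ : ∀ Z, DifferentiableAt ℝ (fun y ↦ θ y Z) x) :
    ∃ D : E →ₗ[ℝ] E [⋀^Fin k]→ₗ[ℝ] ℝ, ∀ v Z, D v Z = fderiv ℝ (fun y ↦ θ y Z) x v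
      - ∑ i, θ x (Function.update Z i (Γ v (Z i))) := by
  -- Precomposing with `1 - Γ(y - x)`, the identity at `y = x`, makes the ordinary derivative at `x`
  -- equal to the covariant one, so the result is alternating at no cost.
  let α : E → E [⋀^Fin k]→ₗ[ℝ] ℝ := fun y ↦
    (θ y).compLinearMap (LinearMap.id - (Γ (y - x) : E →ₗ[ℝ] E))
  have hY : ∀ Z : Fin k → E, ∀ i, HasFDerivAt (fun y ↦ Z i - Γ (y - x) (Z i))
      (-(Γ.flip (Z i))) x := by
    intro Z i
    have h1 : HasFDerivAt (fun y ↦ Γ.flip (Z i) (y - x)) (Γ.flip (Z i)) x := by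
      simp only [map_sub]
      exact (Γ.flip (Z i)).hasFDerivAt.sub_const _
    simpa using h1.const_sub (Z i)
  have h := fun Z ↦ hasFDerivAt_alternating_apply (Y := fun i y ↦ Z i - Γ (y - x) (Z i)) hθ (hY Z)
  obtain ⟨D, hD⟩ := exists_fderiv_alternating (α := α) (x := x) fun Z ↦ (h Z).1
  refine ⟨D, fun v Z ↦ ?_⟩
  rw [hD]
  refine ((h Z).2 v).trans ?_
  simp [sub_eq_add_neg, AlternatingMap.map_update_neg, Finset.sum_neg_distrib]

/-- The Killing–Yano equation in coordinates, for the connection `Γ`. -/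
structure IsKYCoord (Γ : E → E →L[ℝ] E →L[ℝ] E) (θ : E → E [⋀^Fin (q + 1)]→ₗ[ℝ] ℝ)
    (s : Set E) : Prop where
  smooth : ∀ Y, ContDiffOn ℝ ∞ (fun x ↦ θ x Y) s
  eqn : ∀ x ∈ s, ∀ (v : E) (Z : Fin q → E),
    fderiv ℝ (fun y ↦ θ y (Fin.cons v Z)) x v
      = ∑ i, θ x (Function.update (Fin.cons v Z : Fin (q + 1) → E) i
          (Γ x v ((Fin.cons v Z : Fin (q + 1) → E) i)))

/-- The `(q + 1)`-form which a constant form on the tractor bundle induces, when `G` is the frame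
of the tractor bundle at the given point. -/
def modelForm (G : (ℝ × E) →L[ℝ] (ℝ × E)) :
    ((ℝ × E) [⋀^Fin (q + 2)]→ₗ[ℝ] ℝ) →ₗ[ℝ] E [⋀^Fin (q + 1)]→ₗ[ℝ] ℝ where
  toFun Ψ := (Ψ.curryLeft (G (1, 0))).compLinearMap ((G : (ℝ × E) →ₗ[ℝ] (ℝ × E)) ∘ₗ
    LinearMap.inr ℝ ℝ E)
  map_add' _ _ := rfl
  map_smul' _ _ := rfl

theorem modelForm_apply (G : (ℝ × E) →L[ℝ] (ℝ × E)) (Ψ : (ℝ × E) [⋀^Fin (q + 2)]→ₗ[ℝ] ℝ)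
    (Y : Fin (q + 1) → E) :
    modelForm G Ψ Y = Ψ (Fin.cons (G (1, 0)) fun i ↦ G (0, Y i)) := rfl

variable {Γ : E → E →L[ℝ] E →L[ℝ] E} {P : E → E →L[ℝ] E →L[ℝ] ℝ}
  {G H : E → (ℝ × E) →L[ℝ] (ℝ × E)} {s : Set E}

theorem IsTractorFrame.mono {s' : Set E} (h : IsTractorFrame Γ P G H s) (hs : s' ⊆ s) :
    IsTractorFrame Γ P G H s' :=
  ⟨h.smooth.mono hs, h.smooth_inv.mono hs, fun x hx ↦ h.right_inv x (hs hx),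
    fun x hx ↦ h.left_inv x (hs hx), fun x hx ↦ h.deriv x (hs hx)⟩

theorem IsTractorFrame.hasFDerivAt (h : IsTractorFrame Γ P G H s) (hs : IsOpen s) {x : E}
    (hx : x ∈ s) (t : ℝ × E) :
    ∃ G' : E →L[ℝ] ℝ × E, HasFDerivAt (fun y ↦ G y t) G' x ∧
      ∀ v, G' v = G x (-(P x v t.2), t.1 • v + Γ x v t.2) := by
  have hd := (h.smooth.contDiffAt (hs.mem_nhds hx)).differentiableAt (by simp)
  refine ⟨_, (fderiv_clm_apply_const hd t).1.hasFDerivAt, fun v ↦ ?_⟩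
  rw [(fderiv_clm_apply_const hd t).2, h.deriv x hx]

/-- The forms induced by constant tractor forms solve the Killing–Yano equation. -/
theorem IsTractorFrame.isKYCoord_modelForm [FiniteDimensional ℝ E]
    (h : IsTractorFrame Γ P G H s) (hs : IsOpen s) (Ψ : (ℝ × E) [⋀^Fin (q + 2)]→ₗ[ℝ] ℝ) :
    IsKYCoord Γ (fun x ↦ modelForm (G x) Ψ) s := by
  let Y : (Fin (q + 1) → E) → Fin (q + 2) → E → ℝ × E := fun W ↦
    Fin.cons (fun x ↦ G x (1, 0)) (fun i x ↦ G x (0, W i))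
  have hYe : ∀ W x, (Fin.cons (G x (1, 0)) (fun i ↦ G x (0, W i)) : Fin (q + 2) → ℝ × E)
      = fun i ↦ Y W i x := by
    intro W x
    funext i
    refine Fin.cases rfl (fun i ↦ rfl) i
  refine ⟨fun W ↦ ?_, fun x hx v Z ↦ ?_⟩
  · simp only [modelForm_apply, hYe]
    refine contDiffOn_alternating_apply (fun _ ↦ contDiffOn_const) fun i ↦ ?_
    refine Fin.cases ?_ (fun i ↦ ?_) i
    · exact h.smooth.clm_apply contDiffOn_const
    · exact h.smooth.clm_apply contDiffOn_const
  · set W : Fin (q + 1) → E := Fin.cons v Z with hW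
    obtain ⟨G0, hG0, hG0v⟩ := h.hasFDerivAt hs hx (1, 0)
    choose G1 hG1 hG1v using fun i ↦ h.hasFDerivAt hs hx (0, W i)
    let Y' : Fin (q + 2) → E →L[ℝ] ℝ × E := Fin.cons G0 G1
    have hY' : ∀ i, HasFDerivAt (Y W i) (Y' i) x := by
      intro i
      refine Fin.cases hG0 (fun i ↦ hG1 i) i
    have key := (hasFDerivAt_alternating_apply (α := fun _ : E ↦ Ψ) (fun Z ↦
      differentiableAt_const _) hY').2 v
    simp only [modelForm_apply, hYe] at key ⊢
    rw [key, Fin.sum_univ_succ]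
    simp only [fderiv_fun_const, Pi.zero_apply, zero_apply, zero_add]
    -- The derivative of `G(1, 0)` along `v` is `G(0, v)`, which already occupies the next slot.
    have e1 : Ψ (Function.update (fun j ↦ Y W j x) 0 (Y' 0 v)) = 0 := by
      refine Ψ.map_eq_zero_of_eq _ (i := 0) (j := 1) ?_ (by simp)
      have : (1 : Fin (q + 2)) = Fin.succ 0 := rfl
      rw [Function.update_self, Function.update_of_ne (by simp)]
      change G0 v = Y W 1 x
      rw [hG0v, this]
      simp [Y, hW]
    rw [e1, zero_add]
    refine Finset.sum_congr rfl fun i _ ↦ ?_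
    have e2 : Y' i.succ v = -(P x v (W i)) • G x (1, 0) + G x (0, Γ x v (W i)) := by
      change G1 i v = _
      rw [hG1v, ← map_smul, ← map_add]
      simp
    rw [e2, Ψ.map_update_add, Ψ.map_update_smul]
    -- The `P`-term repeats the vector `G(1, 0)` of slot 0; only the `Γ`-term remains.
    have e3 : Ψ (Function.update (fun j ↦ Y W j x) i.succ (G x (1, 0))) = 0 := by
      refine Ψ.map_eq_zero_of_eq _ (i := 0) (j := i.succ) ?_ (Fin.succ_ne_zero i).symm
      rw [Function.update_self, Function.update_of_ne (Fin.succ_ne_zero i).symm]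
      rfl
    rw [e3, smul_zero, zero_add]
    congr 1
    funext j
    refine Fin.cases ?_ (fun j ↦ ?_) j
    · rw [Function.update_of_ne (Fin.succ_ne_zero i).symm]
      rfl
    · by_cases hj : j = i
      · subst hj
        rw [Function.update_self]
        simp [Y]
      · rw [Function.update_of_ne (by simpa using hj)]
        simp [Y, Function.update_of_ne hj]

end KillingYanoEquation

/-! ### Prolongation: every local solution comes from a constant form -/

section Prolongation

variable {E : Type*} [NormedAddCommGroup E] [NormedSpace ℝ E] [FiniteDimensional ℝ E] {q : ℕ}
  {Γ : E → E →L[ℝ] E →L[ℝ] E} {P : E → E →L[ℝ] E →L[ℝ] ℝ}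
  {G H : E → (ℝ × E) →L[ℝ] (ℝ × E)} {s : Set E}

omit [FiniteDimensional ℝ E] in
/-- A trilinear expression which is symmetric in one pair of arguments and alternating in another
one vanishes. -/
theorem eq_zero_of_symm_of_alternating {D : E →ₗ[ℝ] E [⋀^Fin (q + 2)]→ₗ[ℝ] ℝ}
    (h : ∀ u v (Z : Fin (q + 1) → E), D v (Fin.cons u Z) = D u (Fin.cons v Z)) : D = 0 := by
  ext v W
  obtain ⟨a, Z, rfl⟩ : ∃ a Z, W = Fin.cons a Z := ⟨_, _, (Fin.cons_self_tail W).symm⟩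
  obtain ⟨b, R, rfl⟩ : ∃ b R, Z = Fin.cons b R := ⟨_, _, (Fin.cons_self_tail Z).symm⟩
  have h1 := h a v (Fin.cons b R)
  have h2 := alternating_cons_cons_swap (D a) v b R
  have h3 := h b a (Fin.cons v R)
  have h4 := alternating_cons_cons_swap (D b) a v R
  have h5 := h b v (Fin.cons a R)
  have h6 := alternating_cons_cons_swap (D v) a b R
  simp only [LinearMap.zero_apply, AlternatingMap.zero_apply]
  linarith

/-- Prolongation: on a projectively flat space, every solution of the Killing–Yano equation is
induced by a parallel form on the tractor bundle. -/
theorem IsKYCoord.exists_eq_modelForm {θ : E → E [⋀^Fin (q + 1)]→ₗ[ℝ] ℝ} (hθ : IsKYCoord Γ θ s)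
    (h : IsTractorFrame Γ P G H s) (hΓ : ContDiffOn ℝ ∞ Γ s) (hs : IsOpen s)
    (hconn : IsPreconnected s) :
    ∃ Ψ, ∀ x ∈ s, θ x = modelForm (G x) Ψ := by
  have hd : ∀ x ∈ s, ∀ Z, DifferentiableAt ℝ (fun y ↦ θ y Z) x := fun x hx Z ↦
    ((hθ.smooth Z).contDiffAt (hs.mem_nhds hx)).differentiableAt (by simp)
  -- The covariant derivative of `θ`; the Killing–Yano equation is exactly what makes it alternating
  -- in all slots. Off `s` the value is irrelevant.
  have hex : ∀ x, ∃ g : E [⋀^Fin (q + 2)]→ₗ[ℝ] ℝ, x ∈ s → ∀ v Z,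
      g (Fin.cons v Z) = fderiv ℝ (fun y ↦ θ y Z) x v
        - ∑ i, θ x (Function.update Z i (Γ x v (Z i))) := by
    intro x
    by_cases hx : x ∈ s
    · obtain ⟨D, hD⟩ := exists_covDeriv_alternating (Γ x) (hd x hx)
      obtain ⟨g, hg⟩ := exists_alternating_uncurry D fun v Z ↦ by
        rw [hD, hθ.eqn x hx, sub_self]
      refine ⟨g, fun _ v Z ↦ ?_⟩
      rw [hg, ← hD]
      simp
    · exact ⟨0, fun h ↦ absurd h hx⟩
  choose β hβ using hex
  have hβs : ∀ W, ContDiffOn ℝ ∞ (fun x ↦ β x W) s := by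
    intro W
    have : ContDiffOn ℝ ∞ (fun x ↦ fderiv ℝ (fun y ↦ θ y (Fin.tail W)) x (W 0)
        - ∑ i, θ x (Function.update (Fin.tail W) i (Γ x (W 0) (Fin.tail W i)))) s := by
      refine ContDiffOn.sub (((hθ.smooth _).fderiv_of_isOpen hs (by simp)).clm_apply
        contDiffOn_const) (ContDiffOn.sum fun i _ ↦ ?_)
      refine contDiffOn_alternating_apply (Y := fun j x ↦
        Function.update (Fin.tail W) i (Γ x (W 0) (Fin.tail W i)) j) hθ.smooth fun j ↦ ?_
      by_cases hj : j = i
      · subst hj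
        simp only [Function.update_self]
        exact (hΓ.clm_apply contDiffOn_const).clm_apply contDiffOn_const
      · simp only [Function.update_of_ne hj]
        exact contDiffOn_const
    refine this.congr fun x hx ↦ ?_
    rw [← hβ x hx, Fin.cons_self_tail]
  -- The pair `(θ, ∇θ)` as a tractor form, read in the parallel frame. Parallel means constant here,
  -- so the goal is `dσ = 0`.
  let σ : E → (ℝ × E) [⋀^Fin (q + 2)]→ₗ[ℝ] ℝ := fun x ↦
    (formPair (θ x) (β x)).compLinearMap (H x : (ℝ × E) →ₗ[ℝ] (ℝ × E))
  have hσ : ∀ x τ, σ x τ = formPair (θ x) (β x) (fun i ↦ H x (τ i)) := fun _ _ ↦ rfl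
  have hσs : ∀ τ, ContDiffOn ℝ ∞ (fun x ↦ σ x τ) s := by
    intro τ
    simp only [hσ]
    refine contDiffOn_alternating_apply (fun t ↦ ?_) fun i ↦
      h.smooth_inv.clm_apply contDiffOn_const
    simp only [formPair_apply]
    exact (ContDiffOn.sum fun i _ ↦ contDiffOn_const.mul
      (contDiffOn_const.mul (hθ.smooth _))).add (hβs _)
  have hσd : ∀ x ∈ s, ∀ τ, DifferentiableAt ℝ (fun y ↦ σ y τ) x := fun x hx τ ↦
    ((hσs τ).contDiffAt (hs.mem_nhds hx)).differentiableAt (by simp)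
  have hσe : ∀ x ∈ s, ∀ t : Fin (q + 1) → ℝ × E,
      σ x (Fin.cons (G x (1, 0)) fun i ↦ G x (t i)) = θ x (fun i ↦ (t i).2) := by
    intro x hx t
    rw [hσ, ← formPair_cons (θ x) (β x) t]
    congr 1
    funext i
    refine Fin.cases ?_ (fun i ↦ ?_) i
    · simp [h.left_inv x hx]
    · simp [h.left_inv x hx]
  have hσ0 : ∀ x ∈ s, ∀ v (Z : Fin (q + 1) → E),
      σ x (Fin.cons (G x (0, v)) fun i ↦ G x (0, Z i)) = fderiv ℝ (fun y ↦ θ y Z) x v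
        - ∑ i, θ x (Function.update Z i (Γ x v (Z i))) := by
    intro x hx v Z
    rw [hσ, ← hβ x hx, ← formPair_inr (θ x)]
    congr 1
    funext i
    refine Fin.cases ?_ (fun i ↦ ?_) i
    · simp [h.left_inv x hx]
    · simp [h.left_inv x hx]
  choose! K hK using fun x (hx : x ∈ s) ↦ exists_fderiv_alternating (hσd x hx)
  -- the derivative vanishes as soon as the distinguished vector is inserted
  have claim : ∀ x ∈ s, ∀ v (Z : Fin (q + 1) → E),
      K x v (Fin.cons (G x (1, 0)) fun i ↦ G x (0, Z i)) = 0 := by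
    intro x hx v Z
    let Y : Fin (q + 2) → E → ℝ × E :=
      Fin.cons (fun x ↦ G x (1, 0)) (fun i x ↦ G x (0, Z i))
    have hYe : ∀ x, (Fin.cons (G x (1, 0)) (fun i ↦ G x (0, Z i)) : Fin (q + 2) → ℝ × E)
        = fun i ↦ Y i x := by
      intro x
      funext i
      refine Fin.cases rfl (fun i ↦ rfl) i
    obtain ⟨G0, hG0, hG0v⟩ := h.hasFDerivAt hs hx (1, 0)
    choose G1 hG1 hG1v using fun i ↦ h.hasFDerivAt hs hx (0, Z i)
    let Y' : Fin (q + 2) → E →L[ℝ] ℝ × E := Fin.cons G0 G1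
    have hY' : ∀ i, HasFDerivAt (Y i) (Y' i) x := by
      intro i
      refine Fin.cases hG0 (fun i ↦ hG1 i) i
    have key := (hasFDerivAt_alternating_apply (hσd x hx) hY').2 v
    -- In the Leibniz rule for this function, the derivative of `θ` is used up by slot 0, which
    -- contributes `∇θ`, and by the `Γ`-terms of the other slots. Nothing is left for `K`.
    have hev : (fun y ↦ σ y (fun i ↦ Y i y)) =ᶠ[𝓝 x] fun y ↦ θ y Z := by
      filter_upwards [hs.mem_nhds hx] with y hy
      rw [← hYe, hσe y hy]
    rw [hev.fderiv_eq, ← hK x hx, ← hYe, Fin.sum_univ_succ] at key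
    have e0 : (Function.update (fun j ↦ Y j x) 0 (Y' 0 v))
        = (Fin.cons (G x (0, v)) fun i ↦ G x (0, Z i) : Fin (q + 2) → ℝ × E) := by
      funext j
      refine Fin.cases ?_ (fun j ↦ ?_) j
      · rw [Function.update_self]
        change G0 v = _
        simp [hG0v]
      · rw [Function.update_of_ne (Fin.succ_ne_zero j)]
        rfl
    have e1 : ∀ i : Fin (q + 1), σ x (Function.update (fun j ↦ Y j x) i.succ (Y' i.succ v))
        = θ x (Function.update Z i (Γ x v (Z i))) := by
      intro i
      have : (Function.update (fun j ↦ Y j x) i.succ (Y' i.succ v))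
          = (Fin.cons (G x (1, 0)) fun j ↦ G x (Function.update (fun j ↦ ((0 : ℝ), Z j)) i
            (-(P x v (Z i)), Γ x v (Z i)) j) : Fin (q + 2) → ℝ × E) := by
        funext j
        refine Fin.cases ?_ (fun j ↦ ?_) j
        · rw [Function.update_of_ne (Fin.succ_ne_zero i).symm]
          rfl
        · by_cases hj : j = i
          · subst hj
            rw [Function.update_self]
            change G1 j v = _
            simp [hG1v]
          · rw [Function.update_of_ne (by simpa using hj)]
            simp [Y, Function.update_of_ne hj]
      rw [this, hσe x hx]
      congr 1
      funext j
      by_cases hj : j = i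
      · subst hj
        simp
      · simp [Function.update_of_ne hj]
    simp only [hYe x, e0, e1, hσ0 x hx] at key
    rw [hYe x]
    linarith
  have claim' : ∀ x ∈ s, ∀ v (t : Fin (q + 1) → ℝ × E),
      K x v (Fin.cons (G x (1, 0)) t) = 0 := by
    intro x hx v t
    let χ : (ℝ × E) [⋀^Fin (q + 1)]→ₗ[ℝ] ℝ := ((K x v).compLinearMap
      (G x : (ℝ × E) →ₗ[ℝ] (ℝ × E))).curryLeft (1, 0)
    have hχ : ∀ t : Fin (q + 1) → ℝ × E,
        χ t = K x v (Fin.cons (G x (1, 0)) fun i ↦ G x (t i)) := by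
      intro t
      change K x v _ = _
      congr 1
      funext i
      refine Fin.cases rfl (fun i ↦ rfl) i
    have h1 := hχ fun i ↦ H x (t i)
    simp only [h.right_inv x hx] at h1
    rw [← h1, alternating_prod_apply, hχ]
    · exact claim x hx v _
    · intro t i hi
      rw [hχ]
      refine (K x v).map_eq_zero_of_eq _ (i := 0) (j := i.succ) ?_ (Fin.succ_ne_zero i).symm
      simp [hi]
  -- differentiating once more
  have hsymm : ∀ x ∈ s, ∀ u v (t : Fin (q + 1) → ℝ × E),
      K x v (Fin.cons (G x (0, u)) t) = K x u (Fin.cons (G x (0, v)) t) := by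
    intro x hx u v t
    -- Differentiating `K_b(G(1, 0), t) = 0` along `a`: moving the frame vector yields `K_b(G(0, a),
    -- t)`, and moving `K` yields a second derivative of `σ` on fixed arguments, which is symmetric
    -- in `a` and `b`.
    have hval : ∀ a b, fderiv ℝ (fun y ↦ fderiv ℝ (fun z ↦ σ z (Fin.cons (G x (1, 0)) t)) y b) x a
        = -K x b (Fin.cons (G x (0, a)) t) := by
      intro a b
      have hKs : ∀ τ, DifferentiableAt ℝ (fun y ↦ K y b τ) x := by
        intro τ
        have h1 : ContDiffOn ℝ ∞ (fun y ↦ fderiv ℝ (fun z ↦ σ z τ) y b) s :=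
          ((hσs τ).fderiv_of_isOpen hs (by simp)).clm_apply contDiffOn_const
        refine ((h1.contDiffAt (hs.mem_nhds hx)).differentiableAt (by simp)).congr_of_eventuallyEq
          ?_
        filter_upwards [hs.mem_nhds hx] with y hy
        exact hK y hy b τ
      obtain ⟨G0, hG0, hG0v⟩ := h.hasFDerivAt hs hx (1, 0)
      let Y : Fin (q + 2) → E → ℝ × E := Fin.cons (fun x ↦ G x (1, 0)) (fun i _ ↦ t i)
      let Y' : Fin (q + 2) → E →L[ℝ] ℝ × E := Fin.cons G0 0
      have hYe : ∀ x, (Fin.cons (G x (1, 0)) t : Fin (q + 2) → ℝ × E) = fun i ↦ Y i x := by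
        intro x
        funext i
        refine Fin.cases rfl (fun i ↦ rfl) i
      have hY' : ∀ i, HasFDerivAt (Y i) (Y' i) x := by
        intro i
        refine Fin.cases hG0 (fun i ↦ hasFDerivAt_const _ _) i
      have key := (hasFDerivAt_alternating_apply hKs hY').2 a
      have hev : (fun y ↦ K y b (fun i ↦ Y i y)) =ᶠ[𝓝 x] fun y ↦ 0 := by
        filter_upwards [hs.mem_nhds hx] with y hy
        rw [← hYe, claim' y hy]
      have hev' : (fun y ↦ K y b (fun i ↦ Y i x)) =ᶠ[𝓝 x]
          fun y ↦ fderiv ℝ (fun z ↦ σ z (Fin.cons (G x (1, 0)) t)) y b := by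
        filter_upwards [hs.mem_nhds hx] with y hy
        rw [hK y hy, ← hYe]
      rw [hev.fderiv_eq, hev'.fderiv_eq, Fin.sum_univ_succ] at key
      have e0 : (Function.update (fun j ↦ Y j x) 0 (Y' 0 a))
          = (Fin.cons (G x (0, a)) t : Fin (q + 2) → ℝ × E) := by
        funext j
        refine Fin.cases ?_ (fun j ↦ ?_) j
        · rw [Function.update_self]
          change G0 a = _
          simp [hG0v]
        · rw [Function.update_of_ne (Fin.succ_ne_zero j)]
          rfl
      have e1 : ∀ i : Fin (q + 1),
          K x b (Function.update (fun j ↦ Y j x) i.succ (Y' i.succ a)) = 0 := by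
        intro i
        refine (K x b).map_coord_zero i.succ ?_
        rw [Function.update_self]
        rfl
      rw [e0] at key
      simp only [e1, Finset.sum_const_zero, add_zero, fderiv_fun_const, Pi.zero_apply,
        zero_apply] at key
      linarith
    have hC := (hσs (Fin.cons (G x (1, 0)) t)).contDiffAt (hs.mem_nhds hx)
    have hsd : IsSymmSndFDerivAt ℝ (fun z ↦ σ z (Fin.cons (G x (1, 0)) t)) x :=
      hC.isSymmSndFDerivAt (by
        simp only [minSmoothness_of_isRCLikeNormedField]
        exact WithTop.coe_le_coe.2 (le_top (a := (2 : ℕ∞))))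
    have hd2 : DifferentiableAt ℝ (fderiv ℝ (fun z ↦ σ z (Fin.cons (G x (1, 0)) t))) x :=
      (hC.fderiv_right (m := 1)
        (WithTop.coe_le_coe.2 (le_top (a := (2 : ℕ∞))))).differentiableAt (by simp)
    have hsw := hsd u v
    rw [← (fderiv_clm_apply_const hd2 v).2, ← (fderiv_clm_apply_const hd2 u).2, hval, hval] at hsw
    linarith
  have hK0 : ∀ x ∈ s, ∀ v, K x v = 0 := by
    intro x hx v
    let L : E →ₗ[ℝ] ℝ × E := (G x : (ℝ × E) →ₗ[ℝ] (ℝ × E)) ∘ₗ LinearMap.inr ℝ ℝ E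
    let compₗ : ((ℝ × E) [⋀^Fin (q + 2)]→ₗ[ℝ] ℝ) →ₗ[ℝ] E [⋀^Fin (q + 2)]→ₗ[ℝ] ℝ :=
      ⟨⟨fun χ ↦ χ.compLinearMap L, fun _ _ ↦ rfl⟩, fun _ _ ↦ rfl⟩
    -- On vectors `G(0, ·)`, `K` is symmetric in the direction and the first argument and
    -- alternating in its arguments, of which there are at least two.
    have hD : compₗ ∘ₗ K x = 0 := by
      refine eq_zero_of_symm_of_alternating fun u v Z ↦ ?_
      have hL : ∀ w, (fun i ↦ L ((Fin.cons w Z : Fin (q + 2) → E) i))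
          = (Fin.cons (G x (0, w)) fun i ↦ G x (0, Z i) : Fin (q + 2) → ℝ × E) := by
        intro w
        funext i
        refine Fin.cases rfl (fun i ↦ rfl) i
      change K x v (fun i ↦ L ((Fin.cons u Z : Fin (q + 2) → E) i))
        = K x u (fun i ↦ L ((Fin.cons v Z : Fin (q + 2) → E) i))
      rw [hL, hL]
      exact hsymm x hx u v _
    let χ := (K x v).compLinearMap (G x : (ℝ × E) →ₗ[ℝ] (ℝ × E))
    ext τ
    have h1 : K x v τ = χ (fun i ↦ H x (τ i)) := by
      change _ = K x v (fun i ↦ G x (H x (τ i)))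
      simp only [h.right_inv x hx]
    rw [h1, alternating_prod_apply]
    · exact congrArg (fun g : E [⋀^Fin (q + 2)]→ₗ[ℝ] ℝ ↦ g fun i ↦ (H x (τ i)).2)
        (LinearMap.congr_fun hD v)
    · intro t i hi
      refine alternating_eq_zero_of_apply_eq (χ := K x v) (e := G x (1, 0))
        (fun Z ↦ claim' x hx v Z) (i := i) ?_
      exact congrArg (G x) hi
  have hconst : ∀ x ∈ s, ∀ y ∈ s, σ x = σ y := by
    intro x hx y hy
    ext τ
    refine hs.is_const_of_fderiv_eq_zero (𝕜 := ℝ) (f := fun z ↦ σ z τ) hconn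
      (fun z hz ↦ (hσd z hz τ).differentiableWithinAt) (fun z hz ↦ ?_) hx hy
    ext v
    rw [← hK z hz, hK0 z hz]
    rfl
  rcases s.eq_empty_or_nonempty with rfl | ⟨x₀, hx₀⟩
  · exact ⟨0, fun x hx ↦ hx.elim⟩
  refine ⟨σ x₀, fun x hx ↦ ?_⟩
  ext Y
  rw [modelForm_apply, hconst x₀ hx₀ x hx, hσe x hx]

/-- A constant tractor form is determined by the induced form near a point. -/
theorem IsTractorFrame.eq_zero_of_modelForm_eq_zero (h : IsTractorFrame Γ P G H s)
    (hs : IsOpen s) {Ψ : (ℝ × E) [⋀^Fin (q + 2)]→ₗ[ℝ] ℝ} {x : E} (hx : x ∈ s)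
    (hΨ : ∀ᶠ y in 𝓝 x, modelForm (G y) Ψ = 0) : Ψ = 0 := by
  have hΨ' : ∀ᶠ y in 𝓝 x, ∀ t : Fin (q + 1) → ℝ × E, Ψ (Fin.cons (G y (1, 0)) t) = 0 := by
    filter_upwards [hΨ, hs.mem_nhds hx] with y hy hys t
    let χ : (ℝ × E) [⋀^Fin (q + 1)]→ₗ[ℝ] ℝ := (Ψ.compLinearMap
      (G y : (ℝ × E) →ₗ[ℝ] (ℝ × E))).curryLeft (1, 0)
    have hχ : ∀ t : Fin (q + 1) → ℝ × E,
        χ t = Ψ (Fin.cons (G y (1, 0)) fun i ↦ G y (t i)) := by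
      intro t
      change Ψ _ = _
      congr 1
      funext i
      refine Fin.cases rfl (fun i ↦ rfl) i
    have h1 := hχ fun i ↦ H y (t i)
    simp only [h.right_inv y hys] at h1
    rw [← h1, alternating_prod_apply, hχ]
    · exact congrArg (fun g : E [⋀^Fin (q + 1)]→ₗ[ℝ] ℝ ↦ g fun i ↦ (H y (t i)).2) hy
    · intro t i hi
      rw [hχ]
      refine Ψ.map_eq_zero_of_eq _ (i := 0) (j := i.succ) ?_ (Fin.succ_ne_zero i).symm
      simp [hi]
  have h0 : ∀ (a : ℝ × E) (t : Fin (q + 1) → ℝ × E), Ψ (Fin.cons (G x a) t) = 0 := by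
    intro a t
    -- `Ψ(G(1, 0), t)` vanishes near `x`; its derivative along `a.2` is `Ψ(G(0, a.2), t)`. Together
    -- these vectors span `ℝ × E`.
    have h1 : Ψ (Fin.cons (G x (0, a.2)) t) = 0 := by
      obtain ⟨G0, hG0, hG0v⟩ := h.hasFDerivAt hs hx (1, 0)
      let C : (ℝ × E) →L[ℝ] ℝ := LinearMap.toContinuousLinearMap
        { toFun := fun b ↦ Ψ (Fin.cons b t)
          map_add' := fun b b' ↦ Ψ.map_vecCons_add t b b'
          map_smul' := fun c b ↦ Ψ.map_vecCons_smul t c b }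
      have hC := (C.hasFDerivAt.comp x hG0).unique
        ((hasFDerivAt_const (0 : ℝ) x).congr_of_eventuallyEq
          (hΨ'.mono fun y hy ↦ hy t))
      have := congrArg (fun g : E →L[ℝ] ℝ ↦ g a.2) hC
      change C (G0 a.2) = 0 at this
      rw [hG0v] at this
      simp only [map_zero, neg_zero, one_smul, add_zero] at this
      exact this
    have h2 : G x a = a.1 • G x (1, 0) + G x (0, a.2) := by
      rw [← map_smul, ← map_add]
      simp
    have h3 := Ψ.map_vecCons_add t (a.1 • G x (1, 0)) (G x (0, a.2))
    have h4 := Ψ.map_vecCons_smul t a.1 (G x (1, 0))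
    change Ψ (Fin.cons _ t) = Ψ (Fin.cons _ t) + Ψ (Fin.cons _ t) at h3
    change Ψ (Fin.cons _ t) = a.1 • Ψ (Fin.cons _ t) at h4
    rw [h2, h3, h4, h1, hΨ'.self_of_nhds, smul_zero, add_zero]
  ext τ
  rw [← Fin.cons_self_tail τ, ← h.right_inv x hx (τ 0)]
  exact h0 _ _

end Prolongation

/-! ### Tangent vectors and functions in a chart -/

section Coordinates

/-- The model space of `n`-manifolds. -/
abbrev Eucl (n : ℕ) : Type := EuclideanSpace ℝ (Fin n)

variable {n : ℕ} {M : Type*} [TopologicalSpace M] [ChartedSpace (EuclideanSpace ℝ (Fin n)) M]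
  [IsManifold (𝓡 n) ∞ M] {F : Type*} [NormedAddCommGroup F] [NormedSpace ℝ F]

/-- The components of a tangent vector at `y`, in the chart at `x₀`. -/
def toCoord (x₀ y : M) : TangentSpace (𝓡 n) y →L[ℝ] Eucl n :=
  (trivializationAt (Eucl n) (TangentSpace (𝓡 n) : M → Type) x₀).continuousLinearMapAt ℝ y

/-- The tangent vector at `y` with the given components in the chart at `x₀`. -/
def ofCoord (x₀ y : M) : Eucl n →L[ℝ] TangentSpace (𝓡 n) y :=
  (trivializationAt (Eucl n) (TangentSpace (𝓡 n) : M → Type) x₀).symmL ℝ y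

theorem mem_baseSet_of_mem_source {x₀ y : M} (hy : y ∈ (extChartAt (𝓡 n) x₀).source) :
    y ∈ (trivializationAt (Eucl n) (TangentSpace (𝓡 n) : M → Type) x₀).baseSet := by
  rwa [extChartAt_source] at hy

theorem toCoord_ofCoord {x₀ y : M} (hy : y ∈ (extChartAt (𝓡 n) x₀).source) (v : Eucl n) :
    toCoord x₀ y (ofCoord x₀ y v) = v :=
  Trivialization.continuousLinearMapAt_symmL _ (mem_baseSet_of_mem_source hy) v

theorem ofCoord_toCoord {x₀ y : M} (hy : y ∈ (extChartAt (𝓡 n) x₀).source)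
    (v : TangentSpace (𝓡 n) y) : ofCoord x₀ y (toCoord x₀ y v) = v :=
  Trivialization.symmL_continuousLinearMapAt _ (mem_baseSet_of_mem_source hy) v

theorem toCoord_eq_snd {x₀ y : M} (hy : y ∈ (extChartAt (𝓡 n) x₀).source)
    (v : TangentSpace (𝓡 n) y) : toCoord x₀ y v =
      (trivializationAt (Eucl n) (TangentSpace (𝓡 n) : M → Type) x₀ ⟨y, v⟩).2 := by
  rw [toCoord, Trivialization.continuousLinearMapAt_apply,
    Trivialization.linearMapAt_apply, if_pos (mem_baseSet_of_mem_source hy)]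

theorem toCoord_eq_mfderiv {x₀ y : M} (hy : y ∈ (extChartAt (𝓡 n) x₀).source) :
    toCoord x₀ y = mfderiv (𝓡 n) 𝓘(ℝ, Eucl n) (extChartAt (𝓡 n) x₀) y :=
  TangentBundle.continuousLinearMapAt_trivializationAt (by rwa [extChartAt_source] at hy)

theorem ofCoord_eq_mfderiv {x₀ y : M} (hy : y ∈ (extChartAt (𝓡 n) x₀).source) :
    ofCoord x₀ y = mfderiv 𝓘(ℝ, Eucl n) (𝓡 n) (extChartAt (𝓡 n) x₀).symm
      (extChartAt (𝓡 n) x₀ y) := by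
  rw [ofCoord, TangentBundle.symmL_trivializationAt (by rwa [extChartAt_source] at hy)]
  rw [ModelWithCorners.range_eq_univ, mfderivWithin_univ]

theorem contMDiffOn_field_iff {x₀ : M} {U : Set M} (hU : IsOpen U)
    (hUs : U ⊆ (extChartAt (𝓡 n) x₀).source) {X : Π y : M, TangentSpace (𝓡 n) y} :
    ContMDiffOn (𝓡 n) (𝓡 n).tangent ∞ (fun y ↦ (⟨y, X y⟩ : TangentBundle (𝓡 n) M)) U ↔
      ContMDiffOn (𝓡 n) 𝓘(ℝ, Eucl n) ∞ (fun y ↦ toCoord x₀ y (X y)) U := by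
  rw [Trivialization.contMDiffOn_section_iff
    (trivializationAt (Eucl n) (TangentSpace (𝓡 n) : M → Type) x₀) hU
    (fun y hy ↦ mem_baseSet_of_mem_source (hUs hy))]
  exact contMDiffOn_congr fun y hy ↦ (toCoord_eq_snd (hUs hy) _).symm

theorem mdifferentiableAt_field_iff {x₀ y : M} (hy : y ∈ (extChartAt (𝓡 n) x₀).source)
    {X : Π y : M, TangentSpace (𝓡 n) y} :
    MDifferentiableAt (𝓡 n) (𝓡 n).tangent (fun y ↦ (⟨y, X y⟩ : TangentBundle (𝓡 n) M)) y ↔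
      MDifferentiableAt (𝓡 n) 𝓘(ℝ, Eucl n) (fun y ↦ toCoord x₀ y (X y)) y := by
  rw [Trivialization.mdifferentiableAt_section_iff (𝓡 n)
    (trivializationAt (Eucl n) (TangentSpace (𝓡 n) : M → Type) x₀) X
    (mem_baseSet_of_mem_source hy)]
  refine Filter.EventuallyEq.mdifferentiableAt_iff ?_
  filter_upwards [(isOpen_extChartAt_source (I := 𝓡 n) x₀).mem_nhds hy] with z hz
  exact (toCoord_eq_snd hz _).symm

theorem contDiffOn_chart_of_contMDiffOn {x₀ : M} {U : Set M} {f : M → F}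
    (hf : ContMDiffOn (𝓡 n) 𝓘(ℝ, F) ∞ f U) :
    ContDiffOn ℝ ∞ (f ∘ (extChartAt (𝓡 n) x₀).symm)
      ((extChartAt (𝓡 n) x₀).target ∩ (extChartAt (𝓡 n) x₀).symm ⁻¹' U) := by
  rw [← contMDiffOn_iff_contDiffOn]
  exact hf.comp ((contMDiffOn_extChartAt_symm x₀).mono inter_subset_left) fun z hz ↦ hz.2

theorem contMDiffOn_of_contDiffOn_chart {x₀ : M} {U : Set M}
    (hUs : U ⊆ (extChartAt (𝓡 n) x₀).source) {g : Eucl n → F} {V : Set (Eucl n)}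
    (hg : ContDiffOn ℝ ∞ g V) (hV : MapsTo (extChartAt (𝓡 n) x₀) U V) :
    ContMDiffOn (𝓡 n) 𝓘(ℝ, F) ∞ (fun y ↦ g (extChartAt (𝓡 n) x₀ y)) U := by
  rw [← contMDiffOn_iff_contDiffOn] at hg
  refine hg.comp ((contMDiffOn_extChartAt (x := x₀)).mono fun y hy ↦ ?_) hV
  have := hUs hy
  rwa [extChartAt_source] at this

theorem mdifferentiableAt_extChartAt_symm_of_mem {x₀ : M} {z : Eucl n}
    (hz : z ∈ (extChartAt (𝓡 n) x₀).target) :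
    MDifferentiableAt 𝓘(ℝ, Eucl n) (𝓡 n) (extChartAt (𝓡 n) x₀).symm z :=
  (((contMDiffOn_extChartAt_symm (n := ∞) x₀) z hz).contMDiffAt
    ((isOpen_extChartAt_target x₀).mem_nhds hz)).mdifferentiableAt (by simp)

theorem hasFDerivAt_chart {x₀ y : M} (hy : y ∈ (extChartAt (𝓡 n) x₀).source) {f : M → F}
    (hf : MDifferentiableAt (𝓡 n) 𝓘(ℝ, F) f y) :
    HasFDerivAt (f ∘ (extChartAt (𝓡 n) x₀).symm)
      ((mfderiv (𝓡 n) 𝓘(ℝ, F) f y : TangentSpace (𝓡 n) y →L[ℝ] F) ∘L ofCoord x₀ y)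
      (extChartAt (𝓡 n) x₀ y) := by
  have h1 := (mdifferentiableAt_extChartAt_symm_of_mem
    ((extChartAt (𝓡 n) x₀).map_source hy)).hasMFDerivAt
  have h2 := hf.hasMFDerivAt
  rw [← (extChartAt (𝓡 n) x₀).left_inv hy] at h2
  have h3 := HasMFDerivAt.comp _ h2 h1
  rw [ofCoord_eq_mfderiv hy]
  have h4 := h3.hasFDerivAt
  rw [(extChartAt (𝓡 n) x₀).left_inv hy] at h4
  exact h4

end Coordinates

/-! ### Christoffel symbols -/

section Christoffel

variable {n : ℕ} {M : Type*} [TopologicalSpace M] [ChartedSpace (EuclideanSpace ℝ (Fin n)) M]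
  [IsManifold (𝓡 n) ∞ M]

/-- The vector field with constant components in the chart at `x₀`. -/
def coordField (x₀ : M) (v : Eucl n) (y : M) : TangentSpace (𝓡 n) y := ofCoord x₀ y v

/-- The components of a vector field in the chart at `x₀`. -/
def fieldCoord (x₀ : M) (X : Π y : M, TangentSpace (𝓡 n) y) (z : Eucl n) : Eucl n :=
  toCoord x₀ ((extChartAt (𝓡 n) x₀).symm z) (X ((extChartAt (𝓡 n) x₀).symm z))

theorem contMDiffOn_coordField (x₀ : M) (v : Eucl n) :
    ContMDiffOn (𝓡 n) (𝓡 n).tangent ∞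
      (fun y ↦ (⟨y, coordField x₀ v y⟩ : TangentBundle (𝓡 n) M)) (extChartAt (𝓡 n) x₀).source :=
  (contMDiffOn_field_iff (isOpen_extChartAt_source x₀) subset_rfl).2
    ((contMDiffOn_const (c := v)).congr fun _ hy ↦ toCoord_ofCoord hy v)

theorem mdifferentiableAt_coordField {x₀ y : M} (hy : y ∈ (extChartAt (𝓡 n) x₀).source)
    (v : Eucl n) : MDifferentiableAt (𝓡 n) (𝓡 n).tangent
      (fun y ↦ (⟨y, coordField x₀ v y⟩ : TangentBundle (𝓡 n) M)) y :=
  ((contMDiffOn_coordField x₀ v).contMDiffAt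
    ((isOpen_extChartAt_source x₀).mem_nhds hy)).mdifferentiableAt (by simp)

/-- The Christoffel symbols in the chart at `x₀`. -/
def christoffel (D : Connection n M) (x₀ : M) (z : Eucl n) : Eucl n →L[ℝ] Eucl n →L[ℝ] Eucl n :=
  ∑ j : Fin n, (ContinuousLinearMap.smulRightL ℝ (Eucl n) (Eucl n) (EuclideanSpace.proj j)) ∘L
    (toCoord x₀ ((extChartAt (𝓡 n) x₀).symm z) ∘L
      D (coordField x₀ (EuclideanSpace.single j 1)) ((extChartAt (𝓡 n) x₀).symm z) ∘L
        ofCoord x₀ ((extChartAt (𝓡 n) x₀).symm z))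

theorem christoffel_apply (D : Connection n M) (x₀ : M) (z u v : Eucl n) :
    christoffel D x₀ z u v = ∑ j : Fin n, v j • toCoord x₀ ((extChartAt (𝓡 n) x₀).symm z)
      (D (coordField x₀ (EuclideanSpace.single j 1)) ((extChartAt (𝓡 n) x₀).symm z)
        (ofCoord x₀ ((extChartAt (𝓡 n) x₀).symm z) u)) := by
  simp only [christoffel, sum_apply]
  rfl

theorem conn_finset_sum (D : Connection n M) {ι : Type*} (s : Finset ι)
    {X : ι → Π y : M, TangentSpace (𝓡 n) y} {y : M}
    (hX : ∀ i ∈ s, MDifferentiableAt (𝓡 n) (𝓡 n).tangent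
      (fun y ↦ (⟨y, X i y⟩ : TangentBundle (𝓡 n) M)) y) :
    MDifferentiableAt (𝓡 n) (𝓡 n).tangent
      (fun y ↦ (⟨y, (∑ i ∈ s, X i) y⟩ : TangentBundle (𝓡 n) M)) y ∧
      D (∑ i ∈ s, X i) y = ∑ i ∈ s, D (X i) y := by
  classical
  induction s using Finset.induction_on with
  | empty =>
    simp only [Finset.sum_empty, CovariantDerivative.zero]
    exact ⟨mdifferentiableAt_zeroSection .., rfl⟩
  | insert a s ha ih =>
    have h1 := ih fun i hi ↦ hX i (Finset.mem_insert_of_mem hi)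
    have h2 := hX a (Finset.mem_insert_self a s)
    rw [Finset.sum_insert ha, Finset.sum_insert ha]
    refine ⟨mdifferentiableAt_add_section h2 h1.1, ?_⟩
    rw [D.isCovariantDerivativeOn.add h2 h1.1, h1.2]

/-- The covariant derivative in coordinates. -/
theorem toCoord_conn (D : Connection n M) {x₀ y : M} (hy : y ∈ (extChartAt (𝓡 n) x₀).source)
    {X : Π y : M, TangentSpace (𝓡 n) y} (hX : MDifferentiableAt (𝓡 n) (𝓡 n).tangent
      (fun y ↦ (⟨y, X y⟩ : TangentBundle (𝓡 n) M)) y) (u : Eucl n) :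
    DifferentiableAt ℝ (fieldCoord x₀ X) (extChartAt (𝓡 n) x₀ y) ∧
    toCoord x₀ y (D X y (ofCoord x₀ y u)) = fderiv ℝ (fieldCoord x₀ X) (extChartAt (𝓡 n) x₀ y) u
      + christoffel D x₀ (extChartAt (𝓡 n) x₀ y) u (toCoord x₀ y (X y)) := by
  have hX' := (mdifferentiableAt_field_iff hy).1 hX
  have hd := hasFDerivAt_chart hy hX'
  refine ⟨hd.differentiableAt, ?_⟩
  let f : Fin n → M → ℝ := fun j y ↦ toCoord x₀ y (X y) j
  let e : Fin n → Π y : M, TangentSpace (𝓡 n) y := fun j ↦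
    coordField x₀ (EuclideanSpace.single j 1)
  have hf : ∀ j, MDifferentiableAt (𝓡 n) 𝓘(ℝ, ℝ) (f j) y := fun j ↦
    (EuclideanSpace.proj j : Eucl n →L[ℝ] ℝ).mdifferentiableAt.comp y hX'
  have he := fun j ↦ mdifferentiableAt_coordField hy (EuclideanSpace.single j (1 : ℝ))
  have hfe : ∀ j ∈ Finset.univ, MDifferentiableAt (𝓡 n) (𝓡 n).tangent
      (fun y ↦ (⟨y, (f j • e j) y⟩ : TangentBundle (𝓡 n) M)) y := fun j _ ↦
    (hf j).smul_section (he j)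
  have hsum := conn_finset_sum D Finset.univ hfe
  -- Expansion in the coordinate frame, to which the Leibniz rule applies term by term; it holds
  -- only near `y`, so locality of the connection is needed.
  have hev : ∀ᶠ z in 𝓝 y, X z = (∑ j, f j • e j) z := by
    filter_upwards [(isOpen_extChartAt_source (I := 𝓡 n) x₀).mem_nhds hy] with z hz
    rw [Finset.sum_apply]
    have h1 : (fun j ↦ (f j • e j) z) = fun j ↦ ofCoord x₀ z
        ((toCoord x₀ z (X z)) j • EuclideanSpace.single j (1 : ℝ)) := by
      funext j
      rw [map_smul]
      rfl
    simp only [h1]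
    rw [← map_sum]
    have h2 : ∑ j, (toCoord x₀ z (X z)) j • EuclideanSpace.single j (1 : ℝ)
        = toCoord x₀ z (X z) := by
      conv_rhs => rw [← (EuclideanSpace.basisFun (Fin n) ℝ).sum_repr (toCoord x₀ z (X z))]
      simp
    rw [h2, ofCoord_toCoord hz]
  rw [D.isCovariantDerivativeOn.congr_of_eventuallyEq hX hsum.1 Filter.univ_mem hev, hsum.2]
  rw [sum_apply, map_sum, christoffel_apply, (extChartAt (𝓡 n) x₀).left_inv hy]
  have hterm : ∀ j, toCoord x₀ y (D (f j • e j) y (ofCoord x₀ y u))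
      = f j y • toCoord x₀ y (D (e j) y (ofCoord x₀ y u))
        + (fderiv ℝ (fieldCoord x₀ X) (extChartAt (𝓡 n) x₀ y) u) j •
          EuclideanSpace.single j (1 : ℝ) := by
    intro j
    rw [D.isCovariantDerivativeOn.leibniz (he j) (hf j)]
    have h1 : mvfderiv (𝓡 n) (f j) y (ofCoord x₀ y u)
        = (fderiv ℝ (fieldCoord x₀ X) (extChartAt (𝓡 n) x₀ y) u) j := by
      have h2 := hasFDerivAt_chart hy (hf j)
      have h3 : HasFDerivAt (f j ∘ (extChartAt (𝓡 n) x₀).symm)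
          ((EuclideanSpace.proj j : Eucl n →L[ℝ] ℝ) ∘L
            fderiv ℝ (fieldCoord x₀ X) (extChartAt (𝓡 n) x₀ y)) (extChartAt (𝓡 n) x₀ y) :=
        (EuclideanSpace.proj j : Eucl n →L[ℝ] ℝ).hasFDerivAt.comp _
          hd.differentiableAt.hasFDerivAt
      exact (DFunLike.congr_fun (h3.unique h2) u).symm
    rw [add_apply, map_add, ContinuousLinearMap.smulRight_apply, h1, map_smul]
    congr 1
    · exact (toCoord x₀ y).map_smul (f j y) _
    · congr 1
      exact toCoord_ofCoord hy _
  simp only [hterm, Finset.sum_add_distrib]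
  rw [add_comm]
  congr 1
  conv_rhs => rw [← (EuclideanSpace.basisFun (Fin n) ℝ).sum_repr
    (fderiv ℝ (fieldCoord x₀ X) (extChartAt (𝓡 n) x₀ y) u)]
  simp

end Christoffel

/-! ### Smoothness and symmetry of the Christoffel symbols -/

section LocalConnection

variable {n : ℕ} {M : Type*} [TopologicalSpace M] [ChartedSpace (EuclideanSpace ℝ (Fin n)) M]
  [IsManifold (𝓡 n) ∞ M]

theorem field_of_coord {x₀ y : M} (hy : y ∈ (extChartAt (𝓡 n) x₀).source)
    {X : Π y : M, TangentSpace (𝓡 n) y} {g : Eucl n → Eucl n}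
    (h : ∀ᶠ y' in 𝓝 y, toCoord x₀ y' (X y') = g (extChartAt (𝓡 n) x₀ y'))
    (hg : DifferentiableAt ℝ g (extChartAt (𝓡 n) x₀ y)) :
    MDifferentiableAt (𝓡 n) (𝓡 n).tangent
      (fun y ↦ (⟨y, X y⟩ : TangentBundle (𝓡 n) M)) y ∧
    fieldCoord x₀ X =ᶠ[𝓝 (extChartAt (𝓡 n) x₀ y)] g := by
  constructor
  · rw [mdifferentiableAt_field_iff hy, Filter.EventuallyEq.mdifferentiableAt_iff h]
    refine hg.mdifferentiableAt.comp y ?_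
    exact mdifferentiableAt_extChartAt (by rwa [extChartAt_source] at hy)
  · have h1 : Filter.Tendsto (extChartAt (𝓡 n) x₀).symm (𝓝 (extChartAt (𝓡 n) x₀ y)) (𝓝 y) := by
      have := continuousAt_extChartAt_symm'' ((extChartAt (𝓡 n) x₀).map_source hy)
      rwa [ContinuousAt, (extChartAt (𝓡 n) x₀).left_inv hy] at this
    filter_upwards [h1.eventually h, (isOpen_extChartAt_target (I := 𝓡 n) x₀).mem_nhds
      ((extChartAt (𝓡 n) x₀).map_source hy)] with z hz hzt
    rw [fieldCoord, hz, (extChartAt (𝓡 n) x₀).right_inv hzt]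

theorem toCoord_conn_of_coord (D : Connection n M) {x₀ y : M}
    (hy : y ∈ (extChartAt (𝓡 n) x₀).source)
    {X : Π y : M, TangentSpace (𝓡 n) y} {g : Eucl n → Eucl n}
    (h : ∀ᶠ y' in 𝓝 y, toCoord x₀ y' (X y') = g (extChartAt (𝓡 n) x₀ y'))
    (hg : DifferentiableAt ℝ g (extChartAt (𝓡 n) x₀ y)) (u : Eucl n) :
    toCoord x₀ y (D X y (ofCoord x₀ y u)) = fderiv ℝ g (extChartAt (𝓡 n) x₀ y) u
      + christoffel D x₀ (extChartAt (𝓡 n) x₀ y) u (g (extChartAt (𝓡 n) x₀ y)) := by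
  obtain ⟨h1, h2⟩ := field_of_coord hy h hg
  rw [(toCoord_conn D hy h1 u).2, h2.fderiv_eq, h.self_of_nhds]

theorem toCoord_conn_coordField (D : Connection n M) {x₀ y : M}
    (hy : y ∈ (extChartAt (𝓡 n) x₀).source) (u v : Eucl n) :
    toCoord x₀ y (D (coordField x₀ v) y (ofCoord x₀ y u))
      = christoffel D x₀ (extChartAt (𝓡 n) x₀ y) u v := by
  rw [toCoord_conn_of_coord D hy (g := fun _ ↦ v) _ (differentiableAt_const v)]
  · simp
  · filter_upwards [(isOpen_extChartAt_source (I := 𝓡 n) x₀).mem_nhds hy] with z hz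
    exact toCoord_ofCoord hz v

/-- A locally defined smooth vector field extends to a global one after shrinking the domain. -/
theorem exists_smoothField_eventuallyEq [T2Space M] {U : Set M} (hU : IsOpen U) {y : M}
    (hy : y ∈ U) {X : Π y : M, TangentSpace (𝓡 n) y}
    (hX : ContMDiffOn (𝓡 n) (𝓡 n).tangent ∞ (fun y ↦ (⟨y, X y⟩ : TangentBundle (𝓡 n) M)) U) :
    ∃ X' : Π y : M, TangentSpace (𝓡 n) y, IsSmoothField X' ∧ ∀ᶠ z in 𝓝 y, X' z = X z := by
  obtain ⟨f, hf⟩ : ∃ f : SmoothBumpFunction (𝓡 n) y, tsupport f ⊆ U := by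
    obtain ⟨f, -, hf⟩ := (SmoothBumpFunction.nhds_basis_tsupport (I := 𝓡 n) y).mem_iff.1
      (hU.mem_nhds hy)
    exact ⟨f, hf⟩
  refine ⟨(f : M → ℝ) • X, ?_, ?_⟩
  · exact ContMDiffOn.smul_section_of_tsupport f.contMDiff.contMDiffOn hU hf hX
  · filter_upwards [f.eventuallyEq_one] with z hz
    change f z • X z = X z
    rw [hz]
    simp

/-- Smoothness of the connection is applied to global smooth fields. A bump function extends a
coordinate field from near each point, and locality of the connection returns to the coordinate
field itself. -/
theorem contDiffOn_christoffel [T2Space M] {D : Connection n M}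
    (hD : CovariantDerivative.ContMDiffCovariantDerivative D ∞) (x₀ : M) :
    ContDiffOn ℝ ∞ (christoffel D x₀) (extChartAt (𝓡 n) x₀).target := by
  refine contDiffOn_of_forall_apply_apply fun u v z hz ↦ ?_
  set κ := extChartAt (𝓡 n) x₀
  have hy : κ.symm z ∈ κ.source := κ.map_target hz
  have hsrc : IsOpen κ.source := isOpen_extChartAt_source x₀
  obtain ⟨X, hX, hXv⟩ := exists_smoothField_eventuallyEq hsrc hy (contMDiffOn_coordField x₀ v)
  have h1 := (hD.contMDiff.contMDiff (σ := X) hX.contMDiffOn).mono (subset_univ κ.source)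
  have h2 := h1.clm_bundle_apply (contMDiffOn_coordField x₀ u)
  have h3 := (contMDiffOn_field_iff hsrc subset_rfl).1 h2
  have h4 := contDiffOn_chart_of_contMDiffOn (x₀ := x₀) h3
  have h5 : κ.target ∩ κ.symm ⁻¹' κ.source ∈ 𝓝 z := by
    filter_upwards [(isOpen_extChartAt_target (I := 𝓡 n) x₀).mem_nhds hz] with w hw
    exact ⟨hw, κ.map_target hw⟩
  refine ((h4.contDiffAt h5).congr_of_eventuallyEq ?_).contDiffWithinAt
  have h6 : Filter.Tendsto κ.symm (𝓝 z) (𝓝 (κ.symm z)) := continuousAt_extChartAt_symm'' hz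
  filter_upwards [h6.eventually hXv.eventually_nhds, h5] with w hw hwt
  have hw' : κ.symm w ∈ κ.source := hwt.2
  rw [Function.comp_apply, D.isCovariantDerivativeOn.congr_of_eventuallyEq
    ((hX _).mdifferentiableAt (by simp)) (mdifferentiableAt_coordField hw' v) Filter.univ_mem hw]
  have := toCoord_conn_coordField D hw' u v
  rw [show extChartAt (𝓡 n) x₀ (κ.symm w) = w from κ.right_inv hwt.1] at this
  exact this.symm

/-- Coordinate fields are pullbacks of constant fields under the chart, and pullback respects the
bracket. -/
theorem mlieBracket_coordField {x₀ y : M} (hy : y ∈ (extChartAt (𝓡 n) x₀).source)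
    (u v : Eucl n) :
    VectorField.mlieBracket (𝓡 n) (coordField x₀ u) (coordField x₀ v) y = 0 := by
  let V : Eucl n → Π x : Eucl n, TangentSpace 𝓘(ℝ, Eucl n) x := fun u _ ↦ u
  have hV : ∀ u x, MDifferentiableAt 𝓘(ℝ, Eucl n) 𝓘(ℝ, Eucl n).tangent
      (fun x ↦ (⟨x, V u x⟩ : TangentBundle 𝓘(ℝ, Eucl n) (Eucl n))) x := fun u x ↦
    ((contMDiffAt_vectorSpace_iff_contDiffAt (V := V u) (n := 1)).2
      contDiffAt_const).mdifferentiableAt (by simp)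
  have hpull : ∀ u, VectorField.mpullback (𝓡 n) 𝓘(ℝ, Eucl n) (extChartAt (𝓡 n) x₀) (V u)
      =ᶠ[𝓝 y] coordField x₀ u := by
    intro u
    filter_upwards [(isOpen_extChartAt_source (I := 𝓡 n) x₀).mem_nhds hy] with z hz
    rw [VectorField.mpullback_apply, ← toCoord_eq_mfderiv hz]
    change ContinuousLinearMap.inverse (toCoord x₀ z) u = ofCoord x₀ z u
    rw [ContinuousLinearMap.inverse_eq (g := ofCoord x₀ z)]
    · exact ContinuousLinearMap.ext fun w ↦ toCoord_ofCoord hz w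
    · exact ContinuousLinearMap.ext fun w ↦ ofCoord_toCoord hz w
  have : IsManifold (𝓡 n) (minSmoothness ℝ 2) M := by
    rw [minSmoothness_of_isRCLikeNormedField]
    exact IsManifold.of_le (n := ∞) (WithTop.coe_le_coe.2 (le_top (a := (2 : ℕ∞))))
  have : IsManifold (𝓡 n) 2 M :=
    IsManifold.of_le (n := ∞) (WithTop.coe_le_coe.2 (le_top (a := (2 : ℕ∞))))
  rw [← (hpull u).mlieBracket_vectorField_eq (hpull v),
    ← VectorField.mpullback_mlieBracket (n := 2) (hV u _) (hV v _)]
  · rw [VectorField.mpullback_apply, ← VectorField.mlieBracketWithin_univ,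
      VectorField.mlieBracketWithin_eq_lieBracketWithin]
    simp only [VectorField.lieBracketWithin, V, fderivWithin_fun_const, Pi.zero_apply,
      zero_apply, sub_self]
    exact map_zero _
  · exact ((contMDiffAt_extChartAt' (n := 2) (by rwa [extChartAt_source] at hy)))
  · simp [minSmoothness_of_isRCLikeNormedField]

theorem christoffel_symm {D : Connection n M} (hD : D.torsion = 0) {x₀ : M} {z : Eucl n}
    (hz : z ∈ (extChartAt (𝓡 n) x₀).target) (u v : Eucl n) :
    christoffel D x₀ z u v = christoffel D x₀ z v u := by
  have hy := (extChartAt (𝓡 n) x₀).map_target hz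
  have h := (D.torsion_eq_zero_iff.1 hD) (mdifferentiableAt_coordField hy u)
    (mdifferentiableAt_coordField hy v)
  rw [mlieBracket_coordField hy, sub_eq_zero] at h
  have h1 := toCoord_conn_coordField D hy u v
  have h2 := toCoord_conn_coordField D hy v u
  rw [(extChartAt (𝓡 n) x₀).right_inv hz] at h1 h2
  rw [← h1, ← h2]
  exact congrArg _ h

end LocalConnection

/-! ### Curvature in coordinates -/

section Curvature

theorem fderiv_covDeriv_coord {E : Type*} [NormedAddCommGroup E] [NormedSpace ℝ E]
    {Γ : E → E →L[ℝ] E →L[ℝ] E} {Y Z : E → E} {z : E} (hΓ : DifferentiableAt ℝ Γ z)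
    (hY : DifferentiableAt ℝ Y z) (hZ : ContDiffAt ℝ 2 Z z) :
    DifferentiableAt ℝ (fun x ↦ fderiv ℝ Z x (Y x) + Γ x (Y x) (Z x)) z ∧
    ∀ u, fderiv ℝ (fun x ↦ fderiv ℝ Z x (Y x) + Γ x (Y x) (Z x)) z u
      = fderiv ℝ (fderiv ℝ Z) z u (Y z) + fderiv ℝ Z z (fderiv ℝ Y z u)
        + (fderiv ℝ Γ z u (Y z) (Z z) + Γ z (fderiv ℝ Y z u) (Z z)
          + Γ z (Y z) (fderiv ℝ Z z u)) := by
  have hZd : DifferentiableAt ℝ Z z := hZ.differentiableAt (by simp)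
  have hZdd : DifferentiableAt ℝ (fderiv ℝ Z) z :=
    (hZ.fderiv_right (m := 1) (by norm_num)).differentiableAt (by simp)
  have a := fderiv_clm_apply_apply hZdd hY
  have b := fderiv_clm_apply_apply hΓ hY
  have c := fderiv_clm_apply_apply b.1 hZd
  have h := a.1.hasFDerivAt.add c.1.hasFDerivAt
  refine ⟨h.differentiableAt, fun u ↦ ?_⟩
  have e := congrArg (fun L : E →L[ℝ] E ↦ L u) h.fderiv
  refine e.trans ?_
  rw [add_apply, a.2, c.2, b.2]
  rfl

variable {n : ℕ} {M : Type*} [TopologicalSpace M] [ChartedSpace (EuclideanSpace ℝ (Fin n)) M]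
  [IsManifold (𝓡 n) ∞ M]

theorem toCoord_conn_apply (D : Connection n M) {x₀ y : M}
    (hy : y ∈ (extChartAt (𝓡 n) x₀).source)
    {X : Π y : M, TangentSpace (𝓡 n) y} (hX : MDifferentiableAt (𝓡 n) (𝓡 n).tangent
      (fun y ↦ (⟨y, X y⟩ : TangentBundle (𝓡 n) M)) y) (w : TangentSpace (𝓡 n) y) :
    toCoord x₀ y (D X y w) = fderiv ℝ (fieldCoord x₀ X) (extChartAt (𝓡 n) x₀ y) (toCoord x₀ y w)
      + christoffel D x₀ (extChartAt (𝓡 n) x₀ y) (toCoord x₀ y w) (toCoord x₀ y (X y)) := by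
  rw [← (toCoord_conn D hy hX (toCoord x₀ y w)).2, ofCoord_toCoord hy]

theorem fieldCoord_apply {x₀ y : M} (hy : y ∈ (extChartAt (𝓡 n) x₀).source)
    (X : Π y : M, TangentSpace (𝓡 n) y) :
    fieldCoord x₀ X (extChartAt (𝓡 n) x₀ y) = toCoord x₀ y (X y) := by
  rw [fieldCoord, (extChartAt (𝓡 n) x₀).left_inv hy]

theorem contDiffAt_fieldCoord {x₀ y : M} (hy : y ∈ (extChartAt (𝓡 n) x₀).source)
    {U : Set M} (hU : IsOpen U) (hyU : y ∈ U) {X : Π y : M, TangentSpace (𝓡 n) y}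
    (hX : ContMDiffOn (𝓡 n) (𝓡 n).tangent ∞ (fun y ↦ (⟨y, X y⟩ : TangentBundle (𝓡 n) M)) U) :
    ContDiffAt ℝ ∞ (fieldCoord x₀ X) (extChartAt (𝓡 n) x₀ y) := by
  have hV : IsOpen (U ∩ (extChartAt (𝓡 n) x₀).source) :=
    hU.inter (isOpen_extChartAt_source x₀)
  have h1 := contDiffOn_chart_of_contMDiffOn (x₀ := x₀)
    ((contMDiffOn_field_iff hV inter_subset_right).1 (hX.mono inter_subset_left))
  refine h1.contDiffAt (Filter.inter_mem ?_ ?_)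
  · exact (isOpen_extChartAt_target (I := 𝓡 n) x₀).mem_nhds ((extChartAt (𝓡 n) x₀).map_source hy)
  · refine (continuousAt_extChartAt_symm'' ((extChartAt (𝓡 n) x₀).map_source hy)) ?_
    rw [(extChartAt (𝓡 n) x₀).left_inv hy]
    exact hV.mem_nhds ⟨hyU, hy⟩

theorem toCoord_conn_conn [T2Space M] {D : Connection n M}
    (hD : CovariantDerivative.ContMDiffCovariantDerivative D ∞) {x₀ y : M}
    (hy : y ∈ (extChartAt (𝓡 n) x₀).source) {U : Set M} (hU : IsOpen U) (hyU : y ∈ U)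
    {Y Z : Π y : M, TangentSpace (𝓡 n) y}
    (hY : ContMDiffOn (𝓡 n) (𝓡 n).tangent ∞ (fun y ↦ (⟨y, Y y⟩ : TangentBundle (𝓡 n) M)) U)
    (hZ : ContMDiffOn (𝓡 n) (𝓡 n).tangent ∞ (fun y ↦ (⟨y, Z y⟩ : TangentBundle (𝓡 n) M)) U)
    (w : TangentSpace (𝓡 n) y) :
    toCoord x₀ y (D (fun y ↦ D Z y (Y y)) y w) =
      fderiv ℝ (fun z ↦ fderiv ℝ (fieldCoord x₀ Z) z (fieldCoord x₀ Y z)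
        + christoffel D x₀ z (fieldCoord x₀ Y z) (fieldCoord x₀ Z z)) (extChartAt (𝓡 n) x₀ y)
        (toCoord x₀ y w)
      + christoffel D x₀ (extChartAt (𝓡 n) x₀ y) (toCoord x₀ y w)
        (fderiv ℝ (fieldCoord x₀ Z) (extChartAt (𝓡 n) x₀ y) (toCoord x₀ y (Y y))
          + christoffel D x₀ (extChartAt (𝓡 n) x₀ y) (toCoord x₀ y (Y y))
            (toCoord x₀ y (Z y))) := by
  have hΓ : DifferentiableAt ℝ (christoffel D x₀) (extChartAt (𝓡 n) x₀ y) :=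
    ((contDiffOn_christoffel hD x₀).contDiffAt ((isOpen_extChartAt_target (I := 𝓡 n) x₀).mem_nhds
      ((extChartAt (𝓡 n) x₀).map_source hy))).differentiableAt (by simp)
  have hg := (fderiv_covDeriv_coord hΓ
    ((contDiffAt_fieldCoord hy hU hyU hY).differentiableAt (by simp))
    ((contDiffAt_fieldCoord hy hU hyU hZ).of_le
      (WithTop.coe_le_coe.2 (le_top (a := (2 : ℕ∞)))))).1
  have hev : ∀ᶠ y' in 𝓝 y, toCoord x₀ y' (D Z y' (Y y')) =
      (fun z ↦ fderiv ℝ (fieldCoord x₀ Z) z (fieldCoord x₀ Y z)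
        + christoffel D x₀ z (fieldCoord x₀ Y z) (fieldCoord x₀ Z z))
        (extChartAt (𝓡 n) x₀ y') := by
    filter_upwards [hU.mem_nhds hyU, (isOpen_extChartAt_source (I := 𝓡 n) x₀).mem_nhds hy]
      with y' hyU' hy'
    simp only [fieldCoord_apply hy']
    exact toCoord_conn_apply D hy'
      ((hZ.contMDiffAt (hU.mem_nhds hyU')).mdifferentiableAt (by simp)) _
  have h := toCoord_conn_of_coord D hy hev hg (toCoord x₀ y w)
  rw [ofCoord_toCoord hy] at h
  rw [h]
  simp only [fieldCoord_apply hy]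

/-- Vanishing torsion replaces `[X, Y]` by `∇_X Y - ∇_Y X`, so no coordinate formula for the bracket
is needed. The terms differentiating `X`, `Y` and the second derivatives of `Z` then cancel. -/
theorem toCoord_curvature [T2Space M] {D : Connection n M}
    (hD : CovariantDerivative.ContMDiffCovariantDerivative D ∞) (hD' : D.torsion = 0) {x₀ y : M}
    (hy : y ∈ (extChartAt (𝓡 n) x₀).source) {U : Set M} (hU : IsOpen U) (hyU : y ∈ U)
    {X Y Z : Π y : M, TangentSpace (𝓡 n) y}
    (hX : ContMDiffOn (𝓡 n) (𝓡 n).tangent ∞ (fun y ↦ (⟨y, X y⟩ : TangentBundle (𝓡 n) M)) U)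
    (hY : ContMDiffOn (𝓡 n) (𝓡 n).tangent ∞ (fun y ↦ (⟨y, Y y⟩ : TangentBundle (𝓡 n) M)) U)
    (hZ : ContMDiffOn (𝓡 n) (𝓡 n).tangent ∞ (fun y ↦ (⟨y, Z y⟩ : TangentBundle (𝓡 n) M)) U) :
    toCoord x₀ y (curvature D X Y Z y) =
      linCurv (christoffel D x₀) (extChartAt (𝓡 n) x₀ y) (toCoord x₀ y (X y))
        (toCoord x₀ y (Y y)) (toCoord x₀ y (Z y)) := by
  have hm : ∀ {X : Π y : M, TangentSpace (𝓡 n) y}, ContMDiffOn (𝓡 n) (𝓡 n).tangent ∞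
      (fun y ↦ (⟨y, X y⟩ : TangentBundle (𝓡 n) M)) U → MDifferentiableAt (𝓡 n) (𝓡 n).tangent
      (fun y ↦ (⟨y, X y⟩ : TangentBundle (𝓡 n) M)) y := fun h ↦
    (h.contMDiffAt (hU.mem_nhds hyU)).mdifferentiableAt (by simp)
  have h2 : (2 : WithTop ℕ∞) ≤ ∞ := WithTop.coe_le_coe.2 (le_top (a := (2 : ℕ∞)))
  have hΓ : DifferentiableAt ℝ (christoffel D x₀) (extChartAt (𝓡 n) x₀ y) :=
    ((contDiffOn_christoffel hD x₀).contDiffAt ((isOpen_extChartAt_target (I := 𝓡 n) x₀).mem_nhds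
      ((extChartAt (𝓡 n) x₀).map_source hy))).differentiableAt (by simp)
  have hXc := contDiffAt_fieldCoord hy hU hyU hX
  have hYc := contDiffAt_fieldCoord hy hU hyU hY
  have hZc := contDiffAt_fieldCoord hy hU hyU hZ
  have hsymm : ∀ u v, fderiv ℝ (fderiv ℝ (fieldCoord x₀ Z)) (extChartAt (𝓡 n) x₀ y) u v
      = fderiv ℝ (fderiv ℝ (fieldCoord x₀ Z)) (extChartAt (𝓡 n) x₀ y) v u := fun u v ↦
    hZc.isSymmSndFDerivAt (by simpa only [minSmoothness_of_isRCLikeNormedField] using h2) u v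
  have hbr := (D.torsion_eq_zero_iff.1 hD') (hm hX) (hm hY)
  have hsy := christoffel_symm hD' ((extChartAt (𝓡 n) x₀).map_source hy)
  rw [curvature, ← hbr, map_sub, map_sub, toCoord_conn_conn hD hy hU hyU hY hZ,
    toCoord_conn_conn hD hy hU hyU hX hZ, toCoord_conn_apply D hy (hm hZ), map_sub,
    toCoord_conn_apply D hy (hm hY), toCoord_conn_apply D hy (hm hX),
    (fderiv_covDeriv_coord hΓ (hYc.differentiableAt (by simp)) (hZc.of_le h2)).2,
    (fderiv_covDeriv_coord hΓ (hXc.differentiableAt (by simp)) (hZc.of_le h2)).2]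
  simp only [fieldCoord_apply hy]
  rw [hsy (toCoord x₀ y (Y y)) (toCoord x₀ y (X y)), add_sub_add_right_eq_sub, linCurv,
    hsymm (toCoord x₀ y (Y y))]
  simp only [(christoffel D x₀ (extChartAt (𝓡 n) x₀ y)).map_sub, sub_apply, map_sub, map_add]
  abel

theorem extend_eq_coordField {y z : M} (hz : z ∈ (extChartAt (𝓡 n) y).source)
    (u : TangentSpace (𝓡 n) y) :
    FiberBundle.extend (EuclideanSpace ℝ (Fin n)) u z = coordField y (toCoord y y u) z := by
  rw [FiberBundle.extend, toCoord_eq_snd (mem_extChartAt_source y), coordField, ofCoord,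
    Trivialization.symmL_apply _ (mem_baseSet_of_mem_source hz)]

theorem contMDiffOn_extend {y : M} (u : TangentSpace (𝓡 n) y) :
    ContMDiffOn (𝓡 n) (𝓡 n).tangent ∞ (fun z ↦ (⟨z, FiberBundle.extend
      (EuclideanSpace ℝ (Fin n)) u z⟩ : TangentBundle (𝓡 n) M)) (extChartAt (𝓡 n) y).source :=
  (contMDiffOn_coordField y (toCoord y y u)).congr fun z hz ↦ by rw [extend_eq_coordField hz]

/-- The extensions have constant components in the chart at `y`, while the components are taken in
the chart at `x₀`; the formula for arbitrary fields makes the two charts independent. -/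
theorem toCoord_curvatureAt [T2Space M] {D : Connection n M}
    (hD : CovariantDerivative.ContMDiffCovariantDerivative D ∞) (hD' : D.torsion = 0) {x₀ y : M}
    (hy : y ∈ (extChartAt (𝓡 n) x₀).source) (u v w : TangentSpace (𝓡 n) y) :
    toCoord x₀ y (curvatureAt D y u v w) =
      linCurv (christoffel D x₀) (extChartAt (𝓡 n) x₀ y) (toCoord x₀ y u)
        (toCoord x₀ y v) (toCoord x₀ y w) := by
  rw [curvatureAt, toCoord_curvature hD hD' hy (isOpen_extChartAt_source y)
    (mem_extChartAt_source y) (contMDiffOn_extend u) (contMDiffOn_extend v) (contMDiffOn_extend w)]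
  simp only [FiberBundle.extend_apply_self]

/-- The Ricci tensor serves as the unspecified coefficient; no comparison of traces in different
bases is needed, since `IsProjFlat.linCurv_eq` recovers the coefficient from the curvature. -/
theorem isProjFlat_christoffel [T2Space M] {S : EquiaffineStructure n M}
    (hS : S.IsEquiprojective) (x₀ : M) :
    IsProjFlat (christoffel S.conn x₀) (extChartAt (𝓡 n) x₀).target := by
  refine ⟨contDiffOn_christoffel S.smooth_conn x₀, fun z hz ↦
    christoffel_symm S.torsion_eq_zero hz, fun z hz ↦ ?_⟩
  have hy := (extChartAt (𝓡 n) x₀).map_target hz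
  set y := (extChartAt (𝓡 n) x₀).symm z
  refine ⟨fun v w ↦ ((n : ℝ) - 1)⁻¹ * ricciAt S.conn y (ofCoord x₀ y v) (ofCoord x₀ y w),
    fun u v w ↦ ?_⟩
  have h1 := toCoord_curvatureAt S.smooth_conn S.torsion_eq_zero hy (ofCoord x₀ y u)
    (ofCoord x₀ y v) (ofCoord x₀ y w)
  rw [hS] at h1
  simp only [toCoord_ofCoord hy, map_smul, map_sub] at h1
  rw [show extChartAt (𝓡 n) x₀ y = z from (extChartAt (𝓡 n) x₀).right_inv hz] at h1
  rw [← h1, smul_sub, mul_smul, mul_smul]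

end Curvature

/-! ### Velocity and covariant derivative along curves in coordinates -/

section Curves

variable {n : ℕ} {M : Type*} [TopologicalSpace M] [ChartedSpace (EuclideanSpace ℝ (Fin n)) M]
  [IsManifold (𝓡 n) ∞ M]

theorem hasDerivAt_chart_curve {x₀ : M} {γ : ℝ → M} {t : ℝ}
    (hγ : MDifferentiableAt 𝓘(ℝ, ℝ) (𝓡 n) γ t) (ht : γ t ∈ (extChartAt (𝓡 n) x₀).source) :
    HasDerivAt (fun s ↦ extChartAt (𝓡 n) x₀ (γ s)) (toCoord x₀ (γ t) (velocity n γ t)) t := by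
  have h1 : HasMFDerivAt (𝓡 n) 𝓘(ℝ, Eucl n) (extChartAt (𝓡 n) x₀) (γ t)
      (toCoord x₀ (γ t)) := by
    rw [toCoord_eq_mfderiv ht]
    exact (mdifferentiableAt_extChartAt (by rwa [extChartAt_source] at ht)).hasMFDerivAt
  have h2 : HasFDerivAt (fun s ↦ extChartAt (𝓡 n) x₀ (γ s))
      ((toCoord x₀ (γ t)).comp (mfderiv 𝓘(ℝ, ℝ) (𝓡 n) γ t) : ℝ →L[ℝ] Eucl n) t :=
    (HasMFDerivAt.comp t h1 hγ.hasMFDerivAt).hasFDerivAt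
  exact h2.hasDerivAt

theorem isSmoothAlong_iff {x₀ : M} {γ : ℝ → M} {J : Set ℝ}
    (hγ : MapsTo γ J (extChartAt (𝓡 n) x₀).source) {V : Π t : ℝ, TangentSpace (𝓡 n) (γ t)} :
    IsSmoothAlong γ J V ↔ ContMDiffOn 𝓘(ℝ, ℝ) (𝓡 n) ∞ γ J ∧
      ContDiffOn ℝ ∞ (fun s ↦ toCoord x₀ (γ s) (V s)) J := by
  have h := (trivializationAt (Eucl n) (TangentSpace (𝓡 n) : M → Type) x₀).contMDiffOn_iff
    (IM := 𝓘(ℝ, ℝ)) (IB := 𝓡 n) (n := ∞) (s := J)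
    (f := fun t ↦ (⟨γ t, V t⟩ : TangentBundle (𝓡 n) M))
    (fun t ht ↦ (Trivialization.mem_source _).2 (mem_baseSet_of_mem_source (hγ ht)))
  refine h.trans (and_congr_right fun _ ↦ ?_)
  rw [contMDiffOn_iff_contDiffOn]
  exact contDiffOn_congr fun t ht ↦ (toCoord_eq_snd (hγ ht) _).symm

theorem contDiffOn_chart_curve {x₀ : M} {γ : ℝ → M} {J : Set ℝ}
    (hγ : MapsTo γ J (extChartAt (𝓡 n) x₀).source) (h : ContMDiffOn 𝓘(ℝ, ℝ) (𝓡 n) ∞ γ J) :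
    ContDiffOn ℝ ∞ (fun s ↦ extChartAt (𝓡 n) x₀ (γ s)) J := by
  rw [← contMDiffOn_iff_contDiffOn]
  refine (contMDiffOn_extChartAt (x := x₀)).comp h fun t ht ↦ ?_
  have := hγ ht
  rwa [extChartAt_source] at this

theorem contDiffOn_velocity {x₀ : M} {γ : ℝ → M} {J : Set ℝ} (hJ : IsOpen J)
    (hγ : MapsTo γ J (extChartAt (𝓡 n) x₀).source) (h : ContMDiffOn 𝓘(ℝ, ℝ) (𝓡 n) ∞ γ J) :
    ContDiffOn ℝ ∞ (fun s ↦ toCoord x₀ (γ s) (velocity n γ s)) J := by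
  have h1 := (contDiffOn_chart_curve hγ h).deriv_of_isOpen hJ (m := ∞) (by simp)
  refine h1.congr fun t ht ↦ ?_
  exact (hasDerivAt_chart_curve ((h.contMDiffAt (hJ.mem_nhds ht)).mdifferentiableAt (by simp))
    (hγ ht)).deriv.symm

theorem IsSmoothAlong.mono {γ : ℝ → M} {J J' : Set ℝ} {V : Π t : ℝ, TangentSpace (𝓡 n) (γ t)}
    (h : IsSmoothAlong γ J V) (hJ : J' ⊆ J) : IsSmoothAlong γ J' V :=
  ContMDiffOn.mono h hJ

theorem isSmoothAlong_velocity {γ : ℝ → M} {J : Set ℝ} (hJ : IsOpen J)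
    (h : ContMDiffOn 𝓘(ℝ, ℝ) (𝓡 n) ∞ γ J) : IsSmoothAlong γ J (velocity n γ) := by
  intro t ht
  let J' := J ∩ γ ⁻¹' (extChartAt (𝓡 n) (γ t)).source
  have hJ' : IsOpen J' := h.continuousOn.isOpen_inter_preimage hJ (isOpen_extChartAt_source _)
  have hJJ : J' ⊆ J := inter_subset_left
  have ht' : t ∈ J' := ⟨ht, mem_extChartAt_source _⟩
  have h1 : IsSmoothAlong γ J' (velocity n γ) := (isSmoothAlong_iff (x₀ := γ t) fun s hs ↦ hs.2).2
    ⟨h.mono hJJ, contDiffOn_velocity hJ' (fun s hs ↦ hs.2) (h.mono hJJ)⟩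
  exact (ContMDiffOn.contMDiffAt h1 (hJ'.mem_nhds ht')).contMDiffWithinAt

/-- The coordinate change of tangent vectors. -/
def coordChange (x₀ x₁ : M) (z : Eucl n) : Eucl n →L[ℝ] Eucl n :=
  toCoord x₀ ((extChartAt (𝓡 n) x₀).symm z) ∘L ofCoord x₁ ((extChartAt (𝓡 n) x₀).symm z)

theorem differentiableAt_coordChange {x₀ x₁ y : M} (hy : y ∈ (extChartAt (𝓡 n) x₀).source)
    (hy' : y ∈ (extChartAt (𝓡 n) x₁).source) :
    DifferentiableAt ℝ (coordChange x₀ x₁) (extChartAt (𝓡 n) x₀ y) := by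
  have h : ContDiffOn ℝ ∞ (coordChange x₀ x₁) ((extChartAt (𝓡 n) x₀).target ∩
      (extChartAt (𝓡 n) x₀).symm ⁻¹' (extChartAt (𝓡 n) x₁).source) := by
    refine contDiffOn_clm_apply.2 fun v z hz ↦ ?_
    have h1 := contDiffAt_fieldCoord ((extChartAt (𝓡 n) x₀).map_target hz.1)
      (isOpen_extChartAt_source x₁) hz.2 (contMDiffOn_coordField x₁ v)
    rw [(extChartAt (𝓡 n) x₀).right_inv hz.1] at h1
    exact h1.contDiffWithinAt
  refine (h.contDiffAt ?_).differentiableAt (by simp)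
  have hz := (extChartAt (𝓡 n) x₀).map_source hy
  refine Filter.inter_mem ((isOpen_extChartAt_target (I := 𝓡 n) x₀).mem_nhds hz) ?_
  refine (continuousAt_extChartAt_symm'' hz) ?_
  rw [(extChartAt (𝓡 n) x₀).left_inv hy]
  exact (isOpen_extChartAt_source x₁).mem_nhds hy'

/-- The covariant derivative along a curve, in coordinates. -/
theorem toCoord_covDerivAlong (D : Connection n M) {x₀ : M} {γ : ℝ → M} {J : Set ℝ}
    (hJ : IsOpen J) {t : ℝ} (ht : t ∈ J) (hx₀ : γ t ∈ (extChartAt (𝓡 n) x₀).source)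
    {V : Π t : ℝ, TangentSpace (𝓡 n) (γ t)} (hV : IsSmoothAlong γ J V) :
    toCoord x₀ (γ t) (covDerivAlong D γ V t) = deriv (fun s ↦ toCoord x₀ (γ s) (V s)) t
      + christoffel D x₀ (extChartAt (𝓡 n) x₀ (γ t)) (toCoord x₀ (γ t) (velocity n γ t))
        (toCoord x₀ (γ t) (V t)) := by
  have hts : (γ t) ∈ (extChartAt (𝓡 n) (γ t)).source := mem_extChartAt_source (γ t)
  have hγ : ContMDiffOn 𝓘(ℝ, ℝ) (𝓡 n) ∞ γ J := fun s hs ↦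
    (contMDiff_proj (TangentSpace (𝓡 n) : M → Type)).contMDiffAt.comp_contMDiffWithinAt s (hV s hs)
  have hγt : MDifferentiableAt 𝓘(ℝ, ℝ) (𝓡 n) γ t :=
    (hγ.contMDiffAt (hJ.mem_nhds ht)).mdifferentiableAt (by simp)
  let J' := J ∩ γ ⁻¹' (extChartAt (𝓡 n) (γ t)).source
  have hJ' : IsOpen J' := hγ.continuousOn.isOpen_inter_preimage hJ (isOpen_extChartAt_source _)
  have ht' : t ∈ J' := ⟨ht, hts⟩
  have hV1 := ((isSmoothAlong_iff (x₀ := (γ t)) fun s (hs : s ∈ J') ↦ hs.2).1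
    (hV.mono inter_subset_left)).2
  have hV1d : DifferentiableAt ℝ (fun s ↦ toCoord (γ t) (γ s) (V s)) t :=
    (hV1.contDiffAt (hJ'.mem_nhds ht')).differentiableAt (by simp)
  have hev0 : (fun s ↦ (trivializationAt (EuclideanSpace ℝ (Fin n))
      (TangentSpace (𝓡 n) : M → Type) (γ t) ⟨γ s, V s⟩).2) =ᶠ[𝓝 t]
      fun s ↦ toCoord (γ t) (γ s) (V s) := by
    filter_upwards [hJ'.mem_nhds ht'] with s hs
    exact (toCoord_eq_snd hs.2 _).symm
  have hγ0 : ∀ᶠ s in 𝓝 t, γ s ∈ (extChartAt (𝓡 n) x₀).source :=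
    hγt.continuousAt.eventually ((isOpen_extChartAt_source x₀).mem_nhds hx₀)
  have hev1 : (fun s ↦ toCoord x₀ (γ s) (V s)) =ᶠ[𝓝 t] fun s ↦
      coordChange x₀ (γ t) (extChartAt (𝓡 n) x₀ (γ s)) (toCoord (γ t) (γ s) (V s)) := by
    filter_upwards [hJ'.mem_nhds ht', hγ0] with s hs hs0
    rw [coordChange, (extChartAt (𝓡 n) x₀).left_inv hs0, ContinuousLinearMap.comp_apply,
      ofCoord_toCoord hs.2]
  have hB := differentiableAt_coordChange hx₀ hts
  have hBc : HasDerivAt (fun s ↦ coordChange x₀ (γ t) (extChartAt (𝓡 n) x₀ (γ s)))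
      (fderiv ℝ (coordChange x₀ (γ t)) (extChartAt (𝓡 n) x₀ (γ t))
        (toCoord x₀ (γ t) (velocity n γ t))) t := by
    have h := hB.hasFDerivAt.comp_hasDerivAt t (hasDerivAt_chart_curve hγt hx₀)
    exact h
  have hprod := hBc.clm_apply hV1d.hasDerivAt
  rw [hev1.deriv_eq, hprod.deriv, covDerivAlong, map_add]
  have hext : FiberBundle.extend (E := (TangentSpace (𝓡 n) : M → Type))
      (EuclideanSpace ℝ (Fin n)) (V t)
      =ᶠ[𝓝 (γ t)] coordField (γ t) (toCoord (γ t) (γ t) (V t)) := by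
    filter_upwards [(isOpen_extChartAt_source (I := 𝓡 n) (γ t)).mem_nhds hts] with y hy
    exact extend_eq_coordField hy _
  have hcf := mdifferentiableAt_coordField hts (toCoord (γ t) (γ t) (V t))
  have h1 : D (FiberBundle.extend (E := (TangentSpace (𝓡 n) : M → Type))
      (EuclideanSpace ℝ (Fin n)) (V t)) (γ t)
      = D (coordField (γ t) (toCoord (γ t) (γ t) (V t))) (γ t) :=
    D.isCovariantDerivativeOn.congr_of_eventuallyEq
      (((contMDiffOn_extend (V t)).contMDiffAt
        ((isOpen_extChartAt_source (γ t)).mem_nhds hts)).mdifferentiableAt (by simp))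
      hcf Filter.univ_mem hext
  rw [h1, toCoord_conn_apply D hx₀ hcf]
  have h2 : coordField (γ t) (toCoord (γ t) (γ t) (V t)) (γ t) = V t := ofCoord_toCoord hts _
  -- The derivative of the coordinate change left by the product rule is the derivative term of `D`
  -- on a coordinate field of the other chart.
  have h3 : fderiv ℝ (fieldCoord x₀ (coordField (γ t) (toCoord (γ t) (γ t) (V t))))
      (extChartAt (𝓡 n) x₀ (γ t)) (toCoord x₀ (γ t) (velocity n γ t))
      = fderiv ℝ (coordChange x₀ (γ t)) (extChartAt (𝓡 n) x₀ (γ t))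
        (toCoord x₀ (γ t) (velocity n γ t)) (toCoord (γ t) (γ t) (V t)) :=
    (fderiv_clm_apply_const hB (toCoord (γ t) (γ t) (V t))).2 _
  have h4 : toCoord x₀ (γ t) ((trivializationAt (EuclideanSpace ℝ (Fin n))
      (TangentSpace (𝓡 n) : M → Type) (γ t)).symm (γ t) (deriv (fun s ↦ (trivializationAt
        (EuclideanSpace ℝ (Fin n)) (TangentSpace (𝓡 n) : M → Type) (γ t) ⟨γ s, V s⟩).2) t))
      = coordChange x₀ (γ t) (extChartAt (𝓡 n) x₀ (γ t))
        (deriv (fun s ↦ toCoord (γ t) (γ s) (V s)) t) := by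
    rw [hev0.deriv_eq, coordChange, (extChartAt (𝓡 n) x₀).left_inv hx₀,
      ContinuousLinearMap.comp_apply, ofCoord,
      Trivialization.symmL_apply _ (mem_baseSet_of_mem_source hts)]
  rw [h2, h3, h4]
  abel

end Curves

/-! ### Geodesics and the Leibniz rule along them, in coordinates -/

section GeodesicsInCoordinates

variable {E : Type*} [NormedAddCommGroup E] [NormedSpace ℝ E] {q : ℕ}

theorem exists_geodesic_coord [CompleteSpace E] {Γ : E → E →L[ℝ] E →L[ℝ] E} {s : Set E}
    (hs : IsOpen s) (hΓ : ContDiffOn ℝ ∞ Γ s) {z : E} (hz : z ∈ s) (v : E) :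
    ∃ ε > 0, ∃ c u : ℝ → E, c 0 = z ∧ u 0 = v ∧ ContDiffOn ℝ ∞ c (Ioo (-ε) ε) ∧
      MapsTo c (Ioo (-ε) ε) s ∧ ∀ t ∈ Ioo (-ε) ε,
        HasDerivAt c (u t) t ∧ HasDerivAt u (-(Γ (c t) (u t) (u t))) t := by
  let f : E × E → E × E := fun w ↦ (w.2, -(Γ w.1 w.2 w.2))
  have hs' : IsOpen (s ×ˢ (univ : Set E)) := hs.prod isOpen_univ
  have hf : ContDiffOn ℝ ∞ f (s ×ˢ univ) := by
    have h1 : ContDiffOn ℝ ∞ (fun w : E × E ↦ Γ w.1) (s ×ˢ univ) :=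
      hΓ.comp contDiffOn_fst fun p hp ↦ hp.1
    exact contDiffOn_snd.prodMk ((h1.clm_apply contDiffOn_snd).clm_apply contDiffOn_snd).neg
  obtain ⟨a, ha0, ε, hε, ha⟩ :=
    ((hf.contDiffAt (hs'.mem_nhds (x := (z, v)) ⟨hz, mem_univ _⟩)).of_le
      (WithTop.coe_le_coe.2 (le_top (a := (1 : ℕ∞)))) :
        ContDiffAt ℝ 1 f (z, v)).exists_forall_mem_closedBall_exists_eq_forall_mem_Ioo_hasDerivAt₀ 0
  simp only [zero_sub, zero_add] at ha
  have hac : ContinuousAt a 0 := (ha 0 ⟨by linarith, hε⟩).continuousAt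
  obtain ⟨δ, hδ, hδs⟩ := Metric.mem_nhds_iff.1
    (hac.preimage_mem_nhds (by rw [ha0]; exact hs'.mem_nhds ⟨hz, mem_univ _⟩))
  have hsub : Ioo (-min ε δ) (min ε δ) ⊆ Ioo (-ε) ε :=
    Ioo_subset_Ioo (neg_le_neg (min_le_left _ _)) (min_le_left _ _)
  have hmem : ∀ t ∈ Ioo (-min ε δ) (min ε δ), a t ∈ s ×ˢ (univ : Set E) := by
    intro t ht
    refine hδs ?_
    rw [Metric.mem_ball, dist_zero_right, Real.norm_eq_abs, abs_lt]
    exact ⟨by linarith [ht.1, min_le_right ε δ], by linarith [ht.2, min_le_right ε δ]⟩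
  have has : ContDiffOn ℝ ∞ a (Ioo (-min ε δ) (min ε δ)) := by
    refine contDiffOn_of_hasFDerivAt (g := fun p : ℝ × E × E ↦
      ContinuousLinearMap.toSpanSingleton ℝ (f p.2)) (t := univ ×ˢ s ×ˢ univ) isOpen_Ioo ?_
      (fun t ht ↦ (ha t (hsub ht)).hasFDerivAt) (fun t ht ↦ ⟨mem_univ _, hmem t ht⟩)
    refine contDiffOn_clm_apply.2 fun r ↦ ?_
    simp only [ContinuousLinearMap.toSpanSingleton_apply]
    have h1 : ContDiffOn ℝ ∞ (fun p : ℝ × E × E ↦ f p.2) (univ ×ˢ s ×ˢ univ) :=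
      hf.comp contDiffOn_snd fun p hp ↦ hp.2
    exact h1.const_smul r
  refine ⟨min ε δ, lt_min hε hδ, fun t ↦ (a t).1, fun t ↦ (a t).2, congrArg Prod.fst ha0,
    congrArg Prod.snd ha0,
    contDiff_fst.comp_contDiffOn has, fun t ht ↦ (hmem t ht).1, fun t ht ↦ ?_⟩
  exact ⟨(hasFDerivAt_fst (p := a t)).comp_hasDerivAt t (ha t (hsub ht)),
    (hasFDerivAt_snd (p := a t)).comp_hasDerivAt t (ha t (hsub ht))⟩

/-- Separates the slot of the velocity, where the geodesic equation acts, from the slots of the test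
fields. -/
theorem sum_update_cons (α : E [⋀^Fin (q + 1)]→ₗ[ℝ] ℝ) (L : E → E) (a : E) (W : Fin q → E) :
    ∑ i, α (Function.update (Fin.cons a W : Fin (q + 1) → E) i
      (L ((Fin.cons a W : Fin (q + 1) → E) i)))
      = α (Fin.cons (L a) W) + ∑ i, α (Fin.cons a (Function.update W i (L (W i)))) := by
  rw [Fin.sum_univ_succ]
  simp only [Fin.cons_zero, Fin.cons_succ, Fin.update_cons_zero, Fin.cons_update]

/-- The derivative of `α(u, W_1, …, W_q)` along a curve `c` with velocity `u`. -/
theorem hasDerivAt_alternating_curve [FiniteDimensional ℝ E] {α : E → E [⋀^Fin (q + 1)]→ₗ[ℝ] ℝ}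
    {c u : ℝ → E} {u' : E} {W : Fin q → ℝ → E} {W' : Fin q → E} {t : ℝ}
    (hα : ∀ Z, DifferentiableAt ℝ (fun y ↦ α y Z) (c t)) (hc : HasDerivAt c (u t) t)
    (hu : HasDerivAt u u' t) (hW : ∀ i, HasDerivAt (W i) (W' i) t) :
    HasDerivAt (fun s ↦ α (c s) (Fin.cons (u s) fun i ↦ W i s))
      (fderiv ℝ (fun y ↦ α y (Fin.cons (u t) fun i ↦ W i t)) (c t) (u t)
        + (α (c t) (Fin.cons u' fun i ↦ W i t)
          + ∑ i, α (c t) (Fin.cons (u t) (Function.update (fun i ↦ W i t) i (W' i))))) t := by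
  let Y : Fin (q + 1) → ℝ → E := Fin.cons u W
  let Y' : Fin (q + 1) → ℝ →L[ℝ] E := Fin.cons (ContinuousLinearMap.toSpanSingleton ℝ u')
    fun i ↦ ContinuousLinearMap.toSpanSingleton ℝ (W' i)
  have hYe : ∀ s, (Fin.cons (u s) (fun i ↦ W i s) : Fin (q + 1) → E) = fun i ↦ Y i s := by
    intro s
    funext i
    refine Fin.cases rfl (fun i ↦ rfl) i
  have hY' : ∀ i, HasFDerivAt (Y i) (Y' i) t := by
    intro i
    refine Fin.cases hu.hasFDerivAt (fun i ↦ (hW i).hasFDerivAt) i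
  have hαc : ∀ Z, HasDerivAt (fun s ↦ α (c s) Z) (fderiv ℝ (fun y ↦ α y Z) (c t) (u t)) t := by
    intro Z
    have h := (hα Z).hasFDerivAt.comp_hasDerivAt t hc
    exact h
  have h := hasFDerivAt_alternating_apply (α := fun s ↦ α (c s))
    (fun Z ↦ (hαc Z).differentiableAt) hY'
  have h1 := h.1.hasDerivAt
  have h2 := h.2 1
  rw [fderiv_apply_one_eq_deriv, fderiv_apply_one_eq_deriv, ← hYe, (hαc _).deriv,
    Fin.sum_univ_succ] at h2
  rw [h2] at h1
  have e0 : ∀ i, Y' i 1 = (Fin.cons u' W' : Fin (q + 1) → E) i := by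
    intro i
    refine Fin.cases ?_ (fun i ↦ ?_) i
    · exact one_smul ℝ u'
    · exact one_smul ℝ (W' i)
  simp only [← hYe, e0, Fin.cons_zero, Fin.cons_succ, Fin.update_cons_zero, ← Fin.cons_update]
    at h1
  exact h1

end GeodesicsInCoordinates

/-! ### Killing–Yano tensors correspond to solutions of the coordinate equation -/

section Dictionary

variable {n : ℕ} {M : Type*} [TopologicalSpace M] [ChartedSpace (EuclideanSpace ℝ (Fin n)) M]
  [IsManifold (𝓡 n) ∞ M] {k q : ℕ}

/-- The components of a field of forms in the chart at `x₀`. -/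
def formCoord (x₀ : M) (θ : Π x : M, FormAt n k x) (z : Eucl n) : Eucl n [⋀^Fin k]→ₗ[ℝ] ℝ :=
  (θ ((extChartAt (𝓡 n) x₀).symm z)).compLinearMap
    (ofCoord x₀ ((extChartAt (𝓡 n) x₀).symm z)).toLinearMap

theorem formCoord_apply {x₀ y : M} (hy : y ∈ (extChartAt (𝓡 n) x₀).source)
    (θ : Π x : M, FormAt n k x) (Y : Fin k → TangentSpace (𝓡 n) y) :
    formCoord x₀ θ (extChartAt (𝓡 n) x₀ y) (fun i ↦ toCoord x₀ y (Y i)) = θ y Y := by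
  have h : ∀ y', y' = y → ∀ Y : Fin k → Eucl n,
      θ y' (fun i ↦ ofCoord x₀ y' (Y i)) = θ y (fun i ↦ ofCoord x₀ y (Y i)) := by
    rintro y' rfl Y
    rfl
  refine (h _ ((extChartAt (𝓡 n) x₀).left_inv hy) _).trans ?_
  simp only [ofCoord_toCoord hy]

theorem formCoord_smooth [T2Space M] {x₀ : M} {θ : Π x : M, FormAt n k x} {U : Set M}
    (hU : IsOpen U) (hθ : IsSmoothFormOn θ U) (Y : Fin k → Eucl n) :
    ContDiffOn ℝ ∞ (fun z ↦ formCoord x₀ θ z Y)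
      ((extChartAt (𝓡 n) x₀).target ∩ (extChartAt (𝓡 n) x₀).symm ⁻¹' U) := by
  intro z hz
  have hy := (extChartAt (𝓡 n) x₀).map_target hz.1
  choose X hX hXY using fun i ↦ exists_smoothField_eventuallyEq (isOpen_extChartAt_source x₀) hy
    (contMDiffOn_coordField x₀ (Y i))
  have h1 := contDiffOn_chart_of_contMDiffOn (x₀ := x₀) (hθ X hX)
  have hc : ContinuousAt (extChartAt (𝓡 n) x₀).symm z := continuousAt_extChartAt_symm'' hz.1
  have hN : (extChartAt (𝓡 n) x₀).target ∩ (extChartAt (𝓡 n) x₀).symm ⁻¹' U ∈ 𝓝 z :=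
    Filter.inter_mem ((isOpen_extChartAt_target (I := 𝓡 n) x₀).mem_nhds hz.1)
      (hc (hU.mem_nhds hz.2))
  refine ((h1.contDiffAt hN).congr_of_eventuallyEq ?_).contDiffWithinAt
  filter_upwards [hc.eventually (Filter.eventually_all.2 hXY)] with w hw
  change θ _ _ = θ _ _
  congr 1
  funext i
  exact (hw i).symm

theorem isSmoothFormOn_of_formCoord {x₀ : M} {θ : Π x : M, FormAt n k x} {U : Set M}
    (hU : IsOpen U) (hUs : U ⊆ (extChartAt (𝓡 n) x₀).source) {s : Set (Eucl n)}
    (hs : MapsTo (extChartAt (𝓡 n) x₀) U s)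
    (hθ : ∀ Y, ContDiffOn ℝ ∞ (fun z ↦ formCoord x₀ θ z Y) s) : IsSmoothFormOn θ U := by
  intro X hX
  have h1 : ContDiffOn ℝ ∞ (fun z ↦ formCoord x₀ θ z (fun i ↦ fieldCoord x₀ (X i) z))
      (s ∩ extChartAt (𝓡 n) x₀ '' U) := by
    refine contDiffOn_alternating_apply (fun Y ↦ (hθ Y).mono inter_subset_left) fun i ↦ ?_
    rintro _ ⟨-, y, hy, rfl⟩
    exact (contDiffAt_fieldCoord (hUs hy) hU hy (hX i).contMDiffOn).contDiffWithinAt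
  refine (contMDiffOn_of_contDiffOn_chart hUs h1
    fun y hy ↦ ⟨hs hy, mem_image_of_mem _ hy⟩).congr fun y hy ↦ ?_
  simp only [fieldCoord_apply (hUs hy)]
  exact (formCoord_apply (hUs hy) θ _).symm

theorem interior_apply {V : Type*} [AddCommGroup V] [Module ℝ V]
    (α : V [⋀^Fin (q + 1)]→ₗ[ℝ] ℝ) (v : V) (W : Fin q → V) :
    interior (p := q + 1) α v W = α (Fin.cons v W) := rfl

theorem interior_formCoord {x₀ y : M} (hy : y ∈ (extChartAt (𝓡 n) x₀).source)
    (θ : Π x : M, FormAt n (q + 1) x) (v : TangentSpace (𝓡 n) y)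
    (W : Fin q → TangentSpace (𝓡 n) y) :
    interior (p := q + 1) (θ y) v W = formCoord x₀ θ (extChartAt (𝓡 n) x₀ y)
      (Fin.cons (toCoord x₀ y v) fun i ↦ toCoord x₀ y (W i)) := by
  rw [interior_apply, ← formCoord_apply hy]
  congr 1
  funext i
  refine Fin.cases rfl (fun i ↦ rfl) i

/-- The velocity of a geodesic satisfies the geodesic equation in coordinates. -/
theorem IsGeodesicOn.hasDerivAt_velocity {D : Connection n M} {x₀ : M} {γ : ℝ → M} {J : Set ℝ}
    (hJ : IsOpen J) (hγ : IsGeodesicOn D γ J) {t : ℝ} (ht : t ∈ J)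
    (hx₀ : γ t ∈ (extChartAt (𝓡 n) x₀).source) :
    HasDerivAt (fun s ↦ toCoord x₀ (γ s) (velocity n γ s))
      (-(christoffel D x₀ (extChartAt (𝓡 n) x₀ (γ t)) (toCoord x₀ (γ t) (velocity n γ t))
        (toCoord x₀ (γ t) (velocity n γ t)))) t := by
  have h := toCoord_covDerivAlong D hJ ht hx₀ (isSmoothAlong_velocity hJ hγ.smooth)
  rw [hγ.eq_zero t ht, map_zero] at h
  have hJ' : IsOpen (J ∩ γ ⁻¹' (extChartAt (𝓡 n) x₀).source) :=
    hγ.smooth.continuousOn.isOpen_inter_preimage hJ (isOpen_extChartAt_source _)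
  have h1 := ((contDiffOn_velocity hJ' (fun s hs ↦ hs.2)
    (hγ.smooth.mono inter_subset_left)).contDiffAt (hJ'.mem_nhds ⟨ht, hx₀⟩)).differentiableAt
      (by simp)
  rw [← eq_neg_of_add_eq_zero_left h.symm]
  exact h1.hasDerivAt

/-- Along a geodesic with velocity `u`, the term from `u' = -Γ(u, u)` cancels the velocity slot of
the coordinate equation; the other slots assemble to covariant derivatives of the test fields. -/
theorem isKillingYanoOn_of_isKYCoord {S : EquiaffineStructure n M} {x₀ : M}
    {θ : Π x : M, FormAt n (q + 1) x} {U : Set M} (hU : IsOpen U)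
    (hUs : U ⊆ (extChartAt (𝓡 n) x₀).source) {s : Set (Eucl n)} (hs : IsOpen s)
    (hUV : MapsTo (extChartAt (𝓡 n) x₀) U s)
    (hθ : IsKYCoord (christoffel S.conn x₀) (formCoord x₀ θ) s) : IsKillingYanoOn S U θ := by
  refine ⟨isSmoothFormOn_of_formCoord hU hUs hUV hθ.smooth, ?_⟩
  intro γ J hJ hJ' hγU hγ V hV t ht
  have hγs : MapsTo γ J (extChartAt (𝓡 n) x₀).source := fun t ht ↦ hUs (hγU ht)
  have hγt := (hγ.smooth.contMDiffAt (hJ.mem_nhds ht)).mdifferentiableAt (by simp)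
  have hc := hasDerivAt_chart_curve hγt (hγs ht)
  have hu := hγ.hasDerivAt_velocity hJ ht (hγs ht)
  have hW : ∀ i, HasDerivAt (fun s ↦ toCoord x₀ (γ s) (V i s))
      (deriv (fun s ↦ toCoord x₀ (γ s) (V i s)) t) t := fun i ↦
    (((((isSmoothAlong_iff hγs).1 (hV i)).2).contDiffAt (hJ.mem_nhds ht)).differentiableAt
      (by simp)).hasDerivAt
  have key := hasDerivAt_alternating_curve (α := formCoord x₀ θ)
    (u := fun s ↦ toCoord x₀ (γ s) (velocity n γ s))
    (fun Z ↦ ((hθ.smooth Z).contDiffAt (hs.mem_nhds (hUV (hγU ht)))).differentiableAt (by simp))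
    hc hu hW
  have hcov := fun i ↦ (toCoord_covDerivAlong S.conn hJ ht (hγs ht) (hV i)).trans (add_comm _ _)
  have hev : (fun s ↦ interior (p := q + 1) (θ (γ s)) (velocity n γ s) (fun i ↦ V i s)) =ᶠ[𝓝 t]
      fun s ↦ formCoord x₀ θ (extChartAt (𝓡 n) x₀ (γ s))
        (Fin.cons (toCoord x₀ (γ s) (velocity n γ s)) fun i ↦ toCoord x₀ (γ s) (V i s)) := by
    filter_upwards [hJ.mem_nhds ht] with s hs
    exact interior_formCoord (hγs hs) θ _ _
  refine (key.congr_of_eventuallyEq hev).congr_deriv ?_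
  rw [hθ.eqn _ (hUV (hγU ht)), sum_update_cons (formCoord x₀ θ (extChartAt (𝓡 n) x₀ (γ t)))
    (christoffel S.conn x₀ (extChartAt (𝓡 n) x₀ (γ t)) (toCoord x₀ (γ t) (velocity n γ t)))]
  have hneg : ∀ (α : Eucl n [⋀^Fin (q + 1)]→ₗ[ℝ] ℝ) a (W : Fin q → Eucl n),
      α (Fin.cons (-a) W) = -α (Fin.cons a W) := by
    intro α a W
    have h := α.map_update_neg (Fin.cons a W : Fin (q + 1) → Eucl n) 0 a
    simpa only [Fin.update_cons_zero] using h
  have hadd : ∀ (α : Eucl n [⋀^Fin (q + 1)]→ₗ[ℝ] ℝ) a (W : Fin q → Eucl n) i b b',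
      α (Fin.cons a (Function.update W i (b + b'))) =
        α (Fin.cons a (Function.update W i b)) + α (Fin.cons a (Function.update W i b')) := by
    intro α a W i b b'
    simp only [Fin.cons_update, α.map_update_add]
  rw [hneg, add_add_add_comm, add_neg_cancel, zero_add, ← Finset.sum_add_distrib]
  refine Finset.sum_congr rfl fun i _ ↦ ?_
  rw [← hadd, ← hcov]
  refine Eq.trans ?_ (interior_formCoord (hγs ht) θ (velocity n γ t) _).symm
  congr 2
  funext j
  by_cases hj : j = i
  · subst hj
    simp only [Function.update_self]
  · simp only [Function.update_of_ne hj]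

/-- The equation at `z` for `v` and `Z` is the parallelism condition at time 0 along the geodesic
through `z` with velocity `v`. -/
theorem IsKillingYanoOn.isKYCoord [T2Space M] {S : EquiaffineStructure n M} {x₀ : M}
    {θ : Π x : M, FormAt n (q + 1) x} {U : Set M} (hU : IsOpen U) (hθ : IsKillingYanoOn S U θ) :
    IsKYCoord (christoffel S.conn x₀) (formCoord x₀ θ)
      ((extChartAt (𝓡 n) x₀).target ∩ (extChartAt (𝓡 n) x₀).symm ⁻¹' U) := by
  refine ⟨formCoord_smooth hU hθ.smooth, fun z hz v Z ↦ ?_⟩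
  set κ := extChartAt (𝓡 n) x₀ with hκ
  have hs : IsOpen (κ.target ∩ κ.symm ⁻¹' U) :=
    (continuousOn_extChartAt_symm x₀).isOpen_inter_preimage (isOpen_extChartAt_target x₀) hU
  obtain ⟨ε, hε, c, u, hc0, hu0, hcs, hcm, hcu⟩ := exists_geodesic_coord hs
    ((contDiffOn_christoffel S.smooth_conn x₀).mono inter_subset_left) hz v
  set J := Ioo (-ε) ε with hJdef
  have hJ : IsOpen J := isOpen_Ioo
  have h0 : (0 : ℝ) ∈ J := ⟨by linarith, hε⟩
  let γ : ℝ → M := fun t ↦ κ.symm (c t)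
  have hγs : MapsTo γ J κ.source := fun t ht ↦ κ.map_target (hcm ht).1
  have hκγ : ∀ t ∈ J, κ (γ t) = c t := fun t ht ↦ κ.right_inv (hcm ht).1
  have hγsm : ContMDiffOn 𝓘(ℝ, ℝ) (𝓡 n) ∞ γ J :=
    (contMDiffOn_extChartAt_symm x₀).comp (contMDiffOn_iff_contDiffOn.2 hcs)
      fun t ht ↦ (hcm ht).1
  have hvel : ∀ t ∈ J, toCoord x₀ (γ t) (velocity n γ t) = u t := by
    intro t ht
    have h1 := hasDerivAt_chart_curve
      ((hγsm.contMDiffAt (hJ.mem_nhds ht)).mdifferentiableAt (by simp)) (hγs ht)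
    refine h1.unique ((hcu t ht).1.congr_of_eventuallyEq ?_)
    filter_upwards [hJ.mem_nhds ht] with s hs
    exact hκγ s hs
  have hgeo : IsGeodesicOn S.conn γ J := by
    refine ⟨hγsm, fun t ht ↦ ?_⟩
    have h1 := toCoord_covDerivAlong S.conn hJ ht (hγs ht) (isSmoothAlong_velocity hJ hγsm)
    have h2 : (fun s ↦ toCoord x₀ (γ s) (velocity n γ s)) =ᶠ[𝓝 t] u := by
      filter_upwards [hJ.mem_nhds ht] with s hs
      exact hvel s hs
    rw [h2.deriv_eq, (hcu t ht).2.deriv, hvel t ht, show extChartAt (𝓡 n) x₀ (γ t) = c t from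
      hκγ t ht, neg_add_cancel] at h1
    rw [← ofCoord_toCoord (hγs ht) (covDerivAlong S.conn γ (velocity n γ) t), h1, map_zero]
  -- Test fields with constant components: their covariant derivatives reduce to Christoffel terms.
  let V : Fin q → Π t : ℝ, TangentSpace (𝓡 n) (γ t) := fun i t ↦ ofCoord x₀ (γ t) (Z i)
  have hVc : ∀ i, ∀ t ∈ J, toCoord x₀ (γ t) (V i t) = Z i := fun i t ht ↦
    toCoord_ofCoord (hγs ht) _
  have hV : ∀ i, IsSmoothAlong γ J (V i) := fun i ↦
    (isSmoothAlong_iff hγs).2 ⟨hγsm, contDiffOn_const.congr fun t ht ↦ hVc i t ht⟩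
  have hpar := hθ.parallel γ J hJ ordConnected_Ioo (fun t ht ↦ (hcm ht).2) hgeo V hV 0 h0
  have hκ0 : κ (γ 0) = z := (hκγ 0 h0).trans hc0
  have hcov : ∀ i, toCoord x₀ (γ 0) (covDerivAlong S.conn γ (V i) 0)
      = christoffel S.conn x₀ z v (Z i) := by
    intro i
    have h1 := toCoord_covDerivAlong S.conn hJ h0 (hγs h0) (hV i)
    have h2 : (fun s ↦ toCoord x₀ (γ s) (V i s)) =ᶠ[𝓝 0] fun _ ↦ Z i := by
      filter_upwards [hJ.mem_nhds h0] with s hs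
      exact hVc i s hs
    rw [h1, h2.deriv_eq, deriv_const, hvel 0 h0, hVc i 0 h0, hu0,
      show extChartAt (𝓡 n) x₀ (γ 0) = z from hκ0, zero_add]
  have key := hasDerivAt_alternating_curve (α := formCoord x₀ θ) (c := c) (u := u) (t := 0)
    (W := fun i _ ↦ Z i) (W' := fun _ ↦ 0)
    (fun Y ↦ by
      rw [hc0]
      exact ((formCoord_smooth hU hθ.smooth Y).contDiffAt (hs.mem_nhds hz)).differentiableAt
        (by simp))
    (hcu 0 h0).1 (hcu 0 h0).2 (fun i ↦ hasDerivAt_const _ _)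
  have hev : (fun s ↦ interior (p := q + 1) (θ (γ s)) (velocity n γ s) (fun i ↦ V i s)) =ᶠ[𝓝 0]
      fun s ↦ formCoord x₀ θ (c s) (Fin.cons (u s) fun i ↦ Z i) := by
    filter_upwards [hJ.mem_nhds h0] with s hs
    rw [interior_formCoord (hγs hs), hvel s hs, show extChartAt (𝓡 n) x₀ (γ s) = c s from hκγ s hs]
    simp only [hVc _ s hs]
  have heq := (key.congr_of_eventuallyEq hev).unique hpar
  rw [hc0, hu0] at heq
  have hzero : ∀ i, formCoord x₀ θ z (Fin.cons v (Function.update Z i (0 : Eucl n))) = 0 := by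
    intro i
    rw [Fin.cons_update]
    exact (formCoord x₀ θ z).map_coord_zero i.succ (by simp)
  have hneg : ∀ (α : Eucl n [⋀^Fin (q + 1)]→ₗ[ℝ] ℝ) a (W : Fin q → Eucl n),
      α (Fin.cons (-a) W) = -α (Fin.cons a W) := by
    intro α a W
    have h := α.map_update_neg (Fin.cons a W : Fin (q + 1) → Eucl n) 0 a
    simpa only [Fin.update_cons_zero] using h
  have hrhs : ∀ i, interior (p := q + 1) (θ (γ 0)) (velocity n γ 0)
      (Function.update (fun j ↦ V j 0) i (covDerivAlong S.conn γ (V i) 0))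
      = formCoord x₀ θ z (Fin.cons v (Function.update Z i (christoffel S.conn x₀ z v (Z i)))) := by
    intro i
    rw [interior_formCoord (hγs h0), hvel 0 h0, hu0, show extChartAt (𝓡 n) x₀ (γ 0) = z from hκ0]
    congr 2
    funext j
    by_cases hj : j = i
    · subst hj
      simp only [Function.update_self, hcov]
    · simp only [Function.update_of_ne hj, hVc _ 0 h0]
  have hsum := Finset.sum_congr (rfl : (Finset.univ : Finset (Fin q)) = _) fun i _ ↦ hrhs i
  rw [sum_update_cons (formCoord x₀ θ z) (christoffel S.conn x₀ z v)]
  rw [hneg, Finset.sum_eq_zero fun i _ ↦ hzero i] at heq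
  have heq' := heq.trans hsum
  rw [← heq']
  ring

end Dictionary

/-! ### Flat sections over simply connected spaces -/

section Sections

/-- A locally constant cocycle on a simply connected space has global flat sections with any
prescribed value at a point. -/
theorem exists_flat_section {X Λ : Type*} [TopologicalSpace X] [SimplyConnectedSpace X]
    [LocallyPathConnectedSpace X] (N : X → Set X) (hN : ∀ i, IsOpen (N i)) (hmem : ∀ x, x ∈ N x)
    (T : X → X → X → Λ → Λ) (hself : ∀ i, ∀ x ∈ N i, ∀ v, T i i x v = v)
    (hcomp : ∀ i j k, ∀ x ∈ N i ∩ N j ∩ N k, ∀ v, T j k x (T i j x v) = T i k x v)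
    (hT : ∀ i j, ∀ x ∈ N i ∩ N j, ∀ v, ∀ᶠ y in 𝓝 x, T i j y v = T i j x v) (x₀ : X) (v₀ : Λ) :
    ∃ s : X → Λ, s x₀ = v₀ ∧ ∀ y, ∀ᶠ z in 𝓝 y, T z y z (s z) = s y := by
  -- With discrete fibres, local constancy of the cocycle is continuity of the transition maps, and
  -- the bundle is a covering. A lift of the identity is the required section.
  let _ : TopologicalSpace Λ := ⊥
  have : DiscreteTopology Λ := ⟨rfl⟩
  let Z : FiberBundleCore X X Λ :=
    { baseSet := N
      isOpen_baseSet := hN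
      indexAt := id
      mem_baseSet_at := hmem
      coordChange := T
      coordChange_self := hself
      coordChange_comp := hcomp
      continuousOn_coordChange := by
        rintro i j ⟨x, v⟩ ⟨hx, -⟩
        refine ContinuousAt.continuousWithinAt ?_
        refine (continuousAt_const (y := T i j x v)).congr ?_
        rw [nhds_prod_eq, nhds_discrete Λ, Filter.prod_pure]
        refine Filter.eventually_map.2 ?_
        filter_upwards [hT i j x hx v] with y hy
        exact hy.symm }
  have : ∀ x, DiscreteTopology (Z.Fiber x) := fun x ↦ ⟨rfl⟩
  have hcov : IsCoveringMap (TotalSpace.proj : TotalSpace Λ Z.Fiber → X) :=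
    FiberBundle.isCoveringMap
  obtain ⟨F, ⟨hF0, hF⟩, -⟩ := hcov.existsUnique_continuousMap_lifts (ContinuousMap.id X) x₀
    (⟨x₀, v₀⟩ : TotalSpace Λ Z.Fiber) rfl
  have hproj : ∀ x, (F x).proj = x := fun x ↦ congr_fun hF x
  let s : X → Λ := fun x ↦ (F x).2
  refine ⟨s, ?_, fun y ↦ ?_⟩
  · change ((F x₀).2 : Λ) = v₀
    rw [hF0]
  · have hy : F y ∈ (Z.localTriv y).source := by
      rw [FiberBundleCore.mem_localTriv_source, hproj]
      exact hmem y
    have hc : ContinuousAt (fun z ↦ (Z.localTriv y (F z)).2) y :=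
      continuousAt_snd.comp (((Z.localTriv y).continuousAt hy).comp F.continuous.continuousAt)
    have hv : ∀ z, (Z.localTriv y (F z)).2 = T z y z (s z) := by
      intro z
      rw [FiberBundleCore.localTriv_apply]
      change T (F z).proj y (F z).proj (s z) = _
      rw [hproj]
    simp only [hv] at hc
    have h1 := hc.eventually (IsOpen.mem_nhds (isOpen_discrete {T y y y (s y)}) rfl)
    filter_upwards [h1] with z hz
    rw [mem_singleton_iff.1 hz, hself y y (hmem y)]

end Sections

/-! ### Locality and local models -/

section Local

variable {n : ℕ} {M : Type*} [TopologicalSpace M] [ChartedSpace (EuclideanSpace ℝ (Fin n)) M]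
  [IsManifold (𝓡 n) ∞ M] {p q : ℕ} {S : EquiaffineStructure n M}

/-- Being a Killing–Yano tensor is a local property. -/
theorem isKillingYanoOn_of_locally {θ : Π x : M, FormAt n p x} {U : Set M}
    (h : ∀ x ∈ U, ∃ W, IsOpen W ∧ x ∈ W ∧ ∃ θ', IsKillingYanoOn S W θ' ∧ ∀ y ∈ W, θ y = θ' y) :
    IsKillingYanoOn S U θ := by
  refine ⟨fun Y hY x hx ↦ ?_, fun γ J hJ hJ' hγU hγ V hV t ht ↦ ?_⟩
  · obtain ⟨W, hW, hxW, θ', hθ', heq⟩ := h x hx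
    refine ((((hθ'.smooth Y hY).contMDiffAt (hW.mem_nhds hxW))).congr_of_eventuallyEq
      ?_).contMDiffWithinAt
    filter_upwards [hW.mem_nhds hxW] with y hy
    rw [heq y hy]
  · obtain ⟨W, hW, hxW, θ', hθ', heq⟩ := h (γ t) (hγU ht)
    have hO : IsOpen (J ∩ γ ⁻¹' W) := hγ.smooth.continuousOn.isOpen_inter_preimage hJ hW
    -- The definition tests intervals only, and `J ∩ γ ⁻¹' W` need not be one.
    obtain ⟨ε, hε, hsub⟩ := Metric.isOpen_iff.1 hO t ⟨ht, hxW⟩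
    have hsubJ : Metric.ball t ε ⊆ J := fun s hs ↦ (hsub hs).1
    have htε : t ∈ Metric.ball t ε := Metric.mem_ball_self hε
    have key := hθ'.parallel γ (Metric.ball t ε) Metric.isOpen_ball
      (by rw [Real.ball_eq_Ioo]; exact ordConnected_Ioo) (fun s hs ↦ (hsub hs).2)
      ⟨hγ.smooth.mono hsubJ, fun s hs ↦ hγ.eq_zero s (hsubJ hs)⟩ V
      (fun i ↦ (hV i).mono hsubJ) t htε
    simp only at key ⊢
    rw [← heq (γ t) hxW] at key
    refine key.congr_of_eventuallyEq ?_
    filter_upwards [hO.mem_nhds ⟨ht, hxW⟩] with s hs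
    rw [heq (γ s) hs.2]

theorem IsKillingYanoOn.mono {θ : Π x : M, FormAt n p x} {U W : Set M} (hU : IsOpen U)
    (h : IsKillingYanoOn S U θ) (hWU : W ⊆ U) : IsKillingYanoOn S W θ :=
  isKillingYanoOn_of_locally fun _ hx ↦ ⟨U, hU, hWU hx, θ, h, fun _ _ ↦ rfl⟩

theorem IsKillingYanoOn.congr {θ θ' : Π x : M, FormAt n p x} {U : Set M} (hU : IsOpen U)
    (h : IsKillingYanoOn S U θ') (heq : ∀ y ∈ U, θ y = θ' y) : IsKillingYanoOn S U θ :=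
  isKillingYanoOn_of_locally fun _ hx ↦ ⟨U, hU, hx, θ', h, heq⟩

/-- The constant forms on the tractor bundle. -/
abbrev ModelSpace (n q : ℕ) : Type := (ℝ × Eucl n) [⋀^Fin (q + 2)]→ₗ[ℝ] ℝ

/-- `ρ` parametrizes the Killing–Yano tensors on the connected open subsets of `N`. -/
structure IsLocalModel (S : EquiaffineStructure n M) (N : Set M)
    (ρ : ModelSpace n q →ₗ[ℝ] Π x : M, FormAt n (q + 1) x) : Prop where
  isOpen : IsOpen N
  isKillingYanoOn : ∀ Ψ, IsKillingYanoOn S N (ρ Ψ)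
  exists_eq : ∀ W ⊆ N, IsOpen W → IsPreconnected W → ∀ θ, IsKillingYanoOn S W θ →
    ∃ Ψ, ∀ y ∈ W, θ y = ρ Ψ y
  eq_zero : ∀ y ∈ N, ∀ Ψ, (∀ᶠ z in 𝓝 y, ρ Ψ z = 0) → Ψ = 0

/-- The field of forms with the components `modelForm (G z) Ψ` in the chart at `x₀`. -/
def modelField (q : ℕ) (x₀ : M) (G : Eucl n → (ℝ × Eucl n) →L[ℝ] (ℝ × Eucl n)) :
    ModelSpace n q →ₗ[ℝ] Π x : M, FormAt n (q + 1) x where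
  toFun Ψ y := (modelForm (G (extChartAt (𝓡 n) x₀ y)) Ψ).compLinearMap
    (toCoord x₀ y).toLinearMap
  map_add' _ _ := rfl
  map_smul' _ _ := rfl

theorem modelField_apply {x₀ : M} {G : Eucl n → (ℝ × Eucl n) →L[ℝ] (ℝ × Eucl n)}
    (Ψ : ModelSpace n q) (y : M) (Y : Fin (q + 1) → TangentSpace (𝓡 n) y) :
    modelField q x₀ G Ψ y Y =
      modelForm (G (extChartAt (𝓡 n) x₀ y)) Ψ (fun i ↦ toCoord x₀ y (Y i)) := rfl

theorem formCoord_modelField {x₀ : M} {G : Eucl n → (ℝ × Eucl n) →L[ℝ] (ℝ × Eucl n)}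
    {z : Eucl n} (hz : z ∈ (extChartAt (𝓡 n) x₀).target) (Ψ : ModelSpace n q) :
    formCoord x₀ (modelField q x₀ G Ψ) z = modelForm (G z) Ψ := by
  ext Y
  have hy := (extChartAt (𝓡 n) x₀).map_target hz
  change modelForm (G (extChartAt (𝓡 n) x₀ ((extChartAt (𝓡 n) x₀).symm z))) Ψ
    (fun i ↦ toCoord x₀ _ (ofCoord x₀ _ (Y i))) = _
  simp only [toCoord_ofCoord hy, (extChartAt (𝓡 n) x₀).right_inv hz]

theorem eq_modelField {x₀ y : M} (hy : y ∈ (extChartAt (𝓡 n) x₀).source)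
    {G : Eucl n → (ℝ × Eucl n) →L[ℝ] (ℝ × Eucl n)} {θ : Π x : M, FormAt n (q + 1) x}
    {Ψ : ModelSpace n q}
    (h : formCoord x₀ θ (extChartAt (𝓡 n) x₀ y) = modelForm (G (extChartAt (𝓡 n) x₀ y)) Ψ) :
    θ y = modelField q x₀ G Ψ y := by
  ext Y
  rw [modelField_apply, ← h, formCoord_apply hy]

theorem exists_isLocalModel [T2Space M] (hn : 2 < n) (hS : S.IsEquiprojective) (x₀ : M) :
    ∃ (N : Set M) (ρ : ModelSpace n q →ₗ[ℝ] Π x : M, FormAt n (q + 1) x),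
      x₀ ∈ N ∧ IsLocalModel S N ρ := by
  set κ := extChartAt (𝓡 n) x₀ with hκ
  have ht : IsOpen κ.target := isOpen_extChartAt_target x₀
  obtain ⟨r, hr, hball, P, G, H, hG⟩ := (isProjFlat_christoffel hS x₀).exists_tractorFrame ht
    (by rw [finrank_euclideanSpace_fin]; exact hn) (mem_extChartAt_target x₀)
  set B := Metric.ball (κ x₀) r with hB
  have hBo : IsOpen B := Metric.isOpen_ball
  have hc : ContinuousOn κ κ.source := continuousOn_extChartAt x₀
  have hcs : ContinuousOn κ.symm κ.target := continuousOn_extChartAt_symm x₀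
  have hN : IsOpen (κ.source ∩ κ ⁻¹' B) :=
    hc.isOpen_inter_preimage (isOpen_extChartAt_source x₀) hBo
  refine ⟨κ.source ∩ κ ⁻¹' B, modelField q x₀ G, ⟨mem_extChartAt_source x₀,
    Metric.mem_ball_self hr⟩, hN, fun Ψ ↦ ?_, fun W hWN hW hWc θ hθ ↦ ?_, fun y hy Ψ hΨ ↦ ?_⟩
  · refine isKillingYanoOn_of_isKYCoord hN inter_subset_left hBo (fun y hy ↦ hy.2) ?_
    have h := hG.isKYCoord_modelForm hBo Ψ
    have heq : ∀ z ∈ B, formCoord x₀ (modelField q x₀ G Ψ) z = modelForm (G z) Ψ :=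
      fun z hz ↦ formCoord_modelField (hball hz) Ψ
    refine ⟨fun Y ↦ (h.smooth Y).congr fun z hz ↦ by rw [heq z hz], fun z hz v Z ↦ ?_⟩
    rw [heq z hz, ← h.eqn z hz v Z]
    refine congrArg (fun L : Eucl n →L[ℝ] ℝ ↦ L v) (Filter.EventuallyEq.fderiv_eq ?_)
    filter_upwards [hBo.mem_nhds hz] with w hw
    rw [heq w hw]
  · have hWs : W ⊆ κ.source := fun y hy ↦ (hWN hy).1
    have himg : κ '' W = κ.target ∩ κ.symm ⁻¹' W := κ.image_eq_target_inter_inv_preimage hWs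
    have hs : IsOpen (κ '' W) := by
      rw [himg]
      exact hcs.isOpen_inter_preimage ht hW
    have hsB : κ '' W ⊆ B := by
      rintro _ ⟨y, hy, rfl⟩
      exact (hWN hy).2
    have h1 : IsKYCoord (christoffel S.conn x₀) (formCoord x₀ θ) (κ '' W) := by
      rw [himg]
      exact hθ.isKYCoord hW
    obtain ⟨Ψ, hΨ⟩ := h1.exists_eq_modelForm (hG.mono hsB)
      ((contDiffOn_christoffel S.smooth_conn x₀).mono (hsB.trans hball)) hs
      (hWc.image κ (hc.mono hWs))
    exact ⟨Ψ, fun y hy ↦ eq_modelField (hWs hy) (hΨ _ (mem_image_of_mem _ hy))⟩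
  · refine hG.eq_zero_of_modelForm_eq_zero hBo hy.2 ?_
    have hz : κ y ∈ κ.target := κ.map_source hy.1
    have hcy : ContinuousAt κ.symm (κ y) := continuousAt_extChartAt_symm'' hz
    have h1 : ∀ᶠ w in 𝓝 (κ y), modelField q x₀ G Ψ (κ.symm w) = 0 :=
      Filter.Tendsto.eventually (p := fun z ↦ modelField q x₀ G Ψ z = 0) hcy
        (by rwa [κ.left_inv hy.1])
    filter_upwards [h1, ht.mem_nhds hz] with w hw hwt
    rw [← formCoord_modelField hwt, formCoord]
    exact (congrArg (fun α ↦ AlternatingMap.compLinearMap α _) hw).trans (by ext; rfl)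

end Local

/-! ### Dimension of the space of constant forms -/

theorem finrank_alternatingMap (V : Type*) [AddCommGroup V] [Module ℝ V] [FiniteDimensional ℝ V]
    (k : ℕ) : Module.finrank ℝ (V [⋀^Fin k]→ₗ[ℝ] ℝ) = (Module.finrank ℝ V).choose k := by
  rw [(exteriorPower.alternatingMapLinearEquiv (R := ℝ) (M := V) (N := ℝ) (n := k)).finrank_eq]
  exact Subspace.dual_finrank_eq.trans (exteriorPower.finrank_eq ..)

instance (n q : ℕ) : FiniteDimensional ℝ (ModelSpace n q) :=
  Module.Finite.equiv (exteriorPower.alternatingMapLinearEquiv (R := ℝ) (M := ℝ × Eucl n)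
    (N := ℝ) (n := q + 2)).symm

theorem finrank_modelSpace {n q : ℕ} (h : q + 1 ≤ n) :
    Module.finrank ℝ (ModelSpace n q) = (n + 1)! / ((q + 1 + 1)! * (n - (q + 1))!) := by
  rw [finrank_alternatingMap, Module.finrank_prod, Module.finrank_self, finrank_euclideanSpace_fin,
    add_comm 1 n, Nat.choose_eq_factorial_div_factorial (by omega)]
  congr 3
  omega

/-! ### Unique continuation, extension and dimension -/

section Global

variable {n : ℕ} {M : Type*} [TopologicalSpace M] [ChartedSpace (EuclideanSpace ℝ (Fin n)) M]
  [IsManifold (𝓡 n) ∞ M] {p q : ℕ} {S : EquiaffineStructure n M}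

theorem exists_connected_nhds {n : ℕ} {M : Type*} [TopologicalSpace M]
    [ChartedSpace (EuclideanSpace ℝ (Fin n)) M] {x : M} {V : Set M} (hV : V ∈ 𝓝 x) :
    ∃ U ⊆ V, IsOpen U ∧ x ∈ U ∧ IsConnected U := by
  have := ChartedSpace.locallyConnectedSpace (EuclideanSpace ℝ (Fin n)) M
  exact locallyConnectedSpace_iff_subsets_isOpen_isConnected.1 this x V hV

open Classical in
/-- Restriction of fields of forms to `W`, followed by extension by zero. -/
def cutoff (W : Set M) (p : ℕ) :
    (Π x : M, FormAt n p x) →ₗ[ℝ] Π x : M, FormAt n p x where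
  toFun θ x := if x ∈ W then θ x else 0
  map_add' θ θ' := by
    funext x
    by_cases hx : x ∈ W <;> simp [hx]
  map_smul' c θ := by
    funext x
    by_cases hx : x ∈ W <;> simp [hx]

omit [IsManifold (𝓡 n) ∞ M] in
theorem cutoff_of_mem {W : Set M} {x : M} (hx : x ∈ W) (θ : Π x : M, FormAt n p x) :
    cutoff W p θ x = θ x := if_pos hx

omit [IsManifold (𝓡 n) ∞ M] in
theorem cutoff_of_notMem {W : Set M} {x : M} (hx : x ∉ W) (θ : Π x : M, FormAt n p x) :
    cutoff W p θ x = 0 := if_neg hx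

theorem cutoff_mem {W : Set M} (hW : IsOpen W) {θ : Π x : M, FormAt n p x}
    (hθ : IsKillingYanoOn S W θ) : cutoff W p θ ∈ killingYanoSpace S p W :=
  ⟨hθ.congr hW fun _ hy ↦ cutoff_of_mem hy θ, fun _ hx ↦ cutoff_of_notMem hx θ⟩

/-- The restriction of Killing–Yano tensors to a smaller open set. -/
def restrict (S : EquiaffineStructure n M) (p : ℕ) {U W : Set M} (hU : IsOpen U) (hW : IsOpen W)
    (hWU : W ⊆ U) : killingYanoSpace S p U →ₗ[ℝ] killingYanoSpace S p W :=
  ((cutoff W p).comp (killingYanoSpace S p U).subtype).codRestrict _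
    fun θ ↦ cutoff_mem hW (θ.2.1.mono hU hWU)

variable {N : Set M} {ρ : ModelSpace n q →ₗ[ℝ] Π x : M, FormAt n (q + 1) x}

/-- The Killing–Yano tensor on `U` with the given parameter. -/
def IsLocalModel.param (h : IsLocalModel S N ρ) {U : Set M} (hU : IsOpen U) (hUN : U ⊆ N) :
    ModelSpace n q →ₗ[ℝ] killingYanoSpace S (q + 1) U :=
  ((cutoff U (q + 1)).comp ρ).codRestrict _
    fun Ψ ↦ cutoff_mem hU ((h.isKillingYanoOn Ψ).mono h.isOpen hUN)

theorem IsLocalModel.param_bijective (h : IsLocalModel S N ρ) {U : Set M} (hU : IsOpen U)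
    (hUN : U ⊆ N) (hc : IsConnected U) : Function.Bijective (h.param hU hUN) := by
  refine ⟨(injective_iff_map_eq_zero _).2 fun Ψ hΨ ↦ ?_, fun θ ↦ ?_⟩
  · obtain ⟨y, hy⟩ := hc.nonempty
    refine h.eq_zero y (hUN hy) Ψ ?_
    filter_upwards [hU.mem_nhds hy] with z hz
    rw [← cutoff_of_mem hz (ρ Ψ)]
    exact congr_fun (congrArg Subtype.val hΨ) z
  · obtain ⟨Ψ, hΨ⟩ := h.exists_eq U hUN hU hc.isPreconnected θ θ.2.1
    refine ⟨Ψ, Subtype.ext (funext fun y ↦ ?_)⟩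
    change cutoff U (q + 1) (ρ Ψ) y = _
    by_cases hy : y ∈ U
    · rw [cutoff_of_mem hy, hΨ y hy]
    · rw [cutoff_of_notMem hy, θ.2.2 y hy]

/-- Killing–Yano tensors on a connected small open set correspond to constant forms on the
tractor bundle. -/
def IsLocalModel.equiv (h : IsLocalModel S N ρ) {U : Set M} (hU : IsOpen U)
    (hUN : U ⊆ N) (hc : IsConnected U) : ModelSpace n q ≃ₗ[ℝ] killingYanoSpace S (q + 1) U :=
  LinearEquiv.ofBijective _ (h.param_bijective hU hUN hc)

theorem exists_nhds_equiv [T2Space M] (hn : 2 < n) (hS : S.IsEquiprojective) {x : M} {V : Set M}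
    (hV : V ∈ 𝓝 x) : ∃ U ⊆ V, IsOpen U ∧ x ∈ U ∧ IsConnected U ∧
      Nonempty (ModelSpace n q ≃ₗ[ℝ] killingYanoSpace S (q + 1) U) := by
  obtain ⟨N, ρ, hx, h⟩ := exists_isLocalModel (q := q) hn hS x
  obtain ⟨U, hUV, hU, hxU, hc⟩ :=
    exists_connected_nhds (n := n) (Filter.inter_mem hV (h.isOpen.mem_nhds hx))
  exact ⟨U, fun y hy ↦ (hUV hy).1, hU, hxU, hc, ⟨h.equiv hU (fun y hy ↦ (hUV hy).2) hc⟩⟩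

/-- The identity theorem for Killing–Yano tensors. -/
theorem IsKillingYanoOn.eq_zero_of_eventually [T2Space M] (hn : 2 < n) (hS : S.IsEquiprojective)
    {U : Set M} (hU : IsOpen U) (hc : IsPreconnected U) {θ : Π x : M, FormAt n (q + 1) x}
    (hθ : IsKillingYanoOn S U θ) {x : M} (hx : x ∈ U) (h0 : ∀ᶠ y in 𝓝 x, θ y = 0) :
    ∀ y ∈ U, θ y = 0 := by
  have hA : IsOpen {y | ∀ᶠ z in 𝓝 y, θ z = 0} := isOpen_setOfPred_eventually_nhds
  -- The points with vanishing germ form an open set, also closed in `U`: near a limit point `θ` has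
  -- a single parameter, which is zero because it is zero at a nearby point.
  refine fun y hy ↦ (hc.subset_of_closure_inter_subset hA ⟨x, hx, h0⟩ ?_ hy).self_of_nhds
  rintro y ⟨hyA, hyU⟩
  obtain ⟨N, ρ, hyN, h⟩ := exists_isLocalModel (q := q) hn hS y
  obtain ⟨W, hWV, hW, hyW, hWc⟩ := exists_connected_nhds (n := n)
    (Filter.inter_mem (hU.mem_nhds hyU) (h.isOpen.mem_nhds hyN))
  obtain ⟨Ψ, hΨ⟩ := h.exists_eq W (fun z hz ↦ (hWV hz).2) hW hWc.isPreconnected θ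
    (hθ.mono hU fun z hz ↦ (hWV hz).1)
  obtain ⟨a, haW, haA⟩ := mem_closure_iff.1 hyA W hW hyW
  have hΨ0 : Ψ = 0 := by
    refine h.eq_zero a (hWV haW).2 Ψ ?_
    filter_upwards [haA, hW.mem_nhds haW] with z hz hzW
    rw [← hΨ z hzW, hz]
  change ∀ᶠ z in 𝓝 y, θ z = 0
  filter_upwards [hW.mem_nhds hyW] with z hz
  rw [hΨ z hz, hΨ0, map_zero]
  rfl

theorem restrict_injective [T2Space M] (hn : 2 < n) (hS : S.IsEquiprojective) {U W : Set M}
    (hU : IsOpen U) (hc : IsPreconnected U) (hW : IsOpen W) (hWU : W ⊆ U) (hW0 : W.Nonempty) :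
    Function.Injective (restrict S (q + 1) hU hW hWU) := by
  refine (injective_iff_map_eq_zero _).2 fun θ hθ ↦ Subtype.ext (funext fun y ↦ ?_)
  obtain ⟨x, hx⟩ := hW0
  by_cases hy : y ∈ U
  · refine θ.2.1.eq_zero_of_eventually hn hS hU hc (hWU hx) ?_ y hy
    filter_upwards [hW.mem_nhds hx] with z hz
    rw [← cutoff_of_mem hz (θ : Π x : M, FormAt n (q + 1) x)]
    exact congr_fun (congrArg Subtype.val hθ) z
  · exact θ.2.2 y hy

/-- Change of parameters between local models. -/
theorem IsLocalModel.existsUnique_change {N' : Set M}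
    {ρ' : ModelSpace n q →ₗ[ℝ] Π x : M, FormAt n (q + 1) x} (h : IsLocalModel S N ρ)
    (h' : IsLocalModel S N' ρ') {y : M} (hy : y ∈ N ∩ N') (Ψ : ModelSpace n q) :
    ∃! Ψ', ∀ᶠ z in 𝓝 y, ρ' Ψ' z = ρ Ψ z := by
  obtain ⟨W, hWN, hW, hyW, hWc⟩ := exists_connected_nhds (n := n)
    ((h.isOpen.inter h'.isOpen).mem_nhds hy)
  obtain ⟨Ψ', hΨ'⟩ := h'.exists_eq W (fun z hz ↦ (hWN hz).2) hW hWc.isPreconnected _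
    ((h.isKillingYanoOn Ψ).mono h.isOpen fun z hz ↦ (hWN hz).1)
  have hev : ∀ᶠ z in 𝓝 y, ρ' Ψ' z = ρ Ψ z := by
    filter_upwards [hW.mem_nhds hyW] with z hz
    exact (hΨ' z hz).symm
  refine ⟨Ψ', hev, fun Ψ'' hΨ'' ↦ sub_eq_zero.1 (h'.eq_zero y hy.2 _ ?_)⟩
  filter_upwards [hev, hΨ''] with z hz hz'
  rw [map_sub, Pi.sub_apply, hz, hz', sub_self]

/-- On simply connected open sets, Killing–Yano tensors extend from connected open subsets. -/
theorem restrict_surjective [T2Space M] (hn : 2 < n) (hS : S.IsEquiprojective) {U W : Set M}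
    (hU : IsOpen U) [SimplyConnectedSpace U] (hW : IsOpen W) (hWU : W ⊆ U) (hWc : IsConnected W) :
    Function.Surjective (restrict S (q + 1) hU hW hWU) := by
  classical
  intro θ₀
  have := ChartedSpace.locallyPathConnectedSpace (EuclideanSpace ℝ (Fin n)) M
  have := hU.locallyPathConnectedSpace
  choose N ρ hmem hmodel using exists_isLocalModel (S := S) (q := q) hn hS
  obtain ⟨x₀, hx₀⟩ := hWc.nonempty
  obtain ⟨W', hW'N, hW', hxW', hW'c⟩ := exists_connected_nhds (n := n)
    (Filter.inter_mem (hW.mem_nhds hx₀) ((hmodel x₀).isOpen.mem_nhds (hmem x₀)))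
  obtain ⟨Ψ₀, hΨ₀⟩ := (hmodel x₀).exists_eq W' (fun z hz ↦ (hW'N hz).2) hW' hW'c.isPreconnected θ₀
    (θ₀.2.1.mono hW fun z hz ↦ (hW'N hz).1)
  -- `T i j y` is the change of parameters at `y`. Uniqueness `hTu` yields the cocycle identities,
  -- and also local constancy, as an equality of germs at `y` persists at nearby points.
  choose! T hT hTu using fun (i j y : M) (hy : y ∈ N i ∩ N j) (Ψ : ModelSpace n q) ↦
    (hmodel i).existsUnique_change (hmodel j) hy Ψ
  obtain ⟨s, hs0, hs⟩ := exists_flat_section (X := U) (Λ := ModelSpace n q)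
    (fun i ↦ Subtype.val ⁻¹' N i) (fun i ↦ (hmodel i).isOpen.preimage continuous_subtype_val)
    (fun i ↦ hmem i) (fun i j y ↦ T i j y)
    (fun i y hy Ψ ↦ (hTu i i y ⟨hy, hy⟩ Ψ Ψ (Filter.Eventually.of_forall fun z ↦ rfl)).symm)
    (fun i j k y hy Ψ ↦ by
      refine hTu i k y ⟨hy.1.1, hy.2⟩ Ψ _ ?_
      filter_upwards [hT i j y hy.1 Ψ, hT j k y ⟨hy.1.2, hy.2⟩ (T i j y Ψ)] with z h1 h2
      rw [h2, h1])
    (fun i j y hy Ψ ↦ by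
      have h1 : ∀ᶠ z in 𝓝 (y : M), T i j z Ψ = T i j y Ψ := by
        filter_upwards [eventually_eventually_nhds.2 (hT i j y hy Ψ),
          ((hmodel i).isOpen.inter (hmodel j).isOpen).mem_nhds hy] with z hz hz'
        exact (hTu i j z hz' Ψ _ hz).symm
      exact continuous_subtype_val.continuousAt.eventually h1)
    ⟨x₀, hWU hx₀⟩ Ψ₀
  -- Each point uses its own local model; flatness of `s` says that near `y` all of them agree with
  -- the model at `y`.
  let θ : Π x : M, FormAt n (q + 1) x := fun y ↦ if hy : y ∈ U then ρ y (s ⟨y, hy⟩) y else 0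
  have hθ : ∀ y : U, ∀ᶠ z in 𝓝 (y : M), θ z = ρ y (s y) z := by
    intro y
    have h1 : ∀ᶠ z in 𝓝 (y : M), ∀ hz : z ∈ U, T z y z (s ⟨z, hz⟩) = s y := by
      have h2 := hs y
      rw [nhds_subtype, Filter.eventually_comap] at h2
      filter_upwards [h2] with z hz hzU
      exact hz ⟨z, hzU⟩ rfl
    filter_upwards [h1, hU.mem_nhds y.2, (hmodel y).isOpen.mem_nhds (hmem y)] with z hz hzU hzN
    have h3 := (hT z y z ⟨hmem z, hzN⟩ (s ⟨z, hzU⟩)).self_of_nhds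
    rw [hz hzU] at h3
    rw [h3]
    exact dif_pos hzU
  have hKY : IsKillingYanoOn S U θ := by
    refine isKillingYanoOn_of_locally fun y hy ↦ ?_
    obtain ⟨O, hO, hOo, hyO⟩ := eventually_nhds_iff.1 (hθ ⟨y, hy⟩)
    exact ⟨O ∩ N y, hOo.inter (hmodel y).isOpen, ⟨hyO, hmem y⟩, ρ y (s ⟨y, hy⟩),
      ((hmodel y).isKillingYanoOn _).mono (hmodel y).isOpen inter_subset_right,
      fun z hz ↦ hO z hz.1⟩
  refine ⟨⟨cutoff U (q + 1) θ, cutoff_mem hU hKY⟩, sub_eq_zero.1 (Subtype.ext (funext fun y ↦ ?_))⟩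
  -- The extension agrees with `θ₀` near `x₀` by the choice of the initial parameter, hence on all
  -- of `W` by the identity theorem.
  set δ := restrict S (q + 1) hU hW hWU ⟨cutoff U (q + 1) θ, cutoff_mem hU hKY⟩ - θ₀ with hδ
  by_cases hy : y ∈ W
  · refine δ.2.1.eq_zero_of_eventually hn hS hW hWc.isPreconnected hx₀ ?_ y hy
    filter_upwards [hθ ⟨x₀, hWU hx₀⟩, hW'.mem_nhds hxW'] with z hz hzW'
    have hzW := (hW'N hzW').1
    change cutoff W (q + 1) (cutoff U (q + 1) θ) z - (θ₀ : Π x : M, FormAt n (q + 1) x) z = 0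
    rw [cutoff_of_mem hzW, cutoff_of_mem (hWU hzW), hz, hs0, hΨ₀ z hzW', sub_self]
  · exact δ.2.2 y hy

/-- The space of Killing–Yano tensors on a simply connected open set has maximal dimension. -/
theorem finrank_killingYanoSpace_of_simplyConnected [T2Space M] (hn : 2 < n)
    (hS : S.IsEquiprojective) {U : Set M} (hU : IsOpen U) [SimplyConnectedSpace U] :
    Module.finrank ℝ (killingYanoSpace S (q + 1) U) = Module.finrank ℝ (ModelSpace n q) := by
  have hc : IsConnected U := isConnected_iff_connectedSpace.2 inferInstance
  obtain ⟨x, hx⟩ := hc.nonempty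
  obtain ⟨W, hWU, hW, hxW, hWc, ⟨e⟩⟩ := exists_nhds_equiv (q := q) hn hS (hU.mem_nhds hx)
  rw [e.finrank_eq]
  exact (LinearEquiv.ofBijective (restrict S (q + 1) hU hW hWU)
    ⟨restrict_injective hn hS hU hc.isPreconnected hW hWU ⟨x, hxW⟩,
      restrict_surjective hn hS hU hW hWU hWc⟩).finrank_eq

theorem finrank_killingYanoSpace_le [T2Space M] (hn : 2 < n) (hS : S.IsEquiprojective)
    {U : Set M} (hU : IsOpen U) (hc : IsConnected U) :
    FiniteDimensional ℝ (killingYanoSpace S (q + 1) U) ∧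
      Module.finrank ℝ (killingYanoSpace S (q + 1) U) ≤ Module.finrank ℝ (ModelSpace n q) := by
  obtain ⟨x, hx⟩ := hc.nonempty
  obtain ⟨W, hWU, hW, hxW, hWc, ⟨e⟩⟩ := exists_nhds_equiv (q := q) hn hS (hU.mem_nhds hx)
  have hinj : Function.Injective (e.symm.toLinearMap ∘ₗ restrict S (q + 1) hU hW hWU) :=
    e.symm.injective.comp (restrict_injective hn hS hU hc.isPreconnected hW hWU ⟨x, hxW⟩)
  exact ⟨Module.Finite.of_injective _ hinj, LinearMap.finrank_le_finrank_of_injective hinj⟩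

end Global

end KillingYano

end

/-! ### The main theorem -/

theorem corollary1 (n p : ℕ) (hn : 2 < n) (hp : 1 ≤ p) (hpn : p ≤ n - 1)
    (M : Type*) [TopologicalSpace M] [T2Space M] [SecondCountableTopology M] [ConnectedSpace M]
    [ChartedSpace (EuclideanSpace ℝ (Fin n)) M] [IsManifold (𝓡 n) ∞ M]
    (S : KillingYano.EquiaffineStructure n M) (hS : S.IsEquiprojective) :
    -- `K^p` has the asserted dimension locally, on arbitrarily small neighbourhoods,
    (∀ (x : M), ∀ V ∈ 𝓝 x, ∃ U ⊆ V, IsOpen U ∧ IsConnected U ∧ x ∈ U ∧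
      Module.finrank ℝ (KillingYano.killingYanoSpace S p U)
        = (n + 1)! / ((p + 1)! * (n - p)!)) ∧
    -- on every simply connected open set, in particular on `M` if `M` is simply connected,
    (∀ U : Set M, IsOpen U → SimplyConnectedSpace U →
      Module.finrank ℝ (KillingYano.killingYanoSpace S p U)
        = (n + 1)! / ((p + 1)! * (n - p)!)) ∧
    -- and it is the maximal dimension on every connected open set, in particular on `M`.
    (∀ U : Set M, IsOpen U → IsConnected U →
      FiniteDimensional ℝ (KillingYano.killingYanoSpace S p U) ∧
      Module.finrank ℝ (KillingYano.killingYanoSpace S p U)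
        ≤ (n + 1)! / ((p + 1)! * (n - p)!)) := by
  obtain ⟨q, rfl⟩ : ∃ q, p = q + 1 := ⟨p - 1, by omega⟩
  have hdim := KillingYano.finrank_modelSpace (n := n) (q := q) (by omega)
  refine ⟨fun x V hV ↦ ?_, fun U hU _ ↦ ?_, fun U hU hc ↦ ?_⟩
  · obtain ⟨U, hUV, hU, hx, hc, ⟨e⟩⟩ := KillingYano.exists_nhds_equiv (q := q) hn hS hV
    exact ⟨U, hUV, hU, hc, hx, by rw [← e.finrank_eq, hdim]⟩
  · rw [KillingYano.finrank_killingYanoSpace_of_simplyConnected hn hS hU, hdim]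
  · rw [← hdim]
    exact KillingYano.finrank_killingYanoSpace_le hn hS hU hc
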